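/- Let $q\in L^1_{\rm loc}(\mathbb R)$ be complex-valued, $\sigma_4=\begin{pmatrix}0&1\\-1&0\end{pmatrix}$, and let $\widetilde H$ be the maximally defined operator in $L^2(\mathbb R)^2$ generated by $$\widetilde{\mathscr H}=-\sigma_4\frac{d}{dx}+i\begin{pmatrix}-\operatorname{Re} q&-\operatorname{Im} q\\-\operatorname{Im} q&\operatorname{Re} q\end{pmatrix},$$ that is, $\operatorname{dom}(\widetilde H)=\{\Psi\in L^2(\mathbb R)^2\cap AC_{\rm loc}(\mathbb R)^2 : \widetilde{\mathscr H}\Psi\in L^2(\mathbb R)^2\}$. Fix $\theta\in\mathbb R$ and let $\Theta(z,\cdot),\Phi(z,\cdot)$ be the solutions of $\widetilde{\mathscr H}\Psi=z\Psi$ with $\Theta(z,0)=(\cos\theta,\sin\theta)^\top$, $\Phi(z,0)=(-\sin\theta,\cos\theta)^\top$; put $\mathcal F(z,x)=(\Theta(z,x)\ \Phi(z,x))$ and $$(T_0f)(\lambda)=\int_{\mathbb R}\mathcal F(\lambda,x)^\top f(x)\,dx .$$ For $z$ in the resolvent set of $\widetilde H$ let $\Theta+\widetilde m_\pm(z)\Phi$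 be square integrable at $\pm\infty$, and let $$\widetilde M=\begin{pmatrix}\frac1{\widetilde m_--\widetilde m_+}&\frac12\frac{\widetilde m_-+\widetilde m_+}{\widetilde m_--\widetilde m_+}\\ \frac12\frac{\widetilde m_-+\widetilde m_+}{\widetilde m_--\widetilde m_+}&\frac{\widetilde m_-\widetilde m_+}{\widetilde m_--\widetilde m_+}\end{pmatrix}.$$ If $\Phi(z,\cdot)$ itself is square integrable at $+\infty$ or at $-\infty$, then $\widetilde m_+(z)=\infty$ or $\widetilde m_-(z)=\infty$, respectively, and $\widetilde M(z)$ is given by the corresponding limit of this formula. Equivalently, if $c_0\Theta+c_1\Phi$ and $d_0\Theta+d_1\Phi$ are nonzero and square integrable at $+\infty$ and $-\infty$, then $\widetilde M=\frac12(\widetilde\Gamma+\widetilde\Gamma^\top)$ with $\widetilde\Gamma=(c_0d_1-c_1d_0)^{-1}\,c\,d^\top$. Let $\lambda_1<\lambda_2$ be real and assume the following. (i) There are $\varepsilon_0,\delta_0>0$ such that every point of the spectrum of $\widetilde H$ in $\{z:\lambda_1\le\operatorname{Re}z\le\lambda_2+\delta_0,\ |\operatorname{Im}z|\le\varepsilon_0\}$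 is real. With the same $\varepsilon_0,\delta_0$, there is a constant $C$ with $\varepsilon|\widetilde M_{\ell,\ell'}(\lambda+i\varepsilon)|\le C$ for all $\lambda\in[\lambda_1,\lambda_2+\delta_0]$, $0<\varepsilon\le\varepsilon_0$, and $\varepsilon|\widetilde M_{\ell,\ell'}(\lambda+i\varepsilon)+\widetilde M_{\ell,\ell'}(\lambda-i\varepsilon)|\to0$ as $\varepsilon\downarrow0$ for each $\lambda\in[\lambda_1,\lambda_2+\delta_0]$, in both cases for $\ell,\ell'\in\{0,1\}$. (ii) There is a $2\times2$ matrix $\widetilde\Omega$ of complex Borel measures such that, for all $\lambda_1\le a<b\le\lambda_2$, $$\widetilde\Omega((a,b])=\frac1{2\pi i}\lim_{\delta\downarrow0}\lim_{\varepsilon\downarrow0}\int_{a+\delta}^{b+\delta}\big[\widetilde M(\lambda+i\varepsilon)-\widetilde M(\lambda-i\varepsilon)\big]\,d\lambda ,$$ where the inner limit exists for all sufficiently small $\delta>0$. (iii) There is a bounded projection (idempotent) $E((\lambda_1,\lambda_2])$ on $L^2(\mathbb R)^2$ such that for all $f,g\in C_0^\infty(\mathbb R)^2$ $$\langle f,E((\lambda_1,\lambda_2])g\rangle=\lim_{\delta\downarrow0}\lim_{\varepsilon\downarrow0}\frac1{2\pi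 i}\int_{\lambda_1+\delta}^{\lambda_2+\delta}\big\langle f,\big[(\widetilde H-(\lambda+i\varepsilon))^{-1}-(\widetilde H-(\lambda-i\varepsilon))^{-1}\big]g\big\rangle\,d\lambda ,$$ where the inner limit exists for all sufficiently small $\delta>0$, and $\langle\cdot,\cdot\rangle$ is the inner product of $L^2(\mathbb R)^2$, linear in the second entry. Then, for all $f,g\in C_0^\infty(\mathbb R)^2$, $$\langle f,E((\lambda_1,\lambda_2])g\rangle=\int_{(\lambda_1,\lambda_2]}\big((T_0\overline f)(\lambda)\big)^\top\,d\widetilde\Omega(\lambda)\,(T_0g)(\lambda),$$ where the right-hand side denotes $\sum_{\ell,\ell'}\int_{(\lambda_1,\lambda_2]}(T_0\overline f)_\ell\,(T_0g)_{\ell'}\,d\widetilde\Omega_{\ell,\ell'}$ and all these integrals exist. -/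

import Mathlib

open MeasureTheory Filter Topology Set
open scoped ContDiff ENNReal Matrix

noncomputable section

namespace DiracSpectral

/-- `ℂ²` with its Euclidean norm. -/
abbrev C2 : Type := EuclideanSpace ℂ (Fin 2)

/-- The Hilbert space `L²(ℝ)²`; its inner product is linear in the second entry. -/
abbrev L2 : Type := Lp C2 2 (volume : Measure ℝ)

/-- Multiplication of a vector in `ℂ²` by a `2 × 2` matrix. -/
def act (A : Matrix (Fin 2) (Fin 2) ℂ) (v : C2) : C2 := WithLp.toLp 2 (A *ᵥ v.ofLp)

/-- `σ₄`. -/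
def sigma4 : Matrix (Fin 2) (Fin 2) ℂ := !![0, 1; -1, 0]

/-- The potential `B̃(x) = i ( -Re q, -Im q ; -Im q, Re q )`. -/
def potential (q : ℝ → ℂ) (x : ℝ) : Matrix (Fin 2) (Fin 2) ℂ :=
  Complex.I • !![-((q x).re : ℂ), -((q x).im : ℂ); -((q x).im : ℂ), ((q x).re : ℂ)]

/-- Local absolute continuity on `ℝ`. -/
def IsACLoc (ψ : ℝ → C2) : Prop := ∀ a b : ℝ, AbsolutelyContinuousOnInterval ψ a b

/-- The differential expression `-σ₄ ψ' + B̃ ψ`. -/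
def hamExpr (q : ℝ → ℂ) (ψ : ℝ → C2) (x : ℝ) : C2 :=
  -act sigma4 (deriv ψ x) + act (potential q x) (ψ x)

lemma act_add (A : Matrix (Fin 2) (Fin 2) ℂ) (v w : C2) : act A (v + w) = act A v + act A w := by
  simp only [act, WithLp.ofLp_add, Matrix.mulVec_add, WithLp.toLp_add]

lemma act_smul (A : Matrix (Fin 2) (Fin 2) ℂ) (c : ℂ) (v : C2) :
    act A (c • v) = c • act A v := by
  simp only [act, WithLp.ofLp_smul, Matrix.mulVec_smul, WithLp.toLp_smul]

lemma act_zero (A : Matrix (Fin 2) (Fin 2) ℂ) : act A 0 = 0 := by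
  simp [act]

lemma IsACLoc.ae_differentiableAt {ψ : ℝ → C2} (h : IsACLoc ψ) :
    ∀ᵐ x : ℝ, DifferentiableAt ℝ ψ x := by
  refine LocallyBoundedVariationOn.ae_differentiableAt ?_
  intro a b _ _
  exact (h a b).boundedVariationOn.mono
    (fun x hx => Icc_subset_uIcc hx.2)

lemma IsACLoc.continuous {ψ : ℝ → C2} (h : IsACLoc ψ) : Continuous ψ := by
  rw [continuous_iff_continuousAt]
  intro x
  refine (h (x - 1) (x + 1)).continuousOn.continuousAt ?_
  rw [uIcc_of_le (by linarith)]
  exact Icc_mem_nhds (by linarith) (by linarith)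

/-- The graph of the maximal operator: pairs `(u, v)` in `L²(ℝ)² × L²(ℝ)²` such that `u` has a
locally absolutely continuous representative `ψ` with `-σ₄ ψ' + B̃ ψ = v` a.e. -/
def hamGraph (q : ℝ → ℂ) : Submodule ℂ (L2 × L2) where
  carrier := {p | ∃ ψ : ℝ → C2, IsACLoc ψ ∧ p.1 =ᵐ[volume] ψ ∧ p.2 =ᵐ[volume] hamExpr q ψ}
  zero_mem' := by
    refine ⟨fun _ => 0, ?_, ?_, ?_⟩
    · intro a b
      exact (contDiffOn_const (c := (0 : C2))).absolutelyContinuousOnInterval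
    · exact Lp.coeFn_zero C2 2 volume
    · refine (Lp.coeFn_zero C2 2 volume).trans (Eventually.of_forall fun x => ?_)
      simp [hamExpr, act_zero]
  add_mem' := by
    rintro ⟨u, v⟩ ⟨u', v'⟩ ⟨ψ, hψ, hu, hv⟩ ⟨φ, hφ, hu', hv'⟩
    refine ⟨ψ + φ, fun a b => (hψ a b).add (hφ a b), ?_, ?_⟩
    · exact (Lp.coeFn_add u u').trans (hu.add hu')
    · refine (Lp.coeFn_add v v').trans ?_
      filter_upwards [hv, hv', hψ.ae_differentiableAt, hφ.ae_differentiableAt]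
        with x h1 h2 h3 h4
      simp only [Pi.add_apply] at *
      rw [h1, h2]
      simp only [hamExpr, deriv_add h3 h4, act_add, Pi.add_apply]
      abel
  smul_mem' := by
    rintro c ⟨u, v⟩ ⟨ψ, hψ, hu, hv⟩
    refine ⟨fun x => c • ψ x, fun a b => (hψ a b).const_smul c, ?_, ?_⟩
    · refine (Lp.coeFn_smul c u).trans ?_
      filter_upwards [hu] with x h1
      simp only [Pi.smul_apply] at *
      rw [h1]
    · refine (Lp.coeFn_smul c v).trans ?_
      filter_upwards [hv, hψ.ae_differentiableAt] with x h1 h3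
      simp only [Pi.smul_apply] at *
      rw [h1]
      have : deriv (fun y => c • ψ y) x = c • deriv ψ x := (h3.hasDerivAt.const_smul c).deriv
      simp only [hamExpr, this, act_smul, smul_add, smul_neg]

/-- The maximal operator `H̃` in `L²(ℝ)²`. -/
def hamOp (q : ℝ → ℂ) : L2 →ₗ.[ℂ] L2 := (hamGraph q).toLinearPMap

/-- `hamGraph q` is indeed the graph of `hamOp q`. -/
theorem hamOp_graph (q : ℝ → ℂ) : (hamOp q).graph = hamGraph q := by
  refine Submodule.toLinearPMap_graph_eq _ ?_
  rintro ⟨u, v⟩ ⟨ψ, hψ, hu, hv⟩ h0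
  simp only at *
  have hψ0 : ψ =ᵐ[volume] fun _ => (0 : C2) := by
    subst h0
    exact hu.symm.trans (Lp.coeFn_zero C2 2 volume)
  have hψ1 : ψ = fun _ => (0 : C2) :=
    Continuous.ae_eq_iff_eq volume hψ.continuous continuous_const |>.1 hψ0
  refine Lp.ext ?_
  refine hv.trans (EventuallyEq.trans ?_ (Lp.coeFn_zero C2 2 volume).symm)
  refine Eventually.of_forall fun x => ?_
  subst hψ1
  simp [hamExpr, act_zero]

/-- `R` is a bounded everywhere defined two-sided inverse of `A - z`. -/
def IsResolventAt (A : L2 →ₗ.[ℂ] L2) (z : ℂ) (R : L2 →L[ℂ] L2) : Prop :=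
  (∀ g : L2, ∃ h : R g ∈ A.domain, A ⟨R g, h⟩ - z • R g = g) ∧
    ∀ u : A.domain, R (A u - z • (u : L2)) = u

/-- The spectrum of a partially defined operator. -/
def spec (A : L2 →ₗ.[ℂ] L2) : Set ℂ := {z | ¬ ∃ R : L2 →L[ℂ] L2, IsResolventAt A z R}

open Classical in
/-- The resolvent `(A - z)⁻¹`, with value `0` on the spectrum. -/
def resolventOp (A : L2 →ₗ.[ℂ] L2) (z : ℂ) : L2 →L[ℂ] L2 :=
  if h : ∃ R : L2 →L[ℂ] L2, IsResolventAt A z R then h.choose else 0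

/-- Solutions (on `ℝ`) of `-σ₄ ψ' + B̃ ψ = z ψ`. -/
def IsSolution (q : ℝ → ℂ) (z : ℂ) (ψ : ℝ → C2) : Prop :=
  IsACLoc ψ ∧ ∀ᵐ x : ℝ, hamExpr q ψ x = z • ψ x

open Classical in
/-- The solution with `ψ(0) = v` (it exists and is unique for locally integrable `q`). -/
def ivpSol (q : ℝ → ℂ) (z : ℂ) (v : C2) : ℝ → C2 :=
  if h : ∃ ψ, IsSolution q z ψ ∧ ψ 0 = v then h.choose else 0

/-- `Θ(z, ·, α)`, for `α = (cos θ, sin θ)`. -/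
def solTheta (q : ℝ → ℂ) (θ : ℝ) (z : ℂ) : ℝ → C2 :=
  ivpSol q z !₂[(Real.cos θ : ℂ), (Real.sin θ : ℂ)]

/-- `Φ(z, ·, α)`, for `α = (cos θ, sin θ)`. -/
def solPhi (q : ℝ → ℂ) (θ : ℝ) (z : ℂ) : ℝ → C2 :=
  ivpSol q z !₂[-(Real.sin θ : ℂ), (Real.cos θ : ℂ)]

/-- The fundamental matrix `(Θ Φ)`. -/
def fundMat (q : ℝ → ℂ) (θ : ℝ) (z : ℂ) (x : ℝ) : Matrix (Fin 2) (Fin 2) ℂ :=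
  !![solTheta q θ z x 0, solPhi q θ z x 0; solTheta q θ z x 1, solPhi q θ z x 1]

/-- The solution `c₀ Θ + c₁ Φ`. -/
def solComb (q : ℝ → ℂ) (θ : ℝ) (z : ℂ) (c : Fin 2 → ℂ) (x : ℝ) : C2 :=
  c 0 • solTheta q θ z x + c 1 • solPhi q θ z x

/-- `c` and `d` are the coordinates, relative to `(Θ, Φ)`, of nonzero solutions which are square
integrable on `[0, ∞)` and on `(-∞, 0]` respectively, and which are linearly independent. -/
def IsWeylPair (q : ℝ → ℂ) (θ : ℝ) (z : ℂ) (p : (Fin 2 → ℂ) × (Fin 2 → ℂ)) : Prop :=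
  MemLp (solComb q θ z p.1) 2 (volume.restrict (Ici (0 : ℝ))) ∧
    MemLp (solComb q θ z p.2) 2 (volume.restrict (Iic (0 : ℝ))) ∧
    p.1 0 * p.2 1 - p.1 1 * p.2 0 ≠ 0

open Classical in
/-- The matrix `Γ̃(z)`. With `c`, `d` the coordinates of the half-line Weyl solutions at `+∞` and
`-∞` it is `(c₀ d₁ - c₁ d₀)⁻¹ c dᵀ`. This does not depend on the normalization of the Weyl
solutions: for `c = (1, m₊)` and `d = (1, m₋)` it is the usual matrix in terms of the half-line
coefficients `m±` (see `weylGamma_eq`), and it also covers the points of the resolvent set at which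
`m₊` or `m₋` has a pole. -/
def weylGamma (q : ℝ → ℂ) (θ : ℝ) (z : ℂ) : Matrix (Fin 2) (Fin 2) ℂ :=
  if h : ∃ p, IsWeylPair q θ z p then
    (h.choose.1 0 * h.choose.2 1 - h.choose.1 1 * h.choose.2 0)⁻¹ •
      Matrix.vecMulVec h.choose.1 h.choose.2
  else 0

/-- `m` is the half-line Weyl–Titchmarsh coefficient for the half-line `s`: the unique number with
`Θ + m Φ ∈ L²(s)²`. -/
def IsWeylCoeff (q : ℝ → ℂ) (θ : ℝ) (z : ℂ) (s : Set ℝ) (m : ℂ) : Prop :=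
  ∀ m' : ℂ, MemLp (fun x => solTheta q θ z x + m' • solPhi q θ z x) 2 (volume.restrict s) ↔ m' = m

lemma IsWeylCoeff.coord {q : ℝ → ℂ} {θ : ℝ} {z : ℂ} {s : Set ℝ} {m : ℂ}
    (hm : IsWeylCoeff q θ z s m) {c : Fin 2 → ℂ}
    (hc : MemLp (solComb q θ z c) 2 (volume.restrict s)) : c 1 = c 0 * m := by
  by_cases h0 : c 0 = 0
  · have h1 : m + c 1 = m := by
      rw [← hm]
      refine (((hm m).2 rfl).add hc).ae_eq (Eventually.of_forall fun x => ?_)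
      simp [solComb, h0, add_smul, add_assoc]
    simp [h0, by simpa using h1]
  · have h1 : c 1 / c 0 = m := by
      rw [← hm]
      refine (hc.const_smul (c 0)⁻¹).ae_eq (Eventually.of_forall fun x => ?_)
      simp [solComb, smul_add, smul_smul, h0, div_eq_inv_mul]
    rw [← h1]
    field_simp

/-- `weylGamma` in terms of the half-line coefficients `m±`. -/
theorem weylGamma_eq {q : ℝ → ℂ} {θ : ℝ} {z mp mm : ℂ}
    (hp : IsWeylCoeff q θ z (Ici 0) mp) (hm : IsWeylCoeff q θ z (Iic 0) mm) (hne : mm ≠ mp) :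
    weylGamma q θ z =
      !![1 / (mm - mp), mm / (mm - mp); mp / (mm - mp), mm * mp / (mm - mp)] := by
  have hsub : mm - mp ≠ 0 := sub_ne_zero.2 hne
  have hex : ∃ p, IsWeylPair q θ z p := by
    refine ⟨(![1, mp], ![1, mm]), ?_, ?_, ?_⟩
    · refine ((hp mp).2 rfl).ae_eq (Eventually.of_forall fun x => ?_)
      simp [solComb]
    · refine ((hm mm).2 rfl).ae_eq (Eventually.of_forall fun x => ?_)
      simp [solComb]
    · simpa using hsub
  rw [weylGamma, dif_pos hex]
  obtain ⟨h1, h2, h3⟩ := hex.choose_spec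
  set c := hex.choose.1
  set d := hex.choose.2
  have hc := hp.coord h1
  have hd := hm.coord h2
  have hdet : c 0 * d 1 - c 1 * d 0 = c 0 * d 0 * (mm - mp) := by rw [hc, hd]; ring
  rw [hdet] at h3
  have hc0 : c 0 ≠ 0 := fun h => h3 (by simp [h])
  have hd0 : d 0 ≠ 0 := fun h => h3 (by simp [h])
  rw [hdet]
  ext i j
  fin_cases i <;> fin_cases j <;> simp [Matrix.vecMulVec_apply, hc, hd] <;> field_simp

/-- The whole-line Weyl–Titchmarsh matrix `M̃ = (Γ̃ + Γ̃ᵀ) / 2`. -/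
def weylM (q : ℝ → ℂ) (θ : ℝ) (z : ℂ) : Matrix (Fin 2) (Fin 2) ℂ :=
  (1 / 2 : ℂ) • (weylGamma q θ z + (weylGamma q θ z)ᵀ)

/-- `lim_{δ ↓ 0} lim_{ε ↓ 0} F δ ε = L`, where the inner limit has to exist for all small `δ`. -/
def HasIteratedLimit (F : ℝ → ℝ → ℂ) (L : ℂ) : Prop :=
  ∃ G : ℝ → ℂ, (∀ᶠ δ in 𝓝[>] 0, Tendsto (F δ) (𝓝[>] 0) (𝓝 (G δ))) ∧
    Tendsto G (𝓝[>] 0) (𝓝 L)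

/-- The spectral and growth conditions on an interval: for some `ε₀, δ₀ > 0`, the spectrum of `H̃`
within `{l₁ ≤ Re z ≤ l₂ + δ₀, |Im z| ≤ ε₀}` is real, and `M̃` satisfies the two bounds. -/
def IsolatedInterval (q : ℝ → ℂ) (θ l₁ l₂ : ℝ) : Prop :=
  ∃ ε₀ > 0, ∃ δ₀ > 0,
    (∀ z ∈ spec (hamOp q), l₁ ≤ z.re → z.re ≤ l₂ + δ₀ → |z.im| ≤ ε₀ → z.im = 0) ∧
    (∃ C : ℝ, ∀ t ∈ Icc l₁ (l₂ + δ₀), ∀ ε : ℝ, 0 < ε → ε ≤ ε₀ → ∀ j k : Fin 2,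
      ε * ‖weylM q θ (t + ε * Complex.I) j k‖ ≤ C) ∧
    (∀ t ∈ Icc l₁ (l₂ + δ₀), ∀ j k : Fin 2,
      Tendsto (fun ε : ℝ => ε * ‖weylM q θ (t + ε * Complex.I) j k +
        weylM q θ (t - ε * Complex.I) j k‖) (𝓝[>] 0) (𝓝 0))

/-- `Ω` is the (matrix-valued, complex) measure defined on `[l₁, l₂]` by the jump of `M̃` across the
real axis. -/
def IsSpectralMatrixMeasure (q : ℝ → ℂ) (θ l₁ l₂ : ℝ)
    (Ω : Matrix (Fin 2) (Fin 2) (ComplexMeasure ℝ)) : Prop :=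
  ∀ a b : ℝ, l₁ ≤ a → a < b → b ≤ l₂ → ∀ j k : Fin 2,
    HasIteratedLimit
      (fun δ ε => 1 / (2 * Real.pi * Complex.I) * ∫ t in (a + δ)..(b + δ),
        (weylM q θ (t + ε * Complex.I) j k - weylM q θ (t - ε * Complex.I) j k))
      (Ω j k (Ioc a b))

/-- `C₀^∞(ℝ)²`. -/
def IsTest (f : ℝ → C2) : Prop := ContDiff ℝ ∞ f ∧ HasCompactSupport f

/-- The class in `L²(ℝ)²` of a test function. -/
def IsTest.toL2 {f : ℝ → C2} (hf : IsTest f) : L2 :=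
  (hf.1.continuous.memLp_of_hasCompactSupport (p := 2) (μ := volume) hf.2).toLp f

/-- `E` is a bounded projection on `L²(ℝ)²` which extends the form given by Stone's formula on
test functions. -/
def IsStoneProjection (q : ℝ → ℂ) (l₁ l₂ : ℝ) (E : L2 →L[ℂ] L2) : Prop :=
  IsIdempotentElem E ∧
    ∀ (f g : ℝ → C2) (hf : IsTest f) (hg : IsTest g),
      HasIteratedLimit
        (fun δ ε => 1 / (2 * Real.pi * Complex.I) * ∫ t in (l₁ + δ)..(l₂ + δ),
          inner ℂ hf.toL2 ((resolventOp (hamOp q) (t + ε * Complex.I) -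
            resolventOp (hamOp q) (t - ε * Complex.I)) hg.toL2))
        (inner ℂ hf.toL2 (E hg.toL2))

/-- `(T₀ f)(t) = ∫ (Θ Φ)(t, x)ᵀ f(x) dx`. -/
def transformT0 (q : ℝ → ℂ) (θ : ℝ) (f : ℝ → C2) (t : ℝ) : C2 :=
  ∫ x : ℝ, act (fundMat q θ t x)ᵀ (f x)

/-- The complex conjugate `f̄`. -/
def conjFn (f : ℝ → C2) (x : ℝ) : C2 := WithLp.toLp 2 fun i => star (f x i)

end DiracSpectral

end

/-! For fixed test functions the resolvent form splits as `⟨f, (H̃ - z)⁻¹ g⟩ = ∑ h_{jk}(z)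
M̃_{jk}(z) + e(z)` (`inner_resolventOp`). Here `h_{jk}` is the product of the transforms of `f̄` and
`g` at `z`, an entire function, and `e` is continuous across the real axis. Formally the jump of the
left side over the axis is therefore `∑ h_{jk}` times the jump of `M̃_{jk}`, that is `2πi ∑ h_{jk}
dΩ̃_{jk}`, and integrating over `(λ₁, λ₂]` gives the claim.

Making this rigorous is a Stieltjes inversion without positivity. The integrals of the jump of `M̃`
are known to converge only for each pair of endpoints separately, with no uniformity in the
endpoints, so the limit cannot simply be taken under an integral against `h`. Instead everything is
integrated twice. The bound `M̃ = O(1 / Im z)` gives second primitives that are continuous up to the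
axis (`exists_isSecondPrimitive`), and their jump `P` over the axis is an ordinary continuous
function, whose second derivative should be `2πi Ω̃`.

What makes pointwise limits sufficient is a uniqueness principle. If `Re k''` has a positive
vertical limit at a boundary point, then `Re k` has no local maximum along the boundary there
(`false_of_boundary_max`). Indeed a Cauchy integral against a kernel positive on the axis bounds `Re
k(iy) - Re k(2iy) / 2` by `O(y³)`, while concavity in the vertical direction makes it at least a
constant times `y²`. Hence pointwise bounds on vertical limits of a derivative control boundary
increments (`le_re_sub_re_of_tendsto`), and the increments `P(x + d) - P(x)` have the right
derivatives predicted by `Ω̃` (`hasDerivWithinAt_boundaryJump`). An additivity argument transfers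
this to `P` up to a constant (`exists_hasDerivWithinAt_of_differences`).

The product rule `h M = (h p)'' - 2 (h' p)' + h'' p` then expresses the second primitive of the
resolvent form through the second primitives `p` of `M̃`. Comparing the boundary jumps and
integrating by parts against the complex measures yields the formula
(`eq_sum_integral_of_hasIteratedLimit`).

The remaining input is Weyl theory. Solutions and their analytic dependence on `z` come from
Volterra operators. Constancy of Wronskians forces the limit-point case and identifies the Green
kernel with the Weyl matrix. Resolvent elements between step functions make `M̃` analytic
(`differentiableAt_weylGamma`). The symmetry `ψ ↦ σ₄ ψ̄` carries the growth bound to the lower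
half-plane (`weylM_conj`). -/

noncomputable section

namespace DiracSpectral

section

open Complex (I)

/-! ### Cauchy's formula for rectangles -/

/-- The integral of `f` along the positively oriented boundary of `[a, b] × [c, d]`. -/
def rectInt (f : ℂ → ℂ) (a b c d : ℝ) : ℂ :=
  (∫ x : ℝ in a..b, f (x + c * I)) - (∫ x : ℝ in a..b, f (x + d * I)) +
    I * (∫ y : ℝ in c..d, f (b + y * I)) - I * ∫ y : ℝ in c..d, f (a + y * I)

lemma rectInt_eq_zero {f : ℂ → ℂ} {a b c d : ℝ} (hab : a ≤ b) (hcd : c ≤ d)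
    (hc : ContinuousOn f (Icc a b ×ℂ Icc c d)) (hd : DifferentiableOn ℂ f (Ioo a b ×ℂ Ioo c d)) :
    rectInt f a b c d = 0 := by
  have h := Complex.integral_boundary_rect_eq_zero_of_continuousOn_of_differentiableOn f
    (⟨a, c⟩ : ℂ) (⟨b, d⟩ : ℂ)
  simp only [uIcc_of_le hab, uIcc_of_le hcd, min_eq_left hab, min_eq_left hcd, max_eq_right hab,
    max_eq_right hcd, smul_eq_mul] at h
  exact h hc hd

lemma mem_slitPlane_of_im_ne {z : ℂ} (h : z.im ≠ 0) : z ∈ Complex.slitPlane :=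
  Complex.mem_slitPlane_iff.2 (Or.inr h)

lemma mem_slitPlane_of_re_pos {z : ℂ} (h : 0 < z.re) : z ∈ Complex.slitPlane :=
  Complex.mem_slitPlane_iff.2 (Or.inl h)

lemma integral_inv_line {p v : ℂ} {a b : ℝ} (h : ∀ t : ℝ, p + t * v ∈ Complex.slitPlane) :
    v * ∫ t : ℝ in a..b, (p + t * v)⁻¹ = Complex.log (p + b * v) - Complex.log (p + a * v) := by
  rw [← intervalIntegral.integral_const_mul]
  refine intervalIntegral.integral_eq_sub_of_hasDerivAt
    (f := fun t : ℝ => Complex.log (p + t * v)) (fun t _ => ?_) ?_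
  · have h1 : HasDerivAt (fun t : ℝ => p + (t : ℂ) * v) v t := by
      simpa using ((Complex.ofRealCLM.hasDerivAt (x := t)).mul_const v).const_add p
    simpa [div_eq_mul_inv] using h1.clog_real (h t)
  · refine Continuous.intervalIntegrable ?_ _ _
    refine continuous_const.mul (Continuous.inv₀ (by fun_prop) fun t => ?_)
    exact Complex.slitPlane_ne_zero (h t)

/-- Each side contributes a difference of logarithms. The left side crosses the branch cut, so `log
(-(z - w))` is used there; at each of the two left corners it differs from the other logarithm by
`πi`, and the two mismatches add up to the result. -/
lemma rectInt_inv_sub {a b c d : ℝ} {w : ℂ} (ha : a < w.re) (hb : w.re < b) (hc : c < w.im)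
    (hd : w.im < d) : rectInt (fun z => (z - w)⁻¹) a b c d = 2 * Real.pi * I := by
  have e1 : ∫ x : ℝ in a..b, ((x : ℂ) + c * I - w)⁻¹ =
      Complex.log (b + c * I - w) - Complex.log (a + c * I - w) := by
    have := integral_inv_line (p := c * I - w) (v := 1) (a := a) (b := b)
      (fun t => mem_slitPlane_of_im_ne (by simp; linarith))
    simpa [add_comm, add_sub_assoc, add_left_comm, sub_add_eq_add_sub] using this
  have e2 : ∫ x : ℝ in a..b, ((x : ℂ) + d * I - w)⁻¹ =
      Complex.log (b + d * I - w) - Complex.log (a + d * I - w) := by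
    have := integral_inv_line (p := d * I - w) (v := 1) (a := a) (b := b)
      (fun t => mem_slitPlane_of_im_ne (by simp; linarith))
    simpa [add_comm, add_sub_assoc, add_left_comm, sub_add_eq_add_sub] using this
  have e3 : I * ∫ y : ℝ in c..d, ((b : ℂ) + y * I - w)⁻¹ =
      Complex.log (b + d * I - w) - Complex.log (b + c * I - w) := by
    have := integral_inv_line (p := b - w) (v := I) (a := c) (b := d)
      (fun t => mem_slitPlane_of_re_pos (by simp; linarith))
    simpa [sub_add_eq_add_sub] using this
  have e4 : I * ∫ y : ℝ in c..d, ((a : ℂ) + y * I - w)⁻¹ =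
      Complex.log (-(a + d * I - w)) - Complex.log (-(a + c * I - w)) := by
    have := integral_inv_line (p := -(a - w)) (v := -I) (a := c) (b := d)
      (fun t => mem_slitPlane_of_re_pos (by simp; linarith))
    have h2 : ∀ t : ℝ, -((a : ℂ) - w) + t * -I = -(a + t * I - w) := fun t => by ring
    simp only [h2, inv_neg, intervalIntegral.integral_neg] at this
    rw [← this]
    ring
  have key : ∀ z : ℂ, 0 < z.im → Complex.log z - Complex.log (-z) = Real.pi * I := by
    intro z hz
    simp only [Complex.log, norm_neg, Complex.arg_neg_eq_arg_sub_pi_of_im_pos hz]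
    push_cast
    ring
  have h1 := key (a + d * I - w) (by simp; linarith)
  have h2 := key (-(a + c * I - w)) (by simp; linarith)
  rw [neg_neg] at h2
  simp only [rectInt]
  rw [e1, e2, e3, e4]
  linear_combination h1 + h2

lemma isOpen_box (a b c d : ℝ) : IsOpen (Ioo a b ×ℂ Ioo c d) := isOpen_Ioo.reProdIm isOpen_Ioo

lemma convex_box (a b c d : ℝ) : Convex ℝ (Ioo a b ×ℂ Ioo c d) :=
  ((convex_Ioo a b).linear_preimage Complex.reLm).inter
    ((convex_Ioo c d).linear_preimage Complex.imLm)

lemma isCompact_box (a b c d : ℝ) : IsCompact (Icc a b ×ℂ Icc c d) :=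
  isCompact_Icc.reProdIm isCompact_Icc

lemma box_subset (a b c d : ℝ) : Ioo a b ×ℂ Ioo c d ⊆ Icc a b ×ℂ Icc c d :=
  Complex.reProdIm_subset_iff.2 (prod_mono Ioo_subset_Icc_self Ioo_subset_Icc_self)

lemma rectInt_add {f g : ℂ → ℂ} {a b c d : ℝ} (hab : a ≤ b) (hcd : c ≤ d)
    (S : Set ℂ) (hS : (Icc a b ×ℂ Icc c d) \ (Ioo a b ×ℂ Ioo c d) ⊆ S) (hf : ContinuousOn f S)
    (hg : ContinuousOn g S) :
    rectInt (fun z => f z + g z) a b c d = rectInt f a b c d + rectInt g a b c d := by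
  have key : ∀ (p v : ℂ) (s t : ℝ), s ≤ t → (∀ x ∈ Icc s t, p + x * v ∈ S) → 
      ∫ x : ℝ in s..t, (f (p + x * v) + g (p + x * v)) = 
        (∫ x : ℝ in s..t, f (p + x * v)) + ∫ x : ℝ in s..t, g (p + x * v) := by
    intro p v s t hst h
    have hl : ContinuousOn (fun x : ℝ => p + (x : ℂ) * v) (uIcc s t) := by fun_prop
    rw [uIcc_of_le hst] at hl
    refine intervalIntegral.integral_add ?_ ?_ <;> refine ContinuousOn.intervalIntegrable ?_ <;>
      rw [uIcc_of_le hst]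
    · exact hf.comp hl h
    · exact hg.comp hl h
  have hbd : ∀ z : ℂ, z.re ∈ Icc a b → z.im ∈ Icc c d → (z.re ∉ Ioo a b ∨ z.im ∉ Ioo c d) → z ∈ S :=
    fun z h1 h2 h3 => hS ⟨⟨h1, h2⟩, fun h => h3.elim (fun h4 => h4 h.1) (fun h4 => h4 h.2)⟩
  have k1 := key (c * I) 1 a b hab (fun x hx => hbd _ (by simpa using hx) (by simpa using hcd)
    (by simp))
  have k2 := key (d * I) 1 a b hab (fun x hx => hbd _ (by simpa using hx) (by simpa using hcd)
    (by simp))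
  have k3 := key b I c d hcd (fun x hx => hbd _ (by simpa using hab) (by simpa using hx)
    (by simp))
  have k4 := key a I c d hcd (fun x hx => hbd _ (by simpa using hab) (by simpa using hx)
    (by simp))
  simp only [mul_one, add_comm ((_ : ℂ) * I)] at k1 k2
  simp only [rectInt]
  rw [k1, k2, k3, k4]
  ring

lemma rectInt_const_mul (k : ℂ) (f : ℂ → ℂ) (a b c d : ℝ) :
    rectInt (fun z => k * f z) a b c d = k * rectInt f a b c d := by
  simp only [rectInt, intervalIntegral.integral_const_mul]
  ring

lemma rectInt_congr {f g : ℂ → ℂ} {a b c d : ℝ} (hab : a ≤ b) (hcd : c ≤ d)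
    (h : ∀ z ∈ (Icc a b ×ℂ Icc c d) \ (Ioo a b ×ℂ Ioo c d), f z = g z) :
    rectInt f a b c d = rectInt g a b c d := by
  have hbd : ∀ z : ℂ, z.re ∈ Icc a b → z.im ∈ Icc c d → (z.re ∉ Ioo a b ∨ z.im ∉ Ioo c d) →
      f z = g z :=
    fun z h1 h2 h3 => h z ⟨⟨h1, h2⟩, fun h => h3.elim (fun h4 => h4 h.1) (fun h4 => h4 h.2)⟩
  simp only [rectInt]
  congr 1
  · congr 1
    · congr 1
      · refine intervalIntegral.integral_congr fun x hx => ?_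
        rw [uIcc_of_le hab] at hx
        exact hbd _ (by simpa using hx) (by simpa using hcd) (by simp)
      · refine intervalIntegral.integral_congr fun x hx => ?_
        rw [uIcc_of_le hab] at hx
        exact hbd _ (by simpa using hx) (by simpa using hcd) (by simp)
    · congr 1
      refine intervalIntegral.integral_congr fun x hx => ?_
      rw [uIcc_of_le hcd] at hx
      exact hbd _ (by simpa using hab) (by simpa using hx) (by simp)
  · congr 1
    refine intervalIntegral.integral_congr fun x hx => ?_
    rw [uIcc_of_le hcd] at hx
    exact hbd _ (by simpa using hab) (by simpa using hx) (by simp)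

/-- Cauchy's integral formula for a rectangle. -/
lemma rectInt_mul_inv_sub {f : ℂ → ℂ} {a b c d : ℝ} {w : ℂ} (hw : w ∈ Ioo a b ×ℂ Ioo c d)
    (hc : ContinuousOn f (Icc a b ×ℂ Icc c d)) (hd : DifferentiableOn ℂ f (Ioo a b ×ℂ Ioo c d)) :
    rectInt (fun z => f z * (z - w)⁻¹) a b c d = 2 * Real.pi * I * f w := by
  have hnh : Ioo a b ×ℂ Ioo c d ∈ 𝓝 w := (isOpen_box a b c d).mem_nhds hw
  have hnh2 : Icc a b ×ℂ Icc c d ∈ 𝓝 w := mem_of_superset hnh (box_subset a b c d)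
  have hab : a ≤ b := (hw.1.1.trans hw.1.2).le
  have hcd : c ≤ d := (hw.2.1.trans hw.2.2).le
  have h0 : rectInt (dslope f w) a b c d = 0 :=
    rectInt_eq_zero hab hcd
      ((continuousOn_dslope hnh2).2 ⟨hc, (hd w hw).differentiableAt hnh⟩)
      ((Complex.differentiableOn_dslope hnh).2 hd)
  have hne : ∀ z ∈ (Icc a b ×ℂ Icc c d) \ (Ioo a b ×ℂ Ioo c d), z ≠ w := by
    rintro z ⟨-, hz⟩ rfl
    exact hz hw
  -- The divided difference carries no singularity, so only the multiple `f w` of the Cauchy kernel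
  -- contributes.
  have h1 : rectInt (fun z => f z * (z - w)⁻¹) a b c d =
      rectInt (fun z => dslope f w z + f w * (z - w)⁻¹) a b c d := by
    refine rectInt_congr hab hcd fun z hz => ?_
    have hzw := sub_ne_zero.2 (hne z hz)
    rw [dslope_of_ne _ (hne z hz), slope_def_field]
    field_simp
    ring
  rw [h1, rectInt_add hab hcd ((Icc a b ×ℂ Icc c d) \ (Ioo a b ×ℂ Ioo c d)) Subset.rfl, h0,
    rectInt_const_mul,
    rectInt_inv_sub hw.1.1 hw.1.2 hw.2.1 hw.2.2]
  · ring
  · exact ((continuousOn_dslope hnh2).2 ⟨hc, (hd w hw).differentiableAt hnh⟩).mono sdiff_subset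
  · exact continuousOn_const.mul (ContinuousOn.inv₀ (by fun_prop)
      fun z hz => sub_ne_zero.2 (hne z hz))

end

section

open Complex (I)

/-! ### Primitives on closed boxes -/

lemma exists_continuousOn_closure {f : ℂ → ℂ} {U : Set ℂ} (h : UniformContinuousOn f U) :
    ∃ F : ℂ → ℂ, ContinuousOn F (closure U) ∧ EqOn F f U := by
  refine ⟨extendFrom U f, continuousOn_extendFrom Subset.rfl fun x hx => ?_, fun x hx => ?_⟩
  · have : (𝓝[U] x).NeBot := mem_closure_iff_nhdsWithin_neBot.1 hx
    have hc : Cauchy (map f (𝓝[U] x)) := by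
      refine ⟨this.map f, ?_⟩
      rw [prod_map_map_eq]
      refine (map_mono ?_).trans h
      exact le_inf ((Filter.prod_mono nhdsWithin_le_nhds nhdsWithin_le_nhds).trans
          (by rw [← nhds_prod_eq]; exact nhds_le_uniformity x))
          (by rw [← prod_principal_principal]; exact Filter.prod_mono inf_le_right inf_le_right)
    exact CompleteSpace.complete hc
  · exact extendFrom_eq (subset_closure hx) (h.continuousOn x hx)

lemma closure_box {a b c d : ℝ} (hab : a < b) (hcd : c < d) :
    closure (Ioo a b ×ℂ Ioo c d) = Icc a b ×ℂ Icc c d := by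
  rw [Complex.closure_reProdIm, closure_Ioo hab.ne, closure_Ioo hcd.ne]

/-- An interior primitive is Lipschitz, because `g` is bounded on the compact box, so it extends
continuously to the closure. The derivative survives at boundary points because `g` is continuous
there and the box is convex. -/
lemma exists_primitive_box {g : ℂ → ℂ} {a b c d : ℝ} (hab : a < b) (hcd : c < d)
    (hc : ContinuousOn g (Icc a b ×ℂ Icc c d)) (hd : DifferentiableOn ℂ g (Ioo a b ×ℂ Ioo c d)) :
    ∃ k : ℂ → ℂ, ∀ z ∈ Icc a b ×ℂ Icc c d, HasDerivWithinAt k (g z) (Icc a b ×ℂ Icc c d) z := by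
  obtain ⟨k₀, hk₀⟩ := (convex_box a b c d).exists_forall_hasDerivWithinAt hd
  obtain ⟨C, hC⟩ := (isCompact_box a b c d).exists_bound_of_continuousOn hc
  have hlip : LipschitzOnWith C.toNNReal k₀ (Ioo a b ×ℂ Ioo c d) :=
    LipschitzOnWith.of_dist_le_mul fun x hx y hy => by
      rw [dist_eq_norm, dist_eq_norm]
      exact (convex_box a b c d).norm_image_sub_le_of_norm_hasDerivWithin_le hk₀
        (fun z hz => (hC z (box_subset a b c d hz)).trans (Real.le_coe_toNNReal C)) hy hx
  obtain ⟨k, hkc, hke⟩ := exists_continuousOn_closure hlip.uniformContinuousOn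
  have hder : ∀ z ∈ Ioo a b ×ℂ Ioo c d, HasDerivAt k (g z) z := fun z hz =>
    ((hk₀ z hz).congr (fun y hy => hke hy) (hke hz)).hasDerivAt
      ((isOpen_box a b c d).mem_nhds hz)
  have hfd : ∀ z ∈ Ioo a b ×ℂ Ioo c d, HasFDerivAt k
      ((ContinuousLinearMap.toSpanSingleton ℂ (g z)).restrictScalars ℝ) z := fun z hz =>
    (hder z hz).hasFDerivAt.restrictScalars ℝ
  refine ⟨k, fun z hz => ?_⟩
  rw [← closure_box hab hcd] at hz hc ⊢
  have hlim : Tendsto (fun y => fderiv ℝ k y) (𝓝[Ioo a b ×ℂ Ioo c d] z)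
      (𝓝 ((ContinuousLinearMap.toSpanSingleton ℂ (g z)).restrictScalars ℝ)) := by
    have h1 : Tendsto g (𝓝[Ioo a b ×ℂ Ioo c d] z) (𝓝 (g z)) :=
      (hc z hz).mono_left (nhdsWithin_mono _ subset_closure)
    have h2 : Continuous fun w : ℂ =>
        (ContinuousLinearMap.toSpanSingleton ℂ w : ℂ →L[ℂ] ℂ).restrictScalars ℝ :=
      (ContinuousLinearMap.restrictScalarsL ℂ ℂ ℂ ℝ ℂ).continuous.comp
        (ContinuousLinearMap.toSpanSingletonLE ℂ ℂ ℂ).toLinearMap.continuous_of_finiteDimensional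
    refine ((h2.tendsto _).comp h1).congr' ?_
    filter_upwards [self_mem_nhdsWithin] with y hy using (hfd y hy).fderiv.symm
  have := hasFDerivWithinAt_closure_of_tendsto_fderiv
    (fun y hy => (hfd y hy).differentiableAt.differentiableWithinAt) (convex_box a b c d)
    (isOpen_box a b c d) (fun y hy => (hkc y hy).mono subset_closure) hlim
  -- The limiting real derivative is `ℂ`-linear, so the same little-o estimate is a complex
  -- derivative.
  have h3 : HasFDerivWithinAt k (ContinuousLinearMap.toSpanSingleton ℂ (g z))
      (closure (Ioo a b ×ℂ Ioo c d)) z := 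
    .of_isLittleO this.isLittleO
  exact h3

/-! ### A uniqueness principle for boundary values -/

/-- Integrate `k` over the boundary of the half-box against `1 / ((z² + y²)(z² + 4y²))`. The
residues at `iy` and `2iy` give `π / (3y³)` times the combination on the left. The real edge
contributes a nonpositive real part, the kernel being positive there, and the other three edges stay
bounded as `y → 0`. Two poles are used because the single kernel `1 / (z² + y²)` would give only
`O(y)`, too weak against a `y²` gain from concavity. -/
lemma exists_sub_half_le {k : ℂ → ℂ} {r : ℝ} (hr : 0 < r)
    (hc : ContinuousOn k (Icc (-r) r ×ℂ Icc 0 r))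
    (hd : DifferentiableOn ℂ k (Ioo (-r) r ×ℂ Ioo 0 r))
    (hk : ∀ x ∈ Icc (-r) r, (k (x : ℝ)).re ≤ 0) :
    ∃ C : ℝ, ∀ y : ℝ, 0 < y → 4 * y ≤ r →
      (k (y * I)).re - (k ((2 * y : ℝ) * I)).re / 2 ≤ C * y ^ 3 := by
  obtain ⟨B, hB⟩ := (isCompact_box (-r) r 0 r).exists_bound_of_continuousOn hc
  refine ⟨3 / Real.pi * (8 * B / r ^ 3), fun y hy hyr => ?_⟩
  set K : ℂ → ℂ := fun z => ((z ^ 2 + y ^ 2) * (z ^ 2 + (2 * y) ^ 2))⁻¹ with hK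
  have hrr : -r ≤ r := by linarith
  have cauchy : ∀ s : ℝ, 0 < s → s < r →
      rectInt (fun z => k z * (z + s * I)⁻¹ * (z - s * I)⁻¹) (-r) r 0 r =
        Real.pi / s * k (s * I) := by
    intro s hs hsr
    have hne : ∀ z ∈ Icc (-r) r ×ℂ Icc 0 r, z + s * I ≠ 0 := by
      intro z hz h
      have h1 := congrArg Complex.im h
      simp at h1
      have h2 := hz.2.1
      linarith
    have hmem : (s * I : ℂ) ∈ Ioo (-r) r ×ℂ Ioo 0 r := by
      simp [Complex.mem_reProdIm, hr, hs, hsr]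
    rw [rectInt_mul_inv_sub (f := fun z => k z * (z + s * I)⁻¹) hmem]
    · have : (s : ℂ) ≠ 0 := by exact_mod_cast hs.ne'
      field_simp
      ring
    · exact hc.mul (ContinuousOn.inv₀ (by fun_prop) hne)
    · exact hd.mul (DifferentiableOn.inv (by fun_prop) fun z hz => hne z (box_subset _ _ _ _ hz))
  have hy0 : (y : ℂ) ≠ 0 := by exact_mod_cast hy.ne'
  -- On the far edges `|z| ≥ r`, and `4y ≤ r` keeps both `y` and `2y` below `r / 2`; each factor of
  -- the kernel's denominator is then at least `3r² / 4`, and their product exceeds `r⁴ / 2`.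
  have hfar : ∀ z ∈ Icc (-r) r ×ℂ Icc 0 r, z.re = r ∨ z.re = -r ∨ z.im = r →
      ‖k z * K z‖ ≤ 2 * B / r ^ 4 := by
    intro z hz hz2
    have hzr : r ^ 2 ≤ ‖z‖ ^ 2 := by
      rw [Complex.sq_norm, Complex.normSq_apply]
      rcases hz2 with h | h | h <;> rw [h] <;> nlinarith [sq_nonneg z.re, sq_nonneg z.im]
    have hlow : ∀ s : ℝ, 0 < s → 2 * s ≤ r → r ^ 2 * (3 / 4) ≤ ‖z ^ 2 + (s : ℂ) ^ 2‖ := by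
      intro s hs hsr
      have h1 : ‖z ^ 2‖ - ‖-(s : ℂ) ^ 2‖ ≤ ‖z ^ 2 - -(s : ℂ) ^ 2‖ := norm_sub_norm_le _ _
      rw [sub_neg_eq_add, norm_neg, norm_pow, norm_pow, Complex.norm_real,
        Real.norm_of_nonneg hs.le]
        at h1
      nlinarith
    have h1 := hlow y hy (by linarith)
    have h2 := hlow (2 * y) (by linarith) (by linarith)
    push_cast at h2
    have h3 : r ^ 4 / 2 ≤ ‖(z ^ 2 + (y : ℂ) ^ 2) * (z ^ 2 + (2 * y) ^ 2)‖ := by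
      rw [norm_mul]
      have h4 := mul_le_mul h1 h2 (by positivity) (norm_nonneg _)
      refine le_trans ?_ h4
      nlinarith [pow_pos hr 4]
    rw [norm_mul, hK]
    simp only [norm_inv]
    calc ‖k z‖ * ‖(z ^ 2 + (y : ℂ) ^ 2) * (z ^ 2 + (2 * y) ^ 2)‖⁻¹ ≤ B * (r ^ 4 / 2)⁻¹ :=
          mul_le_mul (hB z hz) (inv_anti₀ (by positivity) h3) (by positivity)
            ((norm_nonneg _).trans (hB z hz))
      _ = 2 * B / r ^ 4 := by field_simp
  -- the boundary integral in two ways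
  have e1 : rectInt (fun z => k z * K z) (-r) r 0 r =
      Real.pi / (3 * y ^ 3) * (k (y * I) - k ((2 * y : ℝ) * I) / 2) := by
    have hcont : ∀ s : ℝ, 0 < s → s < r → ContinuousOn
        (fun z => k z * (z + s * I)⁻¹ * (z - s * I)⁻¹)
        ((Icc (-r) r ×ℂ Icc 0 r) \ (Ioo (-r) r ×ℂ Ioo 0 r)) := by
      intro s hs hsr
      refine ((hc.mono sdiff_subset).mul (ContinuousOn.inv₀ (by fun_prop) ?_)).mul
        (ContinuousOn.inv₀ (by fun_prop) ?_)
      · rintro z ⟨hz, -⟩ h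
        have h1 := congrArg Complex.im h
        simp at h1
        have h2 := hz.2.1
        linarith
      · rintro z ⟨hz, hz2⟩ h
        rw [sub_eq_zero] at h
        exact hz2 (by simp [h, Complex.mem_reProdIm, hr, hs, hsr])
    -- Partial fractions: the difference of the two quadratic factors is `3y²`.
    have h1 : rectInt (fun z => k z * K z) (-r) r 0 r =
        rectInt (fun z => (1 / (3 * y ^ 2)) * (k z * (z + y * I)⁻¹ * (z - y * I)⁻¹) +
          (-(1 / (3 * y ^ 2))) * (k z * (z + (2 * y : ℝ) * I)⁻¹ * (z - (2 * y : ℝ) * I)⁻¹))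
          (-r) r 0 r := by
      refine rectInt_congr hrr hr.le fun z hz => ?_
      have hn : ∀ s : ℝ, 0 < s → s < r → z + s * I ≠ 0 ∧ z - s * I ≠ 0 := by
        intro s hs hsr
        refine ⟨fun h => ?_, fun h => ?_⟩
        · have h1 := congrArg Complex.im h
          simp at h1
          have h2 := hz.1.2.1
          linarith
        · rw [sub_eq_zero] at h
          exact hz.2 (by simp [h, Complex.mem_reProdIm, hr, hs, hsr])
      have hf : ∀ s : ℂ, (z + s * I) * (z - s * I) = z ^ 2 + s ^ 2 := fun s => by
        linear_combination (-s ^ 2) * Complex.I_sq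
      obtain ⟨h1, h2⟩ := hn y hy (by linarith)
      obtain ⟨h3, h4⟩ := hn (2 * y) (by linarith) (by linarith)
      have h5 : z ^ 2 + (y : ℂ) ^ 2 ≠ 0 := by rw [← hf]; exact mul_ne_zero h1 h2
      have h6 : z ^ 2 + (2 * (y : ℂ)) ^ 2 ≠ 0 := by
        rw [← hf]
        push_cast at h3 h4
        exact mul_ne_zero h3 h4
      rw [mul_assoc (k z), mul_assoc (k z), ← mul_inv, ← mul_inv, hf, hf, hK]
      push_cast
      have h7 : z ^ 2 + (2 * (y : ℂ)) ^ 2 - (z ^ 2 + (y : ℂ) ^ 2) = 3 * y ^ 2 := by ring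
      generalize z ^ 2 + (2 * (y : ℂ)) ^ 2 = Y at *
      generalize z ^ 2 + (y : ℂ) ^ 2 = X at *
      rw [← h7]
      have h8 : Y - X ≠ 0 := by
        rw [h7]
        exact mul_ne_zero three_ne_zero (pow_ne_zero 2 hy0)
      field_simp
      ring
    rw [h1, rectInt_add (f := fun z => (1 / (3 * y ^ 2)) * (k z * (z + y * I)⁻¹ * (z - y * I)⁻¹))
      (g := fun z => (-(1 / (3 * y ^ 2))) *
        (k z * (z + (2 * y : ℝ) * I)⁻¹ * (z - (2 * y : ℝ) * I)⁻¹)) hrr hr.le _ Subset.rfl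
      (continuousOn_const.mul (hcont y hy (by linarith)))
      (continuousOn_const.mul (hcont (2 * y) (by linarith) (by linarith))), rectInt_const_mul,
      rectInt_const_mul, cauchy y hy (by linarith), cauchy (2 * y) (by linarith) (by linarith)]
    push_cast
    field_simp
    ring_nf
  have hKc : Continuous fun x : ℝ => K x := by
    refine Continuous.inv₀ (by fun_prop) fun x => ?_
    have : (0 : ℝ) < (x ^ 2 + y ^ 2) * (x ^ 2 + (2 * y) ^ 2) := by positivity
    exact_mod_cast this.ne'
  have e2 : (∫ x : ℝ in (-r)..r, k (x + (0 : ℝ) * I) * K (x + (0 : ℝ) * I)).re ≤ 0 := by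
    have hci : ContinuousOn (fun x : ℝ => k x * K x) (uIcc (-r) r) := by
      rw [uIcc_of_le hrr]
      refine ContinuousOn.mul (hc.comp (by fun_prop) fun x hx => ?_) hKc.continuousOn
      simpa [Complex.mem_reProdIm, hr.le] using hx
    have hre : (∫ x : ℝ in (-r)..r, k x * K x).re = ∫ x : ℝ in (-r)..r, (k x * K x).re :=
      (Complex.reCLM.intervalIntegral_comp_comm hci.intervalIntegrable).symm
    simp only [Complex.ofReal_zero, zero_mul, add_zero]
    rw [hre]
    rw [← neg_nonneg, ← intervalIntegral.integral_neg]
    refine intervalIntegral.integral_nonneg hrr fun x hx => neg_nonneg.2 ?_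
    have h1 : K x = ((((x ^ 2 + y ^ 2) * (x ^ 2 + (2 * y) ^ 2))⁻¹ : ℝ) : ℂ) := by
      rw [hK]
      push_cast
      rfl
    rw [h1, Complex.re_mul_ofReal]
    exact mul_nonpos_of_nonpos_of_nonneg (hk x hx) (by positivity)
  have e3 : ‖∫ x : ℝ in (-r)..r, k (x + r * I) * K (x + r * I)‖ ≤ 2 * B / r ^ 4 * |r - -r| := by
    refine intervalIntegral.norm_integral_le_of_norm_le_const fun x hx => hfar _ ?_ (by simp)
    rw [uIoc_of_le hrr] at hx
    simpa [Complex.mem_reProdIm, hr.le] using Ioc_subset_Icc_self hx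
  have e4 : ∀ s : ℝ, (s = r ∨ s = -r) → ‖∫ t : ℝ in 0..r, k (s + t * I) * K (s + t * I)‖ ≤
      2 * B / r ^ 4 * |r - 0| := by
    intro s hs
    refine intervalIntegral.norm_integral_le_of_norm_le_const fun x hx => hfar _ ?_ (by
      rcases hs with rfl | rfl <;> simp)
    rw [uIoc_of_le hr.le] at hx
    have := Ioc_subset_Icc_self hx
    rcases hs with rfl | rfl <;> simpa [Complex.mem_reProdIm, hr.le] using this
  have e5 := e4 r (Or.inl rfl)
  have e6 := e4 (-r) (Or.inr rfl)
  have e7 := congrArg Complex.re e1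
  simp only [rectInt] at e7
  have e8 : ∀ w : ℂ, ‖w‖ ≤ 2 * B / r ^ 4 * |r - 0| → |(I * w).re| ≤ 2 * B / r ^ 4 * r := by
    intro w hw
    refine (Complex.abs_re_le_norm _).trans ?_
    rw [sub_zero, abs_of_pos hr] at hw
    rwa [norm_mul, Complex.norm_I, one_mul]
  have e9 := e8 _ e5
  have e10 := e8 _ e6
  have e11 := (Complex.abs_re_le_norm _).trans e3
  rw [show |r - -r| = 2 * r by rw [sub_neg_eq_add, ← two_mul, abs_of_pos (by positivity)]] at e11
  have e12 : ((Real.pi / (3 * y ^ 3) : ℂ) * (k (y * I) - k ((2 * y : ℝ) * I) / 2)).re =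
      Real.pi / (3 * y ^ 3) * ((k (y * I)).re - (k ((2 * y : ℝ) * I)).re / 2) := by
    rw [show (Real.pi / (3 * y ^ 3) : ℂ) = ((Real.pi / (3 * y ^ 3) : ℝ) : ℂ) by push_cast; rfl,
      Complex.re_ofReal_mul]
    congr 1
    simp
  rw [e12] at e7
  simp only [Complex.sub_re, Complex.add_re] at e7
  have e13 : Real.pi / (3 * y ^ 3) * ((k (y * I)).re - (k ((2 * y : ℝ) * I)).re / 2) ≤
      8 * B / r ^ 3 := by
    have h1 : 2 * B / r ^ 4 * (2 * r) = 4 * B / r ^ 3 := by field_simp; ring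
    have h2 : 2 * B / r ^ 4 * r = 2 * B / r ^ 3 := by field_simp
    rw [h1] at e11
    rw [h2] at e9 e10
    have h3 : 8 * B / r ^ 3 = 4 * B / r ^ 3 + 2 * B / r ^ 3 + 2 * B / r ^ 3 := by ring
    have := abs_le.1 e9
    have := abs_le.1 e10
    have := abs_le.1 e11
    linarith
  have hpi := Real.pi_pos
  calc (k (y * I)).re - (k ((2 * y : ℝ) * I)).re / 2
      = 3 * y ^ 3 / Real.pi *
        (Real.pi / (3 * y ^ 3) * ((k (y * I)).re - (k ((2 * y : ℝ) * I)).re / 2)) := by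
        field_simp
    _ ≤ 3 * y ^ 3 / Real.pi * (8 * B / r ^ 3) := by gcongr
    _ = 3 / Real.pi * (8 * B / r ^ 3) * y ^ 3 := by ring

end

/-! ### Boundary maxima and pointwise control of boundary increments. -/

section

open Complex (I)

/-- Adding `τ y² / 2` to `φ` makes it concave; the bound is midpoint concavity at `0`, `y`, `2y`. -/
lemma sub_half_ge_of_deriv2_le {φ φ' φ'' : ℝ → ℝ} {y₀ τ : ℝ} (hc : ContinuousOn φ (Icc 0 y₀))
    (h1 : ∀ y ∈ Ioo 0 y₀, HasDerivAt φ (φ' y) y) (h2 : ∀ y ∈ Ioo 0 y₀, HasDerivAt φ' (φ'' y) y)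
    (h3 : ∀ y ∈ Ioo 0 y₀, φ'' y ≤ -τ) {y : ℝ} (hy : 0 < y) (hy2 : 2 * y ≤ y₀) :
    τ * y ^ 2 / 2 ≤ φ y - φ (2 * y) / 2 - φ 0 / 2 := by
  set ψ : ℝ → ℝ := fun y => φ y + τ * y ^ 2 / 2 with hψ
  have d1 : ∀ y ∈ Ioo 0 y₀, HasDerivAt ψ (φ' y + τ * y) y := fun y hy => by
    have := (h1 y hy).add (((hasDerivAt_pow 2 y).const_mul τ).div_const 2)
    exact this.congr_deriv (by norm_num; ring)
  have e1 : ∀ y ∈ Ioo 0 y₀, deriv ψ =ᶠ[𝓝 y] fun y => φ' y + τ * y := fun y hy => by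
    filter_upwards [isOpen_Ioo.mem_nhds hy] with x hx using (d1 x hx).deriv
  have d2 : ∀ y ∈ Ioo 0 y₀, HasDerivAt (deriv ψ) (φ'' y + τ) y := fun y hy => by
    have := (h2 y hy).add ((hasDerivAt_id y).const_mul τ)
    rw [mul_one] at this
    exact this.congr_of_eventuallyEq (e1 y hy)
  have hconc : ConcaveOn ℝ (Icc 0 y₀) ψ := by
    refine concaveOn_of_deriv2_nonpos (convex_Icc _ _) (hc.add (by fun_prop)) ?_ ?_ ?_ <;>
      rw [interior_Icc]
    · exact fun y hy => (d1 y hy).differentiableAt.differentiableWithinAt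
    · exact fun y hy => (d2 y hy).differentiableAt.differentiableWithinAt
    · intro y hy
      have : deriv^[2] ψ y = φ'' y + τ := (d2 y hy).deriv
      linarith [h3 y hy]
  have := hconc.2 (show (0 : ℝ) ∈ Icc 0 y₀ from ⟨le_rfl, by linarith⟩)
    (show 2 * y ∈ Icc 0 y₀ from ⟨by linarith, hy2⟩) (show (0 : ℝ) ≤ 1 / 2 by norm_num)
    (show (0 : ℝ) ≤ 1 / 2 by norm_num) (by norm_num)
  simp only [smul_eq_mul, mul_zero, zero_add, hψ] at this
  rw [show (1 / 2 : ℝ) * (2 * y) = y by ring] at this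
  nlinarith

/-- If `Re k''` has a positive vertical limit at a boundary point, then `Re k` does not have a
local maximum along the boundary at that point. -/
lemma false_of_boundary_max {k g f : ℂ → ℂ} {r l : ℝ} (hr : 0 < r)
    (hc : ContinuousOn k (Icc (-r) r ×ℂ Icc 0 r))
    (hk : ∀ z ∈ Ioo (-r) r ×ℂ Ioo 0 r, HasDerivAt k (g z) z)
    (hg : ∀ z ∈ Ioo (-r) r ×ℂ Ioo 0 r, HasDerivAt g (f z) z)
    (hmax : ∀ x ∈ Icc (-r) r, (k (x : ℝ)).re ≤ (k 0).re)
    (hl : 0 < l) (hf : Tendsto (fun ε : ℝ => (f (ε * I)).re) (𝓝[>] 0) (𝓝 l)) : False := by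
  obtain ⟨C, hC⟩ := exists_sub_half_le (k := fun z => k z - k 0) hr (hc.sub continuousOn_const)
    (fun z hz => ((hk z hz).sub_const _).differentiableAt.differentiableWithinAt)
    (fun x hx => by simpa using hmax x hx)
  have h1 : ∀ᶠ ε : ℝ in 𝓝[>] 0, l / 2 < (f (ε * I)).re := hf.eventually (lt_mem_nhds (by linarith))
  obtain ⟨y₁, hy₁, h2⟩ := (mem_nhdsGT_iff_exists_Ioo_subset).1 h1
  rw [mem_Ioi] at hy₁
  set y₀ := min y₁ r with hy₀
  have hy₀pos : 0 < y₀ := lt_min hy₁ hr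
  have hmem : ∀ y ∈ Ioo 0 y₀, (y * I : ℂ) ∈ Ioo (-r) r ×ℂ Ioo 0 r := fun y hy => by
    simpa [Complex.mem_reProdIm, hr, hy.1] using hy.2.trans_le (min_le_right _ _)
  have dI : ∀ y : ℝ, HasDerivAt (fun y : ℝ => (y : ℂ) * I) I y := fun y => by
    simpa using (Complex.ofRealCLM.hasDerivAt (x := y)).mul_const I
  -- Along the imaginary axis the second derivative of `Re k` is `-Re f`, which is below `-l / 2`
  -- close to the boundary.
  have key : ∀ y, 0 < y → 2 * y ≤ y₀ → l / 2 * y ^ 2 / 2 ≤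
      (k (y * I)).re - (k ((2 * y : ℝ) * I)).re / 2 - (k ((0 : ℝ) * I)).re / 2 := by
    intro y hy hy2
    refine sub_half_ge_of_deriv2_le (φ := fun y : ℝ => (k (y * I)).re)
      (φ' := fun y : ℝ => (g (y * I) * I).re) (φ'' := fun y : ℝ => (f (y * I) * I * I).re)
      (y₀ := y₀) ?_ ?_ ?_ ?_ hy hy2
    · refine Complex.continuous_re.comp_continuousOn (hc.comp (by fun_prop) fun t ht => ?_)
      simpa [Complex.mem_reProdIm, hr.le, ht.1] using ht.2.trans (min_le_right _ _)
    · intro t ht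
      have h1 : HasDerivAt (fun y : ℝ => k (y * I)) (g (t * I) * I) t :=
        (hk _ (hmem t ht)).comp t (dI t)
      exact (Complex.reCLM.hasFDerivAt (x := k (t * I))).comp_hasDerivAt t h1
    · intro t ht
      have h1 : HasDerivAt (fun y : ℝ => g (y * I) * I) (f (t * I) * I * I) t :=
        ((hg _ (hmem t ht)).comp t (dI t)).mul_const I
      exact (Complex.reCLM.hasFDerivAt (x := g (t * I) * I)).comp_hasDerivAt t h1
    · intro t ht
      have := h2 (show t ∈ Ioo 0 y₁ from ⟨ht.1, ht.2.trans_le (min_le_left _ _)⟩)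
      rw [mem_ofPred_eq] at this
      rw [mul_assoc, Complex.I_mul_I]
      simp
      linarith
  -- The second entry makes `|C| y < l / 4`, so that the cubic upper bound falls below the quadratic
  -- lower bound; the first keeps both bounds applicable.
  set y := min (y₀ / 4) (l / (4 * (|C| + 1)) / 2) with hy
  have hypos : 0 < y := lt_min (by linarith) (by positivity)
  have hy4 : y ≤ y₀ / 4 := min_le_left _ _
  have h3 := key y hypos (by linarith)
  have h4 := hC y hypos (by linarith [min_le_right y₁ r])
  simp only [Complex.sub_re, Complex.ofReal_zero, zero_mul] at h3 h4
  have h5 : l / 4 * y ^ 2 ≤ |C| * y * y ^ 2 := by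
    have : C * y ^ 3 ≤ |C| * y ^ 3 := by gcongr; exact le_abs_self C
    nlinarith
  have h6 : l / 4 ≤ |C| * y := le_of_mul_le_mul_right h5 (by positivity)
  have h7 : |C| * y < l / 4 := by
    have h8 : y ≤ l / (4 * (|C| + 1)) / 2 := min_le_right _ _
    have h9 : (|C| + 1) * y ≤ l / 8 := by
      calc (|C| + 1) * y ≤ (|C| + 1) * (l / (4 * (|C| + 1)) / 2) := by gcongr
        _ = l / 8 := by field_simp; norm_num
    nlinarith
  linarith

lemma hasDerivWithinAt_ofReal_box {k : ℂ → ℂ} {k' : ℂ} {a b Y x : ℝ} (hY : 0 ≤ Y)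
    (h : HasDerivWithinAt k k' (Icc a b ×ℂ Icc 0 Y) x) :
    HasDerivWithinAt (fun x : ℝ => k x) k' (Icc a b) x := by
  have h1 : HasDerivWithinAt (fun x : ℝ => (x : ℂ)) 1 (Icc a b) x :=
    (Complex.ofRealCLM.hasDerivAt (x := x)).hasDerivWithinAt
  have := h.scomp x h1 (fun t ht => by simpa [Complex.mem_reProdIm, hY] using ht)
  simpa using! this

/-- The real part of a holomorphic function, continuous up to the real axis, grows at least at the
rate given by a pointwise lower bound for the vertical limits of the real part of its
derivative. -/
lemma le_re_sub_re_of_tendsto {g f : ℂ → ℂ} {l : ℝ → ℝ} {a b Y m : ℝ} (hab : a < b) (hY : 0 < Y)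
    (hc : ContinuousOn g (Icc a b ×ℂ Icc 0 Y))
    (hg : ∀ z ∈ Ioo a b ×ℂ Ioo 0 Y, HasDerivAt g (f z) z)
    (hf : ∀ x ∈ Ioo a b, Tendsto (fun ε : ℝ => (f (x + ε * I)).re) (𝓝[>] 0) (𝓝 (l x)))
    (hm : ∀ x ∈ Ioo a b, m ≤ l x) : m * (b - a) ≤ (g b).re - (g a).re := by
  have main : ∀ τ : ℝ, 0 < τ → (m - τ) * (b - a) ≤ (g b).re - (g a).re := by
    intro τ hτ
    by_contra! hcon
    -- After tilting, `Re g₁` decreases from `a` to `b`. For `c` strictly between its end values, a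
    -- primitive of `g₁ - c` has real part increasing at `a` and decreasing at `b`, so that real
    -- part has an interior maximum along the axis. There the second derivative has vertical limit
    -- at least `τ > 0`, which is impossible.
    set g₁ : ℂ → ℂ := fun z => g z - ((m - τ : ℝ) : ℂ) * z with hg₁
    have hg₁c : ContinuousOn g₁ (Icc a b ×ℂ Icc 0 Y) := hc.sub (by fun_prop)
    have hg₁d : ∀ z ∈ Ioo a b ×ℂ Ioo 0 Y, HasDerivAt g₁ (f z - ((m - τ : ℝ) : ℂ)) z := by
      intro z hz
      have := (hg z hz).sub ((hasDerivAt_id z).const_mul ((m - τ : ℝ) : ℂ))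
      rwa [mul_one] at this
    obtain ⟨k, hk⟩ := exists_primitive_box hab hY hg₁c
      fun z hz => (hg₁d z hz).differentiableAt.differentiableWithinAt
    have hlt : (g₁ b).re < (g₁ a).re := by
      simp only [hg₁, Complex.sub_re, Complex.re_ofReal_mul, Complex.ofReal_re]
      linarith
    obtain ⟨c, hc1, hc2⟩ := exists_between hlt
    set H : ℝ → ℝ := fun x => (k x).re - c * x with hH
    have hHd : ∀ x ∈ Icc a b, HasDerivWithinAt H ((g₁ x).re - c) (Icc a b) x := by
      intro x hx
      have h1 := hasDerivWithinAt_ofReal_box hY.le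
        (hk x (by simpa [Complex.mem_reProdIm, hY.le] using hx))
      have h2 : HasDerivWithinAt (fun x : ℝ => (k x).re) (g₁ x).re (Icc a b) x :=
        Complex.reCLM.hasFDerivAt.comp_hasDerivWithinAt x h1
      simpa using! h2.sub (((hasDerivAt_id x).const_mul c).hasDerivWithinAt)
    have hHc : ContinuousOn H (Icc a b) := fun x hx => (hHd x hx).continuousWithinAt
    obtain ⟨x₀, hx₀, hmax⟩ := isCompact_Icc.exists_isMaxOn (nonempty_Icc.2 hab.le) hHc
    -- A maximum at `a` would force a nonpositive one-sided derivative, but that derivative is `Re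
    -- g₁(a) - c > 0`.
    have hxa : x₀ ≠ a := by
      rintro rfl
      refine absurd (sub_nonpos_of_le hc2.le) ?_
      have : b - x₀ ∈ posTangentConeAt (Icc x₀ b) x₀ :=
        sub_mem_posTangentConeAt_of_segment_subset
          ((segment_eq_Icc hab.le).subset.trans Subset.rfl)
      have h2 := hmax.localize.hasFDerivWithinAt_nonpos (hHd x₀ hx₀).hasFDerivWithinAt this
      simp at h2
      nlinarith
    have hxb : x₀ ≠ b := by
      rintro rfl
      have : a - x₀ ∈ posTangentConeAt (Icc a x₀) x₀ :=
        sub_mem_posTangentConeAt_of_segment_subset (by rw [segment_symm, segment_eq_Icc hab.le])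
      have h2 := hmax.localize.hasFDerivWithinAt_nonpos (hHd x₀ hx₀).hasFDerivWithinAt this
      simp at h2
      nlinarith
    have hx₀' : x₀ ∈ Ioo a b := ⟨lt_of_le_of_ne hx₀.1 hxa.symm, lt_of_le_of_ne hx₀.2 hxb⟩
    set r := min Y (min (x₀ - a) (b - x₀)) with hr
    have hr0 : 0 < r := lt_min hY (lt_min (by linarith [hx₀'.1]) (by linarith [hx₀'.2]))
    have r1 : r ≤ Y := min_le_left _ _
    have r2 : r ≤ x₀ - a := (min_le_right _ _).trans (min_le_left _ _)
    have r3 : r ≤ b - x₀ := (min_le_right _ _).trans (min_le_right _ _)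
    have hcl : ∀ z ∈ Icc (-r) r ×ℂ Icc 0 r, z + x₀ ∈ Icc a b ×ℂ Icc 0 Y := by
      rintro z ⟨⟨h1, h2⟩, h3, h4⟩
      refine ⟨⟨?_, ?_⟩, ?_, ?_⟩ <;> simp <;> linarith
    have hop : ∀ z ∈ Ioo (-r) r ×ℂ Ioo 0 r, z + x₀ ∈ Ioo a b ×ℂ Ioo 0 Y := by
      rintro z ⟨⟨h1, h2⟩, h3, h4⟩
      refine ⟨⟨?_, ?_⟩, ?_, ?_⟩ <;> simp <;> linarith
    refine false_of_boundary_max (k := fun z => k (z + x₀) - c * z) (g := fun z => g₁ (z + x₀) - c)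
      (f := fun z => f (z + x₀) - ((m - τ : ℝ) : ℂ)) (l := l x₀ - (m - τ)) hr0 ?_ ?_ ?_ ?_ ?_ ?_
    · refine ContinuousOn.sub (ContinuousOn.comp (g := k)
        (fun z hz => (hk z hz).continuousWithinAt) (by fun_prop) hcl) (by fun_prop)
    · intro z hz
      have h1 : HasDerivAt k (g₁ (z + x₀)) (z + x₀) :=
        (hk _ (box_subset _ _ _ _ (hop z hz))).hasDerivAt
          (mem_of_superset ((isOpen_box _ _ _ _).mem_nhds (hop z hz)) (box_subset _ _ _ _))
      simpa using! (h1.comp_add_const z x₀).sub ((hasDerivAt_id z).const_mul (c : ℂ))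
    · intro z hz
      exact ((hg₁d _ (hop z hz)).comp_add_const z x₀).sub_const _
    · intro x hx
      have h1 : x + x₀ ∈ Icc a b := ⟨by linarith [hx.1], by linarith [hx.2]⟩
      have h2 : H (x + x₀) ≤ H x₀ := hmax h1
      simp only [hH] at h2
      push_cast at h2
      simp
      linarith
    · linarith [hm x₀ hx₀']
    · have := (hf x₀ hx₀').sub_const (m - τ)
      refine this.congr fun ε => ?_
      simp [add_comm]
  have hba : 0 < b - a := sub_pos.2 hab
  refine le_of_forall_pos_le_add fun e he => ?_
  have := main (e / (b - a)) (by positivity)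
  have h2 : (m - e / (b - a)) * (b - a) = m * (b - a) - e := by field_simp
  linarith

end

section

open Complex (I)

/-! ### Second primitives and boundary jumps -/

/-- `p` is continuous on `[a, b] × [0, Y]` and a second primitive of `M` in the interior. -/
def IsSecondPrimitive (p M : ℂ → ℂ) (a b Y : ℝ) : Prop :=
  ContinuousOn p (Icc a b ×ℂ Icc 0 Y) ∧ ∃ m : ℂ → ℂ,
    (∀ z ∈ Ioo a b ×ℂ Ioo 0 Y, HasDerivAt p (m z) z) ∧
      ∀ z ∈ Ioo a b ×ℂ Ioo 0 Y, HasDerivAt m (M z) z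

lemma norm_sub_le_of_norm_deriv_le {h h' : ℝ → ℂ} {B B' : ℝ → ℝ} {s t : ℝ} (hst : s ≤ t)
    (hh : ∀ x ∈ Icc s t, HasDerivAt h (h' x) x) (hB : ∀ x ∈ Icc s t, HasDerivAt B (B' x) x)
    (hle : ∀ x ∈ Icc s t, ‖h' x‖ ≤ B' x) : ‖h t - h s‖ ≤ B t - B s := by
  refine image_norm_le_of_norm_deriv_right_le_deriv_boundary' (f := fun x => h x - h s) (f' := h')
    (B := fun x => B x - B s) (B' := B') ?_ ?_ ?_ ?_ ?_ ?_ (right_mem_Icc.2 hst)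
  · exact fun x hx => ((hh x hx).sub_const _).continuousAt.continuousWithinAt
  · exact fun x hx => ((hh x (Ico_subset_Icc_self hx)).sub_const _).hasDerivWithinAt
  · simp
  · exact fun x hx => ((hB x hx).sub_const _).continuousAt.continuousWithinAt
  · exact fun x hx => ((hB x (Ico_subset_Icc_self hx)).sub_const _).hasDerivWithinAt
  · exact fun x hx => hle x (Ico_subset_Icc_self hx)

lemma hasDerivAt_comp_vertical {p : ℂ → ℂ} {p' : ℂ} {x y : ℝ} (h : HasDerivAt p p' (x + y * I)) :
    HasDerivAt (fun y : ℝ => p (x + y * I)) (p' * I) y := by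
  have h1 : HasDerivAt (fun y : ℝ => (x : ℂ) + y * I) I y := by
    simpa using! ((Complex.ofRealCLM.hasDerivAt (x := y)).mul_const I).const_add (x : ℂ)
  exact h.comp y h1

lemma mk_mem_box {a b c d x y : ℝ} (hx : x ∈ Ioo a b) (hy : y ∈ Ioo c d) :
    (x + y * I : ℂ) ∈ Ioo a b ×ℂ Ioo c d := by
  simpa [Complex.mem_reProdIm] using ⟨hx, hy⟩

/-- Integrating `C / y` would produce a logarithm; the cruder power is enough, since all that
matters is that it can be integrated once more down to `y = 0`. The primitive is bounded on the
middle line of the box, and vertical integration from that line gives the rest. -/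
lemma exists_norm_le_div_sqrt {m M : ℂ → ℂ} {a b Y C : ℝ} (hab : a < b) (hY : 0 < Y)
    (hm : ∀ z ∈ Ioo a b ×ℂ Ioo 0 Y, HasDerivAt m (M z) z)
    (hM : ∀ z ∈ Ioo a b ×ℂ Ioo 0 Y, ‖M z‖ ≤ C / z.im) :
    ∃ A : ℝ, 0 ≤ A ∧ ∀ z ∈ Ioo a b ×ℂ Ioo 0 Y, ‖m z‖ ≤ A / √z.im := by
  set x₁ := (a + b) / 2 with hx₁
  set y₁ := Y / 2 with hy₁
  have hx₁m : x₁ ∈ Ioo a b := ⟨by rw [hx₁]; linarith, by rw [hx₁]; linarith⟩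
  have hy₁m : y₁ ∈ Ioo 0 Y := ⟨by rw [hy₁]; linarith, by rw [hy₁]; linarith⟩
  have hC : 0 ≤ C := by
    have h1 := (norm_nonneg _).trans (hM _ (mk_mem_box hx₁m hy₁m))
    have h2 : (x₁ + y₁ * I : ℂ).im = y₁ := by simp
    rw [h2] at h1
    have := mul_nonneg h1 hy₁m.1.le
    rwa [div_mul_cancel₀ _ hy₁m.1.ne'] at this
  have hor : ∀ x ∈ Ioo a b, ‖m (x + y₁ * I)‖ ≤ ‖m (x₁ + y₁ * I)‖ + C / y₁ * (b - a) := by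
    intro x hx
    have hconv : Convex ℝ (Ioo a b ×ℂ {y₁}) :=
      ((convex_Ioo a b).linear_preimage Complex.reLm).inter
        ((convex_singleton y₁).linear_preimage Complex.imLm)
    have hsub : Ioo a b ×ℂ {y₁} ⊆ Ioo a b ×ℂ Ioo 0 Y := by
      rintro z ⟨h1, h2⟩
      refine ⟨h1, ?_⟩
      rw [mem_preimage, mem_singleton_iff] at h2
      rw [mem_preimage, h2]
      exact hy₁m
    have hmem : ∀ x ∈ Ioo a b, (x + y₁ * I : ℂ) ∈ Ioo a b ×ℂ {y₁} := fun x hx => by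
      simpa [Complex.mem_reProdIm] using hx
    have h1 := hconv.norm_image_sub_le_of_norm_hasDerivWithin_le
      (fun z hz => (hm z (hsub hz)).hasDerivWithinAt) (C := C / y₁) (fun z hz => by
        have := hM z (hsub hz)
        rwa [show z.im = y₁ from hz.2] at this) (hmem x₁ hx₁m) (hmem x hx)
    have h2 : ‖(x + y₁ * I : ℂ) - (x₁ + y₁ * I)‖ ≤ b - a := by
      rw [add_sub_add_right_eq_sub, ← Complex.ofReal_sub, Complex.norm_real, Real.norm_eq_abs,
        abs_le]
      constructor <;> linarith [hx.1, hx.2, hx₁m.1, hx₁m.2]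
    have h3 : ‖m (x + y₁ * I)‖ ≤ ‖m (x₁ + y₁ * I)‖ + ‖m (x + y₁ * I) - m (x₁ + y₁ * I)‖ :=
      norm_le_insert' _ _
    have h4 : C / y₁ * ‖(x + y₁ * I : ℂ) - (x₁ + y₁ * I)‖ ≤ C / y₁ * (b - a) :=
      mul_le_mul_of_nonneg_left h2 (div_nonneg hC hy₁m.1.le)
    linarith
  have ver : ∀ x ∈ Ioo a b, ∀ s ∈ Ioo 0 Y, ∀ t ∈ Ioo 0 Y, s ≤ t →
      ‖m (x + t * I) - m (x + s * I)‖ ≤ 2 * C * √Y / √s := by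
    intro x hx s hs t ht hst
    have hin : ∀ u ∈ Icc s t, u ∈ Ioo 0 Y := fun u hu => ⟨hs.1.trans_le hu.1, hu.2.trans_lt ht.2⟩
    -- The majorant has derivative `C √Y u^(-3/2)`, which dominates `C / u` for `u ≤ Y`.
    have := norm_sub_le_of_norm_deriv_le (h := fun u : ℝ => m (x + u * I))
      (h' := fun u : ℝ => M (x + u * I) * I) (B := fun u => -(2 * C * √Y * (√u)⁻¹))
      (B' := fun u => -(2 * C * √Y * (-(1 / (2 * √u)) / √u ^ 2))) hst
      (fun u hu => hasDerivAt_comp_vertical (hm _ (mk_mem_box hx (hin u hu))))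
      (fun u hu => (((Real.hasDerivAt_sqrt (hin u hu).1.ne').inv
        (Real.sqrt_ne_zero'.2 (hin u hu).1)).const_mul _).neg) ?_
    · have h2 : 0 ≤ 2 * C * √Y * (√t)⁻¹ := by positivity
      rw [div_eq_mul_inv]
      linarith
    · intro u hu
      have hu0 : 0 < u := (hin u hu).1
      have hsu := Real.sqrt_pos.2 hu0
      rw [norm_mul, Complex.norm_I, mul_one]
      refine (hM _ (mk_mem_box hx (hin u hu))).trans ?_
      have him : ((x : ℂ) + u * I).im = u := by simp
      have h3 : √u ≤ √Y := Real.sqrt_le_sqrt (hin u hu).2.le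
      have h4 : -(2 * C * √Y * (-(1 / (2 * √u)) / √u ^ 2)) = C / √u ^ 2 * (√Y / √u) := by
        field_simp
      rw [him, h4, Real.sq_sqrt hu0.le]
      exact le_mul_of_one_le_right (div_nonneg hC hu0.le) ((one_le_div hsu).2 h3)
  have hsY := Real.sqrt_pos.2 hY
  refine ⟨(‖m (x₁ + y₁ * I)‖ + C / y₁ * (b - a) + 2 * C * √Y / √y₁) * √Y + 2 * C * √Y, ?_, ?_⟩
  · have := hy₁m.1
    have : 0 ≤ b - a := by linarith
    positivity
  · intro z hz
    have hz1 : (z.re + z.im * I : ℂ) = z := Complex.re_add_im z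
    have hs := Real.sqrt_pos.2 hz.2.1
    have h1 := hor _ hz.1
    have h2 : ‖m z - m (z.re + y₁ * I)‖ ≤ 2 * C * √Y / √y₁ + 2 * C * √Y / √z.im := by
      have p1 : 0 ≤ 2 * C * √Y / √y₁ := by positivity
      have p2 : 0 ≤ 2 * C * √Y / √z.im := by positivity
      rcases le_total z.im y₁ with h | h
      · have := ver z.re hz.1 z.im hz.2 y₁ hy₁m h
        rw [hz1, norm_sub_rev] at this
        linarith
      · have := ver z.re hz.1 y₁ hy₁m z.im hz.2 h
        rw [hz1] at this
        linarith
    have h3 : ‖m z‖ ≤ ‖m (z.re + y₁ * I)‖ + ‖m z - m (z.re + y₁ * I)‖ := norm_le_insert' _ _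
    have h4 : √z.im ≤ √Y := Real.sqrt_le_sqrt hz.2.2.le
    have h5 : ∀ D : ℝ, 0 ≤ D → D ≤ D * √Y / √z.im := fun D hD => by
      rw [mul_div_assoc]
      exact le_mul_of_one_le_right hD ((one_le_div hs).2 h4)
    have h6 := h5 (‖m (x₁ + y₁ * I)‖ + C / y₁ * (b - a) + 2 * C * √Y / √y₁) (by
      have := hy₁m.1
      have : 0 ≤ b - a := by linarith
      positivity)
    rw [add_div]
    linarith

/-- A holomorphic function which is `O(1 / Im z)` has a second primitive which is continuous up to
the real axis. -/
lemma exists_isSecondPrimitive {M : ℂ → ℂ} {a b Y C : ℝ} (hab : a < b) (hY : 0 < Y)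
    (hd : DifferentiableOn ℂ M (Ioo a b ×ℂ Ioo 0 Y))
    (hM : ∀ z ∈ Ioo a b ×ℂ Ioo 0 Y, ‖M z‖ ≤ C / z.im) : ∃ p, IsSecondPrimitive p M a b Y := by
  have hop := isOpen_box a b 0 Y
  obtain ⟨m, hm⟩ := (convex_box a b 0 Y).exists_forall_hasDerivWithinAt hd
  replace hm : ∀ z ∈ Ioo a b ×ℂ Ioo 0 Y, HasDerivAt m (M z) z := fun z hz =>
    (hm z hz).hasDerivAt (hop.mem_nhds hz)
  obtain ⟨p, hp⟩ := (convex_box a b 0 Y).exists_forall_hasDerivWithinAt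
    (f := m) fun z hz => (hm z hz).differentiableAt.differentiableWithinAt
  replace hp : ∀ z ∈ Ioo a b ×ℂ Ioo 0 Y, HasDerivAt p (m z) z := fun z hz =>
    (hp z hz).hasDerivAt (hop.mem_nhds hz)
  obtain ⟨A, hA0, hA⟩ := exists_norm_le_div_sqrt hab hY hm hM
  have ver : ∀ x ∈ Ioo a b, ∀ s ∈ Ioo 0 Y, ∀ t ∈ Ioo 0 Y, s ≤ t →
      ‖p (x + t * I) - p (x + s * I)‖ ≤ 2 * A * √t := by
    intro x hx s hs t ht hst
    have hin : ∀ u ∈ Icc s t, u ∈ Ioo 0 Y := fun u hu => ⟨hs.1.trans_le hu.1, hu.2.trans_lt ht.2⟩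
    have := norm_sub_le_of_norm_deriv_le (h := fun u : ℝ => p (x + u * I))
      (h' := fun u : ℝ => m (x + u * I) * I) (B := fun u => 2 * A * √u)
      (B' := fun u => 2 * A * (1 / (2 * √u))) hst
      (fun u hu => hasDerivAt_comp_vertical (hp _ (mk_mem_box hx (hin u hu))))
      (fun u hu => (Real.hasDerivAt_sqrt (hin u hu).1.ne').const_mul _) ?_
    · have h2 : 0 ≤ 2 * A * √s := by positivity
      linarith
    · intro u hu
      rw [norm_mul, Complex.norm_I, mul_one]
      refine (hA _ (mk_mem_box hx (hin u hu))).trans (le_of_eq ?_)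
      have him : ((x : ℂ) + u * I).im = u := by simp
      rw [him]
      field_simp
  have huc : UniformContinuousOn p (Ioo a b ×ℂ Ioo 0 Y) := by
    rw [Metric.uniformContinuousOn_iff_le]
    intro τ hτ
    obtain ⟨σ, hσ0, hσY, hσ⟩ : ∃ σ : ℝ, 0 < σ ∧ σ < Y ∧ 2 * A * √σ ≤ τ / 3 := by
      have h1 : Tendsto (fun σ : ℝ => 2 * A * √σ) (𝓝[>] 0) (𝓝 0) := by
        have : Continuous fun σ : ℝ => 2 * A * √σ := by fun_prop
        simpa using (this.tendsto 0).mono_left nhdsWithin_le_nhds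
      have h2 := h1.eventually (gt_mem_nhds (show 0 < τ / 3 by linarith))
      have h3 : ∀ᶠ σ : ℝ in 𝓝[>] 0, σ ∈ Ioo 0 Y := Ioo_mem_nhdsGT hY
      obtain ⟨σ, h4, h5⟩ := (h2.and h3).exists
      exact ⟨σ, h5.1, h5.2, h4.le⟩
    have hss := Real.sqrt_pos.2 hσ0
    refine ⟨τ / 3 / (2 * (A / √σ + 1)), by positivity, fun z hz w hw hzw => ?_⟩
    -- Points are raised to height at least `σ`, at a cost of at most `2A√σ ≤ τ / 3` each; above
    -- that height `p` is Lipschitz with constant `A / √σ`.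
    set lift : ℂ → ℂ := fun z => z.re + (max z.im σ : ℝ) * I with hlift
    have hl1 : ∀ z ∈ Ioo a b ×ℂ Ioo 0 Y, ‖p (lift z) - p z‖ ≤ τ / 3 := by
      intro z hz
      rcases le_total σ z.im with h | h
      · have : lift z = z := by simp only [hlift, max_eq_left h, Complex.re_add_im]
        rw [this, sub_self, norm_zero]
        positivity
      · have h1 := ver z.re hz.1 z.im hz.2 σ ⟨hσ0, hσY⟩ h
        rw [Complex.re_add_im] at h1
        simp only [hlift, max_eq_right h]
        exact h1.trans hσ
    have hconv : Convex ℝ (Ioo a b ×ℂ Ico σ Y) :=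
      ((convex_Ioo a b).linear_preimage Complex.reLm).inter
        ((convex_Ico σ Y).linear_preimage Complex.imLm)
    have hsub : Ioo a b ×ℂ Ico σ Y ⊆ Ioo a b ×ℂ Ioo 0 Y := fun z hz =>
      ⟨hz.1, hσ0.trans_le hz.2.1, hz.2.2⟩
    have hmem : ∀ z ∈ Ioo a b ×ℂ Ioo 0 Y, lift z ∈ Ioo a b ×ℂ Ico σ Y := by
      intro z hz
      refine ⟨?_, ?_⟩
      · simpa [hlift] using hz.1
      · simpa [hlift] using ⟨hz.2.2, hσY⟩
    have h1 := hconv.norm_image_sub_le_of_norm_hasDerivWithin_le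
      (fun z hz => (hp z (hsub hz)).hasDerivWithinAt) (C := A / √σ) (fun z hz =>
        (hA z (hsub hz)).trans (div_le_div_of_nonneg_left hA0 hss (Real.sqrt_le_sqrt hz.2.1)))
      (hmem w hw) (hmem z hz)
    have h2 : ‖lift z - lift w‖ ≤ 2 * ‖z - w‖ := by
      refine (Complex.norm_le_abs_re_add_abs_im _).trans ?_
      have h3 : |(lift z - lift w).re| ≤ ‖z - w‖ := by
        simpa [hlift] using Complex.abs_re_le_norm (z - w)
      have h4 : |(lift z - lift w).im| ≤ ‖z - w‖ := by
        simp only [hlift, Complex.sub_im, Complex.add_im, Complex.ofReal_im, Complex.mul_I_im,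
          Complex.ofReal_re, zero_add]
        exact (abs_max_sub_max_le_abs _ _ _).trans (by simpa using Complex.abs_im_le_norm (z - w))
      linarith
    rw [dist_eq_norm] at hzw ⊢
    have h5 : A / √σ * ‖lift z - lift w‖ ≤ τ / 3 := by
      have h6 : 0 ≤ A / √σ := by positivity
      calc A / √σ * ‖lift z - lift w‖ ≤ (A / √σ + 1) * (2 * ‖z - w‖) := by gcongr; linarith
        _ ≤ (A / √σ + 1) * (2 * (τ / 3 / (2 * (A / √σ + 1)))) := by gcongr
        _ = τ / 3 := by field_simp
    have e : p z - p w = (p (lift z) - p (lift w)) - (p (lift z) - p z) + (p (lift w) - p w) := by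
      ring
    rw [e]
    have := hl1 z hz
    have := hl1 w hw
    have := norm_add_le ((p (lift z) - p (lift w)) - (p (lift z) - p z)) (p (lift w) - p w)
    have := norm_sub_le (p (lift z) - p (lift w)) (p (lift z) - p z)
    linarith
  obtain ⟨q, hqc, hqe⟩ := exists_continuousOn_closure huc
  rw [closure_box hab hY] at hqc
  refine ⟨q, hqc, m, fun z hz => ?_, hm⟩
  exact (hp z hz).congr_of_eventuallyEq (hqe.eventuallyEq_of_mem (hop.mem_nhds hz))

end

/-! ### Right derivatives of increments of the boundary jump. -/

section

open Complex (I)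
open scoped ComplexConjugate

/-- The reflected function `z ↦ conj (M (conj z))`. -/
def reflect (M : ℂ → ℂ) (z : ℂ) : ℂ := conj (M (conj z))

/-- The jump across the real axis of second primitives `p` of `M` and `conj q` of `M` from above and
from below. -/
def boundaryJump (p q : ℂ → ℂ) (x : ℝ) : ℂ := p x - conj (q x)

lemma ofReal_mem_box {a b Y x : ℝ} (hY : 0 ≤ Y) (hx : x ∈ Icc a b) :
    (x : ℂ) ∈ Icc a b ×ℂ Icc 0 Y := by simpa [Complex.mem_reProdIm, hY] using hx

lemma continuousOn_boundaryJump {p q M N : ℂ → ℂ} {a b Y : ℝ} (hY : 0 ≤ Y)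
    (hp : IsSecondPrimitive p M a b Y) (hq : IsSecondPrimitive q N a b Y) :
    ContinuousOn (boundaryJump p q) (Icc a b) :=
  (hp.1.comp (by fun_prop) fun _ hx => ofReal_mem_box hY hx).sub
    (Complex.continuous_conj.comp_continuousOn
      (hq.1.comp (by fun_prop) fun _ hx => ofReal_mem_box hY hx))

lemma hasDerivAt_comp_horizontal {p : ℂ → ℂ} {p' : ℂ} {x y : ℝ}
    (h : HasDerivAt p p' (x + y * I)) : HasDerivAt (fun x : ℝ => p (x + y * I)) p' x := by
  have h1 : HasDerivAt (fun x : ℝ => (x : ℂ) + y * I) 1 x :=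
    (Complex.ofRealCLM.hasDerivAt (x := x)).add_const _
  simpa using! h.comp x h1

lemma integral_horizontal {m M : ℂ → ℂ} {a b Y x d ε : ℝ}
    (hm : ∀ z ∈ Ioo a b ×ℂ Ioo 0 Y, HasDerivAt m (M z) z)
    (hM : ContinuousOn M (Ioo a b ×ℂ Ioo 0 Y)) (hd : 0 ≤ d) (hx : a < x) (hxd : x + d < b)
    (hε : ε ∈ Ioo 0 Y) :
    IntervalIntegrable (fun t : ℝ => M (t + ε * I)) volume x (x + d) ∧
      ∫ t in x..x + d, M (t + ε * I) = m ((x + d : ℝ) + ε * I) - m (x + ε * I) := by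
  have hle : x ≤ x + d := by linarith
  have hin : ∀ t ∈ uIcc x (x + d), t ∈ Ioo a b := fun t ht => by
    rw [uIcc_of_le hle] at ht
    exact ⟨hx.trans_le ht.1, ht.2.trans_lt hxd⟩
  have hint : IntervalIntegrable (fun t : ℝ => M (t + ε * I)) volume x (x + d) :=
    (hM.comp (by fun_prop) fun t ht => mk_mem_box (hin t ht) hε).intervalIntegrable
  exact ⟨hint, intervalIntegral.integral_eq_sub_of_hasDerivAt
    (fun t ht => hasDerivAt_comp_horizontal (hm _ (mk_mem_box (hin t ht) hε))) hint⟩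

/-- Test with `w = -Ē / ‖E‖`. This turns the one-sided bounds on real parts supplied by
`le_re_sub_re_of_tendsto`, applied in every direction `w`, into a norm estimate. -/
lemma norm_le_of_forall_re_le {E : ℂ} {c : ℝ} (hc : 0 ≤ c)
    (h : ∀ w : ℂ, ‖w‖ = 1 → -c ≤ (w * E).re) : ‖E‖ ≤ c := by
  rcases eq_or_ne E 0 with rfl | hE
  · simpa using hc
  · have hn : ‖E‖ ≠ 0 := norm_ne_zero_iff.2 hE
    have h1 := h (-(conj E / ‖E‖)) (by simp [hn])
    have h2 : -(conj E / ‖E‖) * E = ((-‖E‖ : ℝ) : ℂ) := by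
      have : conj E * E = (‖E‖ : ℂ) ^ 2 := Complex.conj_mul' E
      have hn' : (‖E‖ : ℂ) ≠ 0 := by exact_mod_cast hn
      push_cast
      field_simp
      linear_combination -this
    rw [h2, Complex.ofReal_re] at h1
    linarith

/-- If the integrals over `[x, x + d]` of the jump of `M` across the real axis have limits `G x`,
and `G x → l` as `x ↓ x₀`, then the increment over `[x, x + d]` of the boundary jump of the second
primitives has right derivative `l` at `x₀`. -/
lemma hasDerivWithinAt_boundaryJump {p q M : ℂ → ℂ} {G : ℝ → ℂ} {l : ℂ} {a b Y x₀ d : ℝ}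
    (hY : 0 < Y) (hp : IsSecondPrimitive p M a b Y) (hq : IsSecondPrimitive q (reflect M) a b Y)
    (hM : ContinuousOn M (Ioo a b ×ℂ Ioo 0 Y))
    (hM' : ContinuousOn (reflect M) (Ioo a b ×ℂ Ioo 0 Y))
    (hd : 0 < d) (ha : a ≤ x₀) (hb : x₀ + d < b)
    (hG : ∀ᶠ x in 𝓝[>] x₀, Tendsto (fun ε : ℝ => ∫ t in x..x + d, (M (t + ε * I) - M (t - ε * I)))
      (𝓝[>] 0) (𝓝 (G x)))
    (hl : Tendsto G (𝓝[>] x₀) (𝓝 l)) :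
    HasDerivWithinAt (fun x => boundaryJump p q (x + d) - boundaryJump p q x) l (Ici x₀) x₀ := by
  obtain ⟨hpc, m, hp1, hp2⟩ := hp
  obtain ⟨hqc, n, hq1, hq2⟩ := hq
  rw [hasDerivWithinAt_iff_isLittleO, Asymptotics.isLittleO_iff]
  intro τ hτ
  have h1 : ∀ᶠ x in 𝓝[>] x₀, ‖G x - l‖ < τ := by
    have := (hl.sub_const l).norm
    rw [sub_self, norm_zero] at this
    exact this.eventually (gt_mem_nhds hτ)
  obtain ⟨x₁, hx₁, hsub⟩ := mem_nhdsGT_iff_exists_Ioo_subset.1 (hG.and h1)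
  rw [mem_Ioi] at hx₁
  have h2 : ∀ᶠ x in 𝓝[≥] x₀, x ∈ Ico x₀ (min x₁ (b - d)) :=
    Ico_mem_nhdsGE (lt_min hx₁ (by linarith))
  filter_upwards [h2] with x hx
  rcases hx.1.eq_or_lt with rfl | hx0
  · simp
  have hxx₁ : x < x₁ := hx.2.trans_le (min_le_left _ _)
  have hxb : x + d < b := by linarith [hx.2.trans_le (min_le_right x₁ (b - d))]
  set D : ℝ → ℂ := fun x => boundaryJump p q (x + d) - boundaryJump p q x with hD
  have hnorm : ‖D x - D x₀ - (x - x₀) • l‖ ≤ τ * (x - x₀) := by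
    refine norm_le_of_forall_re_le (mul_nonneg hτ.le (by linarith)) fun w hw => ?_
    -- `t + d` and `t` stay in the box
    have hcl : ∀ z ∈ Icc x₀ x ×ℂ Icc 0 Y, z ∈ Icc a b ×ℂ Icc 0 Y ∧ z + d ∈ Icc a b ×ℂ Icc 0 Y := by
      rintro z ⟨⟨h1, h2⟩, h3, h4⟩
      refine ⟨⟨⟨?_, ?_⟩, ?_, ?_⟩, ⟨?_, ?_⟩, ?_, ?_⟩ <;> (try simp) <;> linarith
    have hop : ∀ z ∈ Ioo x₀ x ×ℂ Ioo 0 Y, z ∈ Ioo a b ×ℂ Ioo 0 Y ∧ z + d ∈ Ioo a b ×ℂ Ioo 0 Y := by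
      rintro z ⟨⟨h1, h2⟩, h3, h4⟩
      refine ⟨⟨⟨?_, ?_⟩, ?_, ?_⟩, ⟨?_, ?_⟩, ?_, ?_⟩ <;> (try simp) <;> linarith
    have hshift : ∀ r : ℂ → ℂ, ContinuousOn r (Icc a b ×ℂ Icc 0 Y) →
        ContinuousOn (fun z => r (z + d) - r z) (Icc x₀ x ×ℂ Icc 0 Y) := fun r hr =>
      (hr.comp (by fun_prop) fun z hz => (hcl z hz).2).sub (hr.mono fun z hz => (hcl z hz).1)
    -- Since `Re (w̄ q) = Re (w q̄)`, this combination of `p` and `q` is holomorphic and its real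
    -- part on the axis is that of `w` times the increment of the jump. The real part of its
    -- derivative at height `ε` is that of `w` times the integral of `M(t + iε) - M(t - iε)`, which
    -- has the limit `Re (w G)`.
    have key := le_re_sub_re_of_tendsto
      (g := fun z => w * (p (z + d) - p z) - conj w * (q (z + d) - q z))
      (f := fun z => w * (m (z + d) - m z) - conj w * (n (z + d) - n z))
      (l := fun t => (w * G t).re) (m := (w * l).re - τ) hx0 hY
      ((continuousOn_const.mul (hshift p hpc)).sub (continuousOn_const.mul (hshift q hqc)))
      (fun z hz => ((((hp1 _ (hop z hz).2).comp_add_const z d).sub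
          (hp1 _ (hop z hz).1)).const_mul w).sub
        ((((hq1 _ (hop z hz).2).comp_add_const z d).sub
          (hq1 _ (hop z hz).1)).const_mul (conj w))) ?_ ?_
    · have e1 : ∀ t : ℝ, ((fun z : ℂ => w * (p (z + d) - p z) - conj w * (q (z + d) - q z)) t).re =
          (w * D t).re := by
        intro t
        simp only [hD, boundaryJump, Complex.ofReal_add, Complex.sub_re, Complex.mul_re,
          Complex.conj_re, Complex.conj_im, Complex.sub_im]
        ring
      rw [e1, e1] at key
      have e2 : (w * (D x - D x₀ - (x - x₀) • l)).re =
          (w * D x).re - (w * D x₀).re - (x - x₀) * (w * l).re := by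
        simp only [Complex.sub_re, Complex.mul_re, Complex.sub_im, Complex.smul_re, Complex.smul_im,
          smul_eq_mul]
        ring
      rw [e2]
      linarith
    · intro t ht
      have ht' : t ∈ Ioo x₀ x₁ := ⟨ht.1, ht.2.trans hxx₁⟩
      have h3 := (hsub ht').1
      have h4 : Tendsto (fun ε : ℝ => (w * ∫ t in t..t + d, (M (t + ε * I) - M (t - ε * I))).re)
          (𝓝[>] 0) (𝓝 (w * G t).re) :=
        (Complex.continuous_re.tendsto _).comp (h3.const_mul w)
      refine h4.congr' ?_
      filter_upwards [Ioo_mem_nhdsGT hY] with ε hε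
      obtain ⟨i1, e1⟩ := integral_horizontal hp2 hM hd.le (show a < t by linarith [ht.1])
        (show t + d < b by linarith [ht.2]) hε
      obtain ⟨i2, e2⟩ := integral_horizontal hq2 hM' hd.le (show a < t by linarith [ht.1])
        (show t + d < b by linarith [ht.2]) hε
      have e3 : ∀ s : ℝ, M (s - ε * I) = conj (reflect M (s + ε * I)) := fun s => by
        simp [reflect, sub_eq_add_neg]
      have i3 : IntervalIntegrable (fun s : ℝ => conj (reflect M (s + ε * I))) volume t (t + d) :=
        ⟨Complex.conjCLE.toContinuousLinearMap.integrable_comp i2.1,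
          Complex.conjCLE.toContinuousLinearMap.integrable_comp i2.2⟩
      have e4 : ∫ s in t..t + d, conj (reflect M (s + ε * I)) =
          conj (∫ s in t..t + d, reflect M (s + ε * I)) := by
        simp only [intervalIntegral, integral_conj, map_sub]
      simp only [e3]
      rw [intervalIntegral.integral_sub i1 i3, e4, e1, e2]
      have e5 : ((t + d : ℝ) : ℂ) + ε * I = t + ε * I + d := by push_cast; ring
      rw [e5]
      simp only [Complex.sub_re, Complex.mul_re, Complex.conj_re, Complex.conj_im, Complex.sub_im]
      ring
    · intro t ht
      have ht' : t ∈ Ioo x₀ x₁ := ⟨ht.1, ht.2.trans hxx₁⟩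
      have h3 := (hsub ht').2
      have h4 : -(w * (G t - l)).re ≤ ‖w * (G t - l)‖ := 
        (neg_le_abs _).trans (Complex.abs_re_le_norm _)
      rw [norm_mul, hw, one_mul, mul_sub, Complex.sub_re] at h4
      linarith
  rw [Real.norm_of_nonneg (by linarith : 0 ≤ x - x₀)]
  exact hnorm

end

section

/-! ### Integration by parts for complex measures on the line -/

/-- The variation is dominated by the sum of the total variations of the real and imaginary parts,
both finite. -/
lemma isFiniteMeasure_variation {X : Type*} [MeasurableSpace X] (μ : ComplexMeasure X) :
    IsFiniteMeasure μ.variation := by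
  have hle : μ.variation ≤ (ComplexMeasure.re μ).totalVariation +
      (ComplexMeasure.im μ).totalVariation := by
    refine VectorMeasure.variation_le_of_forall_enorm_le fun E hE => ?_
    have h1 : μ E = ((ComplexMeasure.re μ E : ℝ) : ℂ) + ((ComplexMeasure.im μ E : ℝ) : ℂ) *
        Complex.I := (Complex.re_add_im (μ E)).symm
    rw [h1, Measure.add_apply]
    refine (enorm_add_le _ _).trans (add_le_add ?_ ?_)
    · refine le_trans (le_of_eq ?_) (SignedMeasure.enorm_le_totalVariation _ E)
      simp [enorm_eq_nnnorm]
    · refine le_trans (le_of_eq ?_) (SignedMeasure.enorm_le_totalVariation _ E)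
      simp [enorm_eq_nnnorm]
  exact isFiniteMeasure_of_le _ hle

lemma tendsto_measureReal_Ioc (V : Measure ℝ) [IsFiniteMeasure V] (x : ℝ) :
    Tendsto (fun y => V.real (Ioc x y)) (𝓝[>] x) (𝓝 0) := by
  have h := tendsto_measure_biInter_gt (μ := V) (s := fun r => Ioc x r) (a := x)
    (fun r _ => measurableSet_Ioc.nullMeasurableSet) (fun i j _ hij => Ioc_subset_Ioc_right hij)
    ⟨x + 1, by simp, measure_ne_top _ _⟩
  have he : (⋂ r > x, Ioc x r) = ∅ := by
    refine eq_empty_of_forall_notMem fun y hy => ?_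
    simp only [mem_iInter] at hy
    have h1 := (hy (x + 1) (by simp)).1
    have h2 := (hy ((x + y) / 2) (by simp; linarith)).2
    linarith
  rw [he, measure_empty] at h
  exact (ENNReal.tendsto_toReal (by simp)).comp h

variable (μ : ComplexMeasure ℝ)

lemma norm_apply_le_variation_real (s : Set ℝ) : ‖μ s‖ ≤ μ.variation.real s := by
  have := isFiniteMeasure_variation μ
  exact VectorMeasure.norm_measure_le_variation

lemma measure_Ioc_sub (a : ℝ) {x y : ℝ} (hax : a ≤ x) (hxy : x ≤ y) :
    μ (Ioc a y) - μ (Ioc a x) = μ (Ioc x y) := by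
  rw [← Ioc_union_Ioc_eq_Ioc hax hxy, VectorMeasure.of_union (Ioc_disjoint_Ioc_of_le le_rfl)
    measurableSet_Ioc measurableSet_Ioc]
  ring

lemma tendsto_measure_Ioc_right {a x : ℝ} (hax : a ≤ x) :
    Tendsto (fun y => μ (Ioc a y)) (𝓝[>] x) (𝓝 (μ (Ioc a x))) := by
  have := isFiniteMeasure_variation μ
  rw [tendsto_iff_norm_sub_tendsto_zero]
  refine squeeze_zero' (Eventually.of_forall fun _ => norm_nonneg _) ?_
    (tendsto_measureReal_Ioc μ.variation x)
  filter_upwards [self_mem_nhdsWithin] with y hy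
  rw [measure_Ioc_sub μ a hax (le_of_lt hy)]
  exact norm_apply_le_variation_real μ _

lemma stronglyMeasurable_measure_Ioc (a : ℝ) : StronglyMeasurable fun x => μ (Ioc a x) := by
  have hs : MeasurableSet {p : ℝ × ℝ | a < p.2 ∧ p.2 ≤ p.1} :=
    (measurableSet_lt measurable_const measurable_snd).inter
      (measurableSet_le measurable_snd measurable_fst)
  exact VectorMeasure.stronglyMeasurable_vectorMeasure_prodMk_left (ν := μ) hs

lemma intervalIntegrable_mul_measure_Ioc {h : ℝ → ℂ} (hh : Continuous h) (a x y : ℝ) :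
    IntervalIntegrable (fun t => h t * μ (Ioc a t)) volume x y := by
  have := isFiniteMeasure_variation μ
  have h1 : IntervalIntegrable (fun t => μ (Ioc a t)) volume x y := by
    refine (intervalIntegrable_const (c := μ.variation.real univ)).mono_fun'
      (stronglyMeasurable_measure_Ioc μ a).aestronglyMeasurable (Eventually.of_forall fun t => ?_)
    exact (norm_apply_le_variation_real μ _).trans (measureReal_mono (subset_univ _))
  exact h1.continuousOn_mul hh.continuousOn

lemma integrable_of_continuous_Ioc {h : ℝ → ℂ} (hh : Continuous h) (a b : ℝ) :
    μ.IntegrableOn h (Ioc a b) := by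
  have := isFiniteMeasure_variation μ
  have h1 : IntegrableOn h (Ioc a b) μ.variation :=
    (hh.continuousOn.integrableOn_compact isCompact_Icc).mono_set Ioc_subset_Icc_self
  rwa [VectorMeasure.IntegrableOn, VectorMeasure.Integrable,
    VectorMeasure.variation_restrict measurableSet_Ioc]

/-- Integration by parts against a complex measure. -/
lemma integral_Ioc_complexMeasure {h h' : ℝ → ℂ} (hd : ∀ x, HasDerivAt h (h' x) x)
    (hc : Continuous h') {a b : ℝ} (hab : a ≤ b) :
    ∫ᵛ t in Ioc a b, h t ∂[ContinuousLinearMap.mul ℝ ℂ; μ] =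
      h b * μ (Ioc a b) - ∫ x in a..b, h' x * μ (Ioc a x) := by
  have hfin := isFiniteMeasure_variation μ
  have hhc : Continuous h := continuous_iff_continuousAt.2 fun x => (hd x).continuousAt
  obtain ⟨C, hC⟩ := (isCompact_Icc (a := a) (b := b)).exists_bound_of_continuousOn hc.continuousOn
  -- `J` is the defect in the formula on `(a, x]`. Its increments are `O(|μ|((x, y]) (y - x))`, so
  -- it is Lipschitz. As `y ↓ x` the intervals `(x, y]` shrink to the empty set, so its right
  -- derivative vanishes and `J` keeps its initial value `0`. Atoms of `μ` do no harm because `(x,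
  -- y]` excludes its left endpoint.
  set J : ℝ → ℂ := fun x => (∫ᵛ t in Ioc a x, h t ∂[ContinuousLinearMap.mul ℝ ℂ; μ]) -
    h x * μ (Ioc a x) + ∫ t in a..x, h' t * μ (Ioc a t) with hJ
  have hincr : ∀ x y, a ≤ x → x ≤ y → y ≤ b →
      ‖J y - J x‖ ≤ 2 * C * μ.variation.real (Ioc x y) * (y - x) := by
    intro x y hax hxy hyb
    have e1 : ∫ᵛ t in Ioc a y, h t ∂[ContinuousLinearMap.mul ℝ ℂ; μ] =
        (∫ᵛ t in Ioc a x, h t ∂[ContinuousLinearMap.mul ℝ ℂ; μ]) +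
          ∫ᵛ t in Ioc x y, h t ∂[ContinuousLinearMap.mul ℝ ℂ; μ] := by
      rw [← Ioc_union_Ioc_eq_Ioc hax hxy, VectorMeasure.setIntegral_union
        (Ioc_disjoint_Ioc_of_le le_rfl) measurableSet_Ioc measurableSet_Ioc
        (integrable_of_continuous_Ioc μ hhc _ _) (integrable_of_continuous_Ioc μ hhc _ _)]
    have e2 : ∫ᵛ t in Ioc x y, (h t - h y) ∂[ContinuousLinearMap.mul ℝ ℂ; μ] =
        (∫ᵛ t in Ioc x y, h t ∂[ContinuousLinearMap.mul ℝ ℂ; μ]) - h y * μ (Ioc x y) := by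
      rw [VectorMeasure.integral_fun_sub (integrable_of_continuous_Ioc μ hhc _ _)
        (integrable_of_continuous_Ioc μ continuous_const _ _), VectorMeasure.setIntegral_const]
      rfl
    have e3 : ∫ t in x..y, h' t * (μ (Ioc a t) - μ (Ioc a x)) =
        (∫ t in a..y, h' t * μ (Ioc a t)) - (∫ t in a..x, h' t * μ (Ioc a t)) -
          (h y - h x) * μ (Ioc a x) := by
      have h1 : ∫ t in x..y, h' t = h y - h x :=
        intervalIntegral.integral_eq_sub_of_hasDerivAt (fun t _ => hd t)
          (hc.intervalIntegrable _ _)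
      have h2 : IntervalIntegrable (fun t => h' t * μ (Ioc a x)) volume x y :=
        (hc.mul continuous_const).intervalIntegrable _ _
      simp only [mul_sub]
      rw [intervalIntegral.integral_sub (intervalIntegrable_mul_measure_Ioc μ hc _ _ _) h2,
        intervalIntegral.integral_mul_const, h1,
        intervalIntegral.integral_interval_sub_left (intervalIntegrable_mul_measure_Ioc μ hc _ _ _)
        (intervalIntegrable_mul_measure_Ioc μ hc _ _ _)]
    have e4 : J y - J x = (∫ᵛ t in Ioc x y, (h t - h y) ∂[ContinuousLinearMap.mul ℝ ℂ; μ]) +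
        ∫ t in x..y, h' t * (μ (Ioc a t) - μ (Ioc a x)) := by
      simp only [hJ]
      rw [e1, e2, e3, ← measure_Ioc_sub μ a hax hxy]
      ring
    have hlip : ∀ t ∈ Ioc x y, ‖h t - h y‖ ≤ C * (y - x) := by
      intro t ht
      have h1 := (convex_Icc a b).norm_image_sub_le_of_norm_hasDerivWithin_le
        (fun s _ => (hd s).hasDerivWithinAt) (fun s hs => hC s hs)
        (show y ∈ Icc a b from ⟨hax.trans hxy, hyb⟩)
        (show t ∈ Icc a b from ⟨hax.trans ht.1.le, ht.2.trans hyb⟩)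
      refine h1.trans ?_
      have hC0 : 0 ≤ C := (norm_nonneg _).trans (hC a (left_mem_Icc.2 (hax.trans (hxy.trans hyb))))
      rw [norm_sub_rev, Real.norm_of_nonneg (by linarith [ht.2])]
      gcongr
      exact ht.1.le
    have b1 : ‖∫ᵛ t in Ioc x y, (h t - h y) ∂[ContinuousLinearMap.mul ℝ ℂ; μ]‖ ≤
        C * (y - x) * 1 * μ.variation.real (Ioc x y) := by
      have h1 : ∀ᵐ t ∂(μ.restrict (Ioc x y)).variation, ‖h t - h y‖ ≤ C * (y - x) := by
        rw [VectorMeasure.variation_restrict measurableSet_Ioc]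
        exact (ae_restrict_iff' measurableSet_Ioc).2 (Eventually.of_forall hlip)
      have h2 := VectorMeasure.norm_integral_le_of_norm_le_const
        (B := ContinuousLinearMap.mul ℝ ℂ) h1
      rw [VectorMeasure.variation_restrict measurableSet_Ioc, measureReal_restrict_apply_univ,
        ContinuousLinearMap.opNorm_mul] at h2
      exact h2
    have b2 : ‖∫ t in x..y, h' t * (μ (Ioc a t) - μ (Ioc a x))‖ ≤
        C * μ.variation.real (Ioc x y) * |y - x| := by
      refine intervalIntegral.norm_integral_le_of_norm_le_const fun t ht => ?_
      rw [uIoc_of_le hxy] at ht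
      rw [norm_mul, measure_Ioc_sub μ a hax ht.1.le]
      have hCt := hC t ⟨hax.trans ht.1.le, ht.2.trans hyb⟩
      exact mul_le_mul hCt ((norm_apply_le_variation_real μ _).trans
        (measureReal_mono (Ioc_subset_Ioc_right ht.2))) (norm_nonneg _)
        ((norm_nonneg _).trans hCt)
    rw [abs_of_nonneg (by linarith)] at b2
    rw [e4]
    refine (norm_add_le _ _).trans ((add_le_add b1 b2).trans (le_of_eq ?_))
    ring
  have hC0 : 0 ≤ C := (norm_nonneg _).trans (hC a (left_mem_Icc.2 hab))
  have hJc : ContinuousOn J (Icc a b) := by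
    set K := 2 * C * μ.variation.real univ with hK
    have hlip : LipschitzOnWith K.toNNReal J (Icc a b) := by
      refine LipschitzOnWith.of_dist_le_mul fun x hx y hy => ?_
      rw [Real.coe_toNNReal _ (by positivity)]
      have main : ∀ x ∈ Icc a b, ∀ y ∈ Icc a b, x ≤ y → ‖J y - J x‖ ≤ K * (y - x) := by
        intro x hx y hy hxy
        refine (hincr x y hx.1 hxy hy.2).trans ?_
        rw [hK]
        have : 0 ≤ y - x := by linarith
        have h1 : μ.variation.real (Ioc x y) ≤ μ.variation.real univ :=
          measureReal_mono (subset_univ _)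
        exact mul_le_mul_of_nonneg_right (mul_le_mul_of_nonneg_left h1 (by positivity)) this
      rcases le_total x y with h | h
      · rw [dist_comm, dist_eq_norm, dist_comm, Real.dist_eq, abs_of_nonneg (by linarith)]
        exact main x hx y hy h
      · rw [dist_eq_norm, Real.dist_eq, abs_of_nonneg (by linarith)]
        exact main y hy x hx h
    exact hlip.continuousOn
  have hJd : ∀ x ∈ Ico a b, HasDerivWithinAt J 0 (Ici x) x := by
    intro x hx
    rw [hasDerivWithinAt_iff_isLittleO, Asymptotics.isLittleO_iff]
    intro τ hτ
    have h1 : Tendsto (fun y => 2 * C * μ.variation.real (Ioc x y)) (𝓝[>] x) (𝓝 0) := by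
      simpa using (tendsto_measureReal_Ioc μ.variation x).const_mul (2 * C)
    obtain ⟨x₁, hx₁, hsub⟩ := mem_nhdsGT_iff_exists_Ioo_subset.1
      (h1.eventually (gt_mem_nhds hτ))
    filter_upwards [Ico_mem_nhdsGE (lt_min hx₁ hx.2)] with y hy
    rcases hy.1.eq_or_lt with rfl | hxy
    · simp
    have h2 := hsub (show y ∈ Ioo x x₁ from ⟨hxy, hy.2.trans_le (min_le_left _ _)⟩)
    have h3 := hincr x y hx.1 hxy.le (hy.2.trans_le (min_le_right _ _)).le
    rw [smul_zero, sub_zero, Real.norm_of_nonneg (by linarith)]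
    refine h3.trans ?_
    gcongr
    exact le_of_lt h2
  have hfinal := constant_of_has_deriv_right_zero hJc hJd b (right_mem_Icc.2 hab)
  simp only [hJ, Ioc_self, VectorMeasure.empty, intervalIntegral.integral_same,
    VectorMeasure.restrict_empty, VectorMeasure.integral_zero_vectorMeasure] at hfinal
  linear_combination hfinal

end

/-! ### From the increments of the jump to the jump itself. -/

section

open Complex (I)
open scoped ComplexConjugate

/-- The shifted interval `[x₀ + δ, y₀ + δ]` has fixed length, so with `x = x₀ + δ` the inner limit
is a function of `x` and the outer limit `δ ↓ 0` is its limit from the right at `x₀`. -/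
lemma hasDerivWithinAt_boundaryJump_of_hasIteratedLimit {p q M : ℂ → ℂ} {a b Y x₀ y₀ : ℝ} {l : ℂ}
    (hY : 0 < Y) (hp : IsSecondPrimitive p M a b Y) (hq : IsSecondPrimitive q (reflect M) a b Y)
    (hM : ContinuousOn M (Ioo a b ×ℂ Ioo 0 Y))
    (hM' : ContinuousOn (reflect M) (Ioo a b ×ℂ Ioo 0 Y))
    (hxy : x₀ < y₀) (ha : a ≤ x₀) (hb : y₀ < b)
    (h : HasIteratedLimit (fun δ ε => 1 / (2 * Real.pi * I) * ∫ t in (x₀ + δ)..(y₀ + δ),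
      (M (t + ε * I) - M (t - ε * I))) l) :
    HasDerivWithinAt (fun x => boundaryJump p q (x + (y₀ - x₀)) - boundaryJump p q x)
      (2 * Real.pi * I * l) (Ici x₀) x₀ := by
  obtain ⟨G, hG, hl⟩ := h
  have hshift : Tendsto (fun x : ℝ => x - x₀) (𝓝[>] x₀) (𝓝[>] 0) := by
    refine tendsto_nhdsWithin_iff.2 ⟨?_, ?_⟩
    · refine Tendsto.mono_left ?_ nhdsWithin_le_nhds
      have : ContinuousAt (fun x : ℝ => x - x₀) x₀ := by fun_prop
      simpa [ContinuousAt] using this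
    · filter_upwards [self_mem_nhdsWithin] with x hx
      exact sub_pos.2 (mem_Ioi.1 hx)
  have hpi : (2 * Real.pi * I : ℂ) ≠ 0 := by simp [Real.pi_ne_zero]
  refine hasDerivWithinAt_boundaryJump (G := fun x => 2 * Real.pi * I * G (x - x₀)) hY hp hq hM hM'
    (sub_pos.2 hxy) ha (by linarith) ?_ ((hl.comp hshift).const_mul _)
  filter_upwards [hshift.eventually hG] with x hx
  refine (hx.const_mul (2 * Real.pi * I)).congr fun ε => ?_
  rw [show x₀ + (x - x₀) = x by ring, show y₀ + (x - x₀) = x + (y₀ - x₀) by ring, ← mul_assoc,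
    mul_one_div_cancel hpi, one_mul]

/-- A continuous function on `[0, L]` that is additive there vanishes if it vanishes at `L`. -/
lemma eq_zero_of_additive_Icc {R : ℝ → ℂ} {L : ℝ} (hL : 0 ≤ L) (hc : ContinuousOn R (Icc 0 L))
    (hadd : ∀ s t, 0 ≤ s → 0 ≤ t → s + t ≤ L → R (s + t) = R s + R t) (hRL : R L = 0) :
    ∀ t ∈ Icc 0 L, R t = 0 := by
  obtain ⟨t₀, ht₀, hmax⟩ := isCompact_Icc.exists_isMaxOn (nonempty_Icc.2 hL) hc.norm
  have hmax' : ∀ t ∈ Icc 0 L, ‖R t‖ ≤ ‖R t₀‖ := fun t ht => hmax ht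
  have key : ∀ t ∈ Icc 0 L, t ≤ L / 2 → ‖R t‖ = ‖R t₀‖ → R t₀ = 0 := by
    intro t ht htL h
    have h1 := hadd t t ht.1 ht.1 (by linarith)
    have h2 := hmax' (t + t) ⟨by linarith [ht.1], by linarith⟩
    rw [h1, ← two_mul, norm_mul, h] at h2
    rw [← norm_eq_zero]
    norm_num at h2
    linarith [norm_nonneg (R t₀)]
  have h0 : R t₀ = 0 := by
    rcases le_total t₀ (L / 2) with h | h
    · exact key t₀ ht₀ h rfl
    · refine key (L - t₀) ⟨by linarith [ht₀.2], by linarith [ht₀.1]⟩ (by linarith) ?_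
      have h1 := hadd (L - t₀) t₀ (by linarith [ht₀.2]) ht₀.1 (by linarith)
      rw [sub_add_cancel, hRL] at h1
      rw [eq_neg_of_add_eq_zero_left h1.symm, norm_neg]
  intro t ht
  have := hmax' t ht
  rw [h0, norm_zero] at this
  exact norm_le_zero_iff.1 this

/-- If all differences `P (x + d) - P x` have the right derivative `G (x + d) - G x`, then `P` has
the right derivative `G` up to a constant. -/
lemma exists_hasDerivWithinAt_of_differences {P G : ℝ → ℂ} {a b : ℝ} (hab : a < b)
    (hP : ContinuousOn P (Icc a b)) (hGi : ∀ x y, IntervalIntegrable G volume x y)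
    (hGm : StronglyMeasurable G) (hGc : ∀ x ∈ Ico a b, ContinuousWithinAt G (Ici x) x)
    (hd : ∀ x y, a ≤ x → x < y → y ≤ b →
      HasDerivWithinAt (fun t => P (t + (y - x)) - P t) (G y - G x) (Ici x) x) :
    ∃ β, ∀ x ∈ Icc a b, HasDerivWithinAt P (G x + β) (Ici x) x := by
  have hPhi : ∀ x ∈ Ico a b, HasDerivWithinAt (fun x => ∫ t in a..x, G t) (G x) (Ici x) x :=
    fun x hx => intervalIntegral.integral_hasDerivWithinAt_right (hGi _ _)
      (hGm.stronglyMeasurableAtFilter) ((hGc x hx).mono Ioi_subset_Ici_self)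
  have hPhic : Continuous fun x => ∫ t in a..x, G t :=
    intervalIntegral.continuous_primitive hGi a
  -- All increments of `ψ` by a fixed `d` have right derivative zero, hence do not depend on the
  -- base point. So `t ↦ ψ(a + t) - ψ(a)` is additive and continuous, that is, linear; its slope is
  -- `β`.
  set ψ : ℝ → ℂ := fun x => P x - ∫ t in a..x, G t with hψ
  have hψc : ContinuousOn ψ (Icc a b) := hP.sub hPhic.continuousOn
  have hconst : ∀ d, 0 < d → ∀ x ∈ Icc a (b - d), ψ (x + d) - ψ x = ψ (a + d) - ψ a := by
    intro d hd0
    refine constant_of_has_deriv_right_zero (f := fun x => ψ (x + d) - ψ x) ?_ ?_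
    · refine ContinuousOn.sub (hψc.comp (by fun_prop) fun x hx => ?_)
        (hψc.mono (Icc_subset_Icc_right (by linarith)))
      exact ⟨by linarith [hx.1], by linarith [hx.2]⟩
    · intro x hx
      have hxd : x + d ∈ Ico a b := ⟨by linarith [hx.1], by linarith [hx.2]⟩
      have h1 := hd x (x + d) hx.1 (by linarith) hxd.2.le
      have h2 := hPhi x ⟨hx.1, by linarith [hx.2]⟩
      have h3 : HasDerivWithinAt (fun x => ∫ t in a..x + d, G t) (G (x + d)) (Ici x) x := by
        have h4 : HasDerivWithinAt (fun x => x + d) 1 (Ici x) x :=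
          ((hasDerivAt_id x).add_const d).hasDerivWithinAt
        have := (hPhi _ hxd).scomp x h4 (fun y hy => by simpa using! hy)
        simpa using! this
      have h5 := h1.sub (h3.sub h2)
      rw [sub_self] at h5
      refine h5.congr_of_mem (fun y _ => ?_) self_mem_Ici
      simp only [hψ, Pi.sub_apply, add_sub_cancel_left]
      ring
  set L := b - a with hL
  have hL0 : 0 < L := sub_pos.2 hab
  -- Subtracting the chord makes `R` vanish at `L`, as `eq_zero_of_additive_Icc` requires.
  set R : ℝ → ℂ := fun t => ψ (a + t) - ψ a - (t / L : ℝ) * (ψ b - ψ a) with hR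
  have hR0 := eq_zero_of_additive_Icc (R := R) hL0.le (by
      refine ContinuousOn.sub (ContinuousOn.sub (hψc.comp (by fun_prop) fun t ht => ?_)
        continuousOn_const) (by fun_prop)
      exact ⟨by linarith [ht.1], by linarith [ht.2]⟩) (by
      intro s t hs ht hst
      rcases ht.eq_or_lt with rfl | ht
      · simp [hR]
      have := hconst t ht (a + s) ⟨by linarith, by linarith⟩
      simp only [hR]
      rw [← add_assoc, eq_add_of_sub_eq this]
      push_cast
      ring) (by
      simp only [hR]
      rw [div_self hL0.ne']
      simp [hL])
  set β : ℂ := (ψ b - ψ a) / L with hβ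
  have hform : ∀ x ∈ Icc a b, P x = (∫ t in a..x, G t) + (ψ a + (x - a) * β) := by
    intro x hx
    have h1 := hR0 (x - a) ⟨by linarith [hx.1], by linarith [hx.2]⟩
    simp only [hR, add_sub_cancel] at h1
    rw [show P x = ψ x + ∫ t in a..x, G t by simp [hψ], hβ]
    push_cast at h1
    linear_combination h1
  have hIco : ∀ x ∈ Ico a b, HasDerivWithinAt P (G x + β) (Ici x) x := by
    intro x hx
    have h1 : HasDerivWithinAt (fun x : ℝ => ψ a + ((x : ℂ) - a) * β) β (Ici x) x := by
      have h2 : HasDerivAt (fun x : ℝ => (x : ℂ)) 1 x := Complex.ofRealCLM.hasDerivAt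
      simpa using (((h2.sub_const (a : ℂ)).mul_const β).const_add (ψ a)).hasDerivWithinAt
    refine ((hPhi x hx).add h1).congr_of_eventuallyEq ?_ (hform x ⟨hx.1, hx.2.le⟩)
    filter_upwards [Ico_mem_nhdsGE hx.2] with y hy
    exact hform y ⟨hx.1.trans hy.1, hy.2.le⟩
  refine ⟨β, fun x hx => ?_⟩
  rcases hx.2.eq_or_lt with rfl | hxb
  -- To the right of `b` the representation of `P` is not available; the derivative there comes from
  -- the increment over all of `[a, b]` together with the derivative at `a`.
  · have h1 := (hd a x le_rfl hab le_rfl).add (hIco a ⟨le_rfl, hab⟩)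
    have h2 : HasDerivWithinAt (fun t => t - (x - a)) 1 (Ici x) x :=
      ((hasDerivAt_id x).sub_const _).hasDerivWithinAt
    have hxa : x - (x - a) = a := by ring
    have h3 := HasDerivWithinAt.scomp (t' := Ici a) (h := fun t => t - (x - a)) x
      (by rw [hxa]; exact h1) h2 (fun y hy => by
        simp only [mem_Ici] at hy ⊢
        linarith)
    refine (h3.congr_deriv (by simp; ring)).congr_of_mem (fun y _ => ?_) self_mem_Ici
    simp
  · exact hIco x ⟨hx.1, hxb⟩

end

/-! ### Stieltjes inversion with holomorphic weights. -/

section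

open Complex (I)
open scoped ComplexConjugate

variable {ι : Type*} [Fintype ι]

/-- Second primitive of `∑ h M + e` in terms of the second primitives `p` of the `M`, up to the
boundary. -/
lemma exists_secondPrimitive_sum {a b Y : ℝ} (hab : a < b) (hY : 0 < Y)
    {M p h h' h'' : ι → ℂ → ℂ} {r s e : ℂ → ℂ}
    (hp : ∀ i, IsSecondPrimitive (p i) (M i) a b Y) (hs : IsSecondPrimitive s r a b Y)
    (hh : ∀ i z, HasDerivAt (h i) (h' i z) z) (hh' : ∀ i z, HasDerivAt (h' i) (h'' i z) z)
    (hh'' : ∀ i z, DifferentiableAt ℂ (h'' i) z)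
    (he : ContinuousOn e (Icc a b ×ℂ Icc 0 Y)) (hed : DifferentiableOn ℂ e (Ioo a b ×ℂ Ioo 0 Y))
    (hr : ∀ z ∈ Ioo a b ×ℂ Ioo 0 Y, r z = ∑ i, h i z * M i z + e z) :
    ∃ A B₁ B₂ : ℂ → ℂ, ∃ α β : ℂ,
      (∀ z ∈ Icc a b ×ℂ Icc 0 Y,
        HasDerivWithinAt A (∑ i, h' i z * p i z) (Icc a b ×ℂ Icc 0 Y) z) ∧
      (∀ z ∈ Icc a b ×ℂ Icc 0 Y,
        HasDerivWithinAt B₁ (e z + ∑ i, h'' i z * p i z) (Icc a b ×ℂ Icc 0 Y) z) ∧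
      (∀ z ∈ Icc a b ×ℂ Icc 0 Y, HasDerivWithinAt B₂ (B₁ z) (Icc a b ×ℂ Icc 0 Y) z) ∧
      ∀ z ∈ Icc a b ×ℂ Icc 0 Y, s z = ∑ i, h i z * p i z - 2 * A z + B₂ z + α + β * z := by
  have hop := isOpen_box a b 0 Y
  have hnh : ∀ z ∈ Ioo a b ×ℂ Ioo 0 Y, Icc a b ×ℂ Icc 0 Y ∈ 𝓝 z := fun z hz =>
    mem_of_superset (hop.mem_nhds hz) (box_subset a b 0 Y)
  choose hpc m hm hmM using hp
  obtain ⟨hsc, n, hn, hnr⟩ := hs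
  have hhc : ∀ i, ContinuousOn (h i) (Icc a b ×ℂ Icc 0 Y) := fun i =>
    (continuous_iff_continuousAt.2 fun z => (hh i z).continuousAt).continuousOn
  have hhc' : ∀ i, ContinuousOn (h' i) (Icc a b ×ℂ Icc 0 Y) := fun i =>
    (continuous_iff_continuousAt.2 fun z => (hh' i z).continuousAt).continuousOn
  have hhc'' : ∀ i, ContinuousOn (h'' i) (Icc a b ×ℂ Icc 0 Y) := fun i =>
    (continuous_iff_continuousAt.2 fun z => (hh'' i z).continuousAt).continuousOn
  have hpd : ∀ i, DifferentiableOn ℂ (p i) (Ioo a b ×ℂ Ioo 0 Y) := fun i z hz =>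
    (hm i z hz).differentiableAt.differentiableWithinAt
  obtain ⟨A, hA⟩ := exists_primitive_box (g := fun z => ∑ i, h' i z * p i z) hab hY
    (continuousOn_finsetSum _ fun i _ => (hhc' i).mul (hpc i))
    (DifferentiableOn.fun_sum fun i _ => DifferentiableOn.mul
      (fun z _ => (hh' i z).differentiableAt.differentiableWithinAt) (hpd i))
  obtain ⟨B₁, hB₁⟩ := exists_primitive_box (g := fun z => e z + ∑ i, h'' i z * p i z) hab hY
    (he.add (continuousOn_finsetSum _ fun i _ => (hhc'' i).mul (hpc i)))
    (hed.add (DifferentiableOn.fun_sum fun i _ => DifferentiableOn.mul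
      (fun z _ => (hh'' i z).differentiableWithinAt) (hpd i)))
  obtain ⟨B₂, hB₂⟩ := exists_primitive_box (g := B₁) hab hY
    (fun z hz => (hB₁ z hz).continuousWithinAt)
    (fun z hz => ((hB₁ z (box_subset _ _ _ _ hz)).differentiableWithinAt.mono (box_subset _ _ _ _)))
  have hA' := fun z hz => (hA z (box_subset a b 0 Y hz)).hasDerivAt (hnh z hz)
  have hB₁' := fun z hz => (hB₁ z (box_subset a b 0 Y hz)).hasDerivAt (hnh z hz)
  have hB₂' := fun z hz => (hB₂ z (box_subset a b 0 Y hz)).hasDerivAt (hnh z hz)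
  -- By `h M = (h p)'' - 2 (h' p)' + h'' p`, the function `∑ h p - 2A + B₂` is a second primitive of
  -- `∑ h M + e`. Its difference `D` from `s` therefore has vanishing second derivative and is
  -- affine, first inside the box and then, by continuity, on the closed box.
  set D₁ : ℂ → ℂ := fun z => n z - (∑ i, h i z * m i z - ∑ i, h' i z * p i z + B₁ z) with hD₁
  set D : ℂ → ℂ := fun z => s z - (∑ i, h i z * p i z - 2 * A z + B₂ z) with hD
  have hDd : ∀ z ∈ Ioo a b ×ℂ Ioo 0 Y, HasDerivAt D (D₁ z) z := by
    intro z hz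
    refine ((hn z hz).sub (((HasDerivAt.fun_sum fun i _ => (hh i z).mul (hm i z hz)).sub
      ((hA' z hz).const_mul 2)).add (hB₂' z hz))).congr_deriv ?_
    simp only [hD₁, Finset.sum_add_distrib]
    ring
  have hD₁d : ∀ z ∈ Ioo a b ×ℂ Ioo 0 Y, HasDerivAt D₁ 0 z := by
    intro z hz
    refine ((hnr z hz).sub (((HasDerivAt.fun_sum fun i _ => (hh i z).mul (hmM i z hz)).sub
      (HasDerivAt.fun_sum fun i _ => (hh' i z).mul (hm i z hz))).add (hB₁' z hz))).congr_deriv ?_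
    simp only [hr z hz, Finset.sum_add_distrib]
    ring
  set z₀ : ℂ := ((a + b) / 2 : ℝ) + (Y / 2 : ℝ) * I with hz₀
  have hz₀m : z₀ ∈ Ioo a b ×ℂ Ioo 0 Y :=
    mk_mem_box ⟨by linarith, by linarith⟩ ⟨by linarith, by linarith⟩
  have hpre := (convex_box a b 0 Y).isPreconnected
  have hc₁ : ∀ z ∈ Ioo a b ×ℂ Ioo 0 Y, D₁ z = D₁ z₀ := fun z hz =>
    hop.is_const_of_deriv_eq_zero hpre
      (fun w hw => (hD₁d w hw).differentiableAt.differentiableWithinAt)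
      (fun w hw => (hD₁d w hw).deriv) hz hz₀m
  have hD₂ : ∀ z ∈ Ioo a b ×ℂ Ioo 0 Y, HasDerivAt (fun z => D z - D₁ z₀ * z) 0 z := fun z hz => by
    refine ((hDd z hz).sub ((hasDerivAt_id z).const_mul (D₁ z₀))).congr_deriv ?_
    rw [hc₁ z hz]
    ring
  have hc₂ : EqOn (fun z => D z - D₁ z₀ * z) (fun _ => D z₀ - D₁ z₀ * z₀)
      (Ioo a b ×ℂ Ioo 0 Y) := fun z hz =>
    hop.is_const_of_deriv_eq_zero hpre
      (fun w hw => (hD₂ w hw).differentiableAt.differentiableWithinAt)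
      (fun w hw => (hD₂ w hw).deriv) hz hz₀m
  have hDc : ContinuousOn (fun z => D z - D₁ z₀ * z) (Icc a b ×ℂ Icc 0 Y) := by
    refine ContinuousOn.sub (hsc.sub (ContinuousOn.add (ContinuousOn.sub
      (continuousOn_finsetSum _ fun i _ => (hhc i).mul (hpc i))
      (continuousOn_const.mul fun z hz => (hA z hz).continuousWithinAt))
      fun z hz => (hB₂ z hz).continuousWithinAt)) (by fun_prop)
  have hc₃ := hc₂.of_subset_closure hDc continuousOn_const (box_subset a b 0 Y)
    (closure_box hab hY).ge
  refine ⟨A, B₁, B₂, D z₀ - D₁ z₀ * z₀, D₁ z₀, hA, hB₁, hB₂, fun z hz => ?_⟩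
  have := hc₃ hz
  simp only [hD] at this ⊢
  linear_combination this

lemma conj_reflect (f : ℂ → ℂ) (x : ℝ) : conj (reflect f x) = f x := by
  simp [reflect]

lemma hasDerivAt_reflect {f f' : ℂ → ℂ} (h : ∀ z, HasDerivAt f (f' z) z) (z : ℂ) :
    HasDerivAt (reflect f) (reflect f' z) z := by
  simpa [reflect, Function.comp_def] using! (h (conj z)).conj_conj

lemma hasDerivWithinAt_conj_ofReal {k : ℂ → ℂ} {k' : ℂ} {s : Set ℝ} {x : ℝ}
    (h : HasDerivWithinAt (fun x : ℝ => k x) k' s x) :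
    HasDerivWithinAt (fun x : ℝ => conj (k x)) (conj k') s x := by
  simpa using! h.star

/-- A Stieltjes inversion formula for a function `∑ h M + e`, where the jumps of the functions `M`
across the real axis are complex measures. -/
theorem eq_sum_integral_of_hasIteratedLimit [Nonempty ι] {l₁ l₂ b Y C : ℝ} (hl : l₁ < l₂)
    (hb : l₂ < b)
    (hY : 0 < Y) {M h h' h'' : ι → ℂ → ℂ} {r e : ℂ → ℂ}
    (hM : ∀ i, DifferentiableOn ℂ (M i) (Ioo l₁ b ×ℂ Ioo 0 Y))
    (hM' : ∀ i, DifferentiableOn ℂ (reflect (M i)) (Ioo l₁ b ×ℂ Ioo 0 Y))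
    (hMC : ∀ i, ∀ z ∈ Ioo l₁ b ×ℂ Ioo 0 Y, ‖M i z‖ ≤ C / z.im)
    (hMC' : ∀ i, ∀ z ∈ Ioo l₁ b ×ℂ Ioo 0 Y, ‖reflect (M i) z‖ ≤ C / z.im)
    (hh : ∀ i z, HasDerivAt (h i) (h' i z) z) (hh' : ∀ i z, HasDerivAt (h' i) (h'' i z) z)
    (hh'' : ∀ i z, DifferentiableAt ℂ (h'' i) z) (he : Continuous e)
    (hrd : DifferentiableOn ℂ r (Ioo l₁ b ×ℂ Ioo 0 Y))
    (hrd' : DifferentiableOn ℂ (reflect r) (Ioo l₁ b ×ℂ Ioo 0 Y))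
    (hr : ∀ z ∈ Ioo l₁ b ×ℂ Ioo 0 Y, r z = ∑ i, h i z * M i z + e z)
    (hr' : ∀ z ∈ Ioo l₁ b ×ℂ Ioo 0 Y, r (conj z) = ∑ i, h i (conj z) * M i (conj z) + e (conj z))
    {Ω : ι → ComplexMeasure ℝ}
    (hΩ : ∀ i x y, l₁ ≤ x → x < y → y ≤ l₂ → HasIteratedLimit
      (fun δ ε => 1 / (2 * Real.pi * I) * ∫ t in (x + δ)..(y + δ),
        (M i (t + ε * I) - M i (t - ε * I))) (Ω i (Ioc x y)))
    {R : ℂ} (hR : HasIteratedLimit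
      (fun δ ε => 1 / (2 * Real.pi * I) * ∫ t in (l₁ + δ)..(l₂ + δ),
        (r (t + ε * I) - r (t - ε * I))) R) :
    R = ∑ i, ∫ᵛ t in Ioc l₁ l₂, h i t ∂[ContinuousLinearMap.mul ℝ ℂ; Ω i] := by
  have hlb : l₁ < b := hl.trans hb
  have hrr : ∀ z ∈ Ioo l₁ b ×ℂ Ioo 0 Y,
      reflect r z = ∑ i, reflect (h i) z * reflect (M i) z + reflect e z := fun z hz => by
    simp [reflect, hr' z hz]
  have hec' : Continuous (reflect e) :=
    Complex.continuous_conj.comp (he.comp Complex.continuous_conj)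
  -- The function `r` inherits the growth `O(1 / Im z)` from the `M i`, and so has second primitives
  -- of its own; likewise for its reflection.
  have hbound : ∀ (k : ι → ℂ → ℂ) (N : ι → ℂ → ℂ) (e' ρ : ℂ → ℂ), (∀ i, Continuous (k i)) →
      Continuous e' → (∀ i, ∀ z ∈ Ioo l₁ b ×ℂ Ioo 0 Y, ‖N i z‖ ≤ C / z.im) →
      (∀ z ∈ Ioo l₁ b ×ℂ Ioo 0 Y, ρ z = ∑ i, k i z * N i z + e' z) →
      ∃ C', ∀ z ∈ Ioo l₁ b ×ℂ Ioo 0 Y, ‖ρ z‖ ≤ C' / z.im := by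
    intro k N e' ρ hk he' hN hρ
    have hcomp := isCompact_box l₁ b 0 Y
    obtain ⟨K, hK⟩ := hcomp.exists_bound_of_continuousOn (f := fun z => ∑ i, ‖k i z‖)
      (by fun_prop)
    obtain ⟨K', hK'⟩ := hcomp.exists_bound_of_continuousOn (f := e') he'.continuousOn
    refine ⟨K * C + K' * Y, fun z hz => ?_⟩
    have hz' := box_subset _ _ _ _ hz
    have him : 0 < z.im := hz.2.1
    have h1 := hK z hz'
    have h2 := hK' z hz'
    rw [hρ z hz, add_div]
    refine (norm_add_le _ _).trans (add_le_add ?_ ?_)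
    · have hC : 0 ≤ C / z.im := (norm_nonneg _).trans (hN (Classical.arbitrary ι) z hz)
      rw [Real.norm_of_nonneg (Finset.sum_nonneg fun i _ => norm_nonneg _)] at h1
      calc ‖∑ i, k i z * N i z‖ ≤ ∑ i, ‖k i z‖ * (C / z.im) := by
            refine (norm_sum_le _ _).trans (Finset.sum_le_sum fun i _ => ?_)
            rw [norm_mul]
            exact mul_le_mul_of_nonneg_left (hN i z hz) (norm_nonneg _)
        _ = (∑ i, ‖k i z‖) * (C / z.im) := by rw [Finset.sum_mul]
        _ ≤ K * (C / z.im) := mul_le_mul_of_nonneg_right h1 hC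
        _ = K * C / z.im := by ring
    · rw [le_div_iff₀ him]
      exact mul_le_mul h2 hz.2.2.le him.le ((norm_nonneg _).trans h2)
  have hhc : ∀ i, Continuous (h i) := fun i =>
    continuous_iff_continuousAt.2 fun z => (hh i z).continuousAt
  have hhc' : ∀ i, Continuous (reflect (h i)) := fun i =>
    continuous_iff_continuousAt.2 fun z => (hasDerivAt_reflect (hh i) z).continuousAt
  obtain ⟨C₁, hC₁⟩ := hbound h M e r hhc he hMC hr
  obtain ⟨C₂, hC₂⟩ := hbound (fun i => reflect (h i)) (fun i => reflect (M i)) (reflect e)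
    (reflect r) hhc' hec' hMC' hrr
  choose p hp using fun i => exists_isSecondPrimitive hlb hY (hM i) (hMC i)
  choose p' hp' using fun i => exists_isSecondPrimitive hlb hY (hM' i) (hMC' i)
  obtain ⟨s, hs⟩ := exists_isSecondPrimitive hlb hY hrd hC₁
  obtain ⟨s', hs'⟩ := exists_isSecondPrimitive hlb hY hrd' hC₂
  -- Holomorphy of `e` off the axis is forced by the formula for `r`, so only its continuity has to
  -- be assumed.
  have hed : DifferentiableOn ℂ e (Ioo l₁ b ×ℂ Ioo 0 Y) := by
    refine (hrd.sub (DifferentiableOn.fun_sum (u := Finset.univ) fun i _ => DifferentiableOn.mul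
      (fun z _ => (hh i z).differentiableAt.differentiableWithinAt) (hM i))).congr fun z hz => ?_
    simp [hr z hz]
  have hed' : DifferentiableOn ℂ (reflect e) (Ioo l₁ b ×ℂ Ioo 0 Y) := by
    refine (hrd'.sub (DifferentiableOn.fun_sum (u := Finset.univ) fun i _ => DifferentiableOn.mul
      (fun z _ => (hasDerivAt_reflect (hh i) z).differentiableAt.differentiableWithinAt)
        (hM' i))).congr fun z hz => ?_
    simp [hrr z hz]
  have hh''' : ∀ i z, DifferentiableAt ℂ (reflect (h'' i)) z := fun i z =>
    (hasDerivAt_reflect (fun w => (hh'' i w).hasDerivAt) z).differentiableAt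
  obtain ⟨A, B₁, B₂, α, β, hA, hB₁, hB₂, hform⟩ := exists_secondPrimitive_sum hlb hY hp hs hh hh'
    hh'' he.continuousOn hed hr
  obtain ⟨A', B₁', B₂', α', β', hA', hB₁', hB₂', hform'⟩ := exists_secondPrimitive_sum hlb hY hp'
    hs' (fun i => hasDerivAt_reflect (hh i)) (fun i => hasDerivAt_reflect (hh' i)) hh'''
    hec'.continuousOn hed' hrr
  set P : ι → ℝ → ℂ := fun i => boundaryJump (p i) (p' i) with hP
  have hA₀ : ∀ x ∈ Icc l₁ b, HasDerivWithinAt (boundaryJump A A')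
      (∑ i, h' i x * P i x) (Icc l₁ b) x := by
    intro x hx
    have h1 := hasDerivWithinAt_ofReal_box hY.le (hA x (ofReal_mem_box hY.le hx))
    have h2 := hasDerivWithinAt_conj_ofReal
      (hasDerivWithinAt_ofReal_box hY.le (hA' x (ofReal_mem_box hY.le hx)))
    refine (h1.sub h2).congr_deriv ?_
    simp [hP, boundaryJump, conj_reflect, mul_sub]
  -- Here `e` drops out: it takes the same value on the axis from both sides.
  have hB₁₀ : ∀ x ∈ Icc l₁ b, HasDerivWithinAt (boundaryJump B₁ B₁')
      (∑ i, h'' i x * P i x) (Icc l₁ b) x := by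
    intro x hx
    have h1 := hasDerivWithinAt_ofReal_box hY.le (hB₁ x (ofReal_mem_box hY.le hx))
    have h2 := hasDerivWithinAt_conj_ofReal
      (hasDerivWithinAt_ofReal_box hY.le (hB₁' x (ofReal_mem_box hY.le hx)))
    refine (h1.sub h2).congr_deriv ?_
    simp [hP, boundaryJump, conj_reflect, mul_sub]
  have hB₂₀ : ∀ x ∈ Icc l₁ b, HasDerivWithinAt (boundaryJump B₂ B₂')
      (boundaryJump B₁ B₁' x) (Icc l₁ b) x := by
    intro x hx
    have h1 := hasDerivWithinAt_ofReal_box hY.le (hB₂ x (ofReal_mem_box hY.le hx))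
    have h2 := hasDerivWithinAt_conj_ofReal
      (hasDerivWithinAt_ofReal_box hY.le (hB₂' x (ofReal_mem_box hY.le hx)))
    exact h1.sub h2
  have hS : ∀ x ∈ Icc l₁ b, boundaryJump s s' x = ∑ i, h i x * P i x - 2 * boundaryJump A A' x +
      boundaryJump B₂ B₂' x + (α - conj α') + (β - conj β') * x := by
    intro x hx
    have h1 := hform x (ofReal_mem_box hY.le hx)
    have h2 := hform' x (ofReal_mem_box hY.le hx)
    simp only [boundaryJump, h1, h2, hP, mul_sub, Finset.sum_sub_distrib, map_add, map_sub, map_mul,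
      map_sum, conj_reflect, Complex.conj_ofReal, map_ofNat]
    ring
  have hPc : ∀ i, ContinuousOn (P i) (Icc l₁ b) := fun i =>
    continuousOn_boundaryJump hY.le (hp i) (hp' i)
  set G : ι → ℝ → ℂ := fun i x => 2 * Real.pi * I * Ω i (Ioc l₁ x) with hG
  have hPd : ∀ i, ∃ γ, ∀ x ∈ Icc l₁ l₂, HasDerivWithinAt (P i) (G i x + γ) (Ici x) x := by
    intro i
    refine exists_hasDerivWithinAt_of_differences hl ((hPc i).mono (Icc_subset_Icc_right hb.le))
      (fun x y => intervalIntegrable_mul_measure_Ioc (Ω i)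
        (h := fun _ => 2 * Real.pi * I) continuous_const _ _ _)
      ((stronglyMeasurable_measure_Ioc (Ω i) l₁).const_mul _) ?_ ?_
    · intro x hx
      refine (continuousWithinAt_Ioi_iff_Ici.1 ?_)
      exact (tendsto_measure_Ioc_right (Ω i) hx.1).const_mul _
    · intro x y hx hxy hy
      refine (hasDerivWithinAt_boundaryJump_of_hasIteratedLimit hY (hp i) (hp' i)
        (hM i).continuousOn (hM' i).continuousOn hxy hx (hy.trans_lt hb)
        (hΩ i x y hx hxy hy)).congr_deriv ?_
      simp only [hG]
      rw [← mul_sub, measure_Ioc_sub (Ω i) l₁ hx hxy.le]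
  choose γ hγ using hPd
  have hnhds : ∀ x ∈ Icc l₁ l₂, Icc l₁ b ∈ 𝓝[≥] x := fun x hx =>
    mem_of_superset (Icc_mem_nhdsGE (hx.2.trans_lt hb)) (Icc_subset_Icc_left hx.1)
  have hIcc : ∀ x ∈ Icc l₁ l₂, x ∈ Icc l₁ b := fun x hx => ⟨hx.1, hx.2.trans hb.le⟩
  have hhr : ∀ i (x : ℝ) (s : Set ℝ), HasDerivWithinAt (fun x : ℝ => h i x) (h' i x) s x :=
    fun i x s => (hh i x).comp_ofReal.hasDerivWithinAt
  have hhr' : ∀ i (x : ℝ) (s : Set ℝ), HasDerivWithinAt (fun x : ℝ => h' i x) (h'' i x) s x :=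
    fun i x s => (hh' i x).comp_ofReal.hasDerivWithinAt
  -- Differentiating `∑ h P - 2 [A] + [B₂]`, with brackets denoting jumps, gives `∑ h G` plus `τ`
  -- plus a constant. In the derivative of `τ` the terms with `P` and with `γ` cancel, leaving `-∑
  -- h' G`: no derivative of `G` is ever needed.
  set τ : ℝ → ℂ := fun x =>
    boundaryJump B₁ B₁' x - ∑ i, h' i x * P i x + ∑ i, h i x * γ i with hτ
  have hτd : ∀ x ∈ Icc l₁ l₂, HasDerivWithinAt τ (-∑ i, h' i x * G i x) (Ici x) x := by
    intro x hx
    refine ((((hB₁₀ x (hIcc x hx)).mono_of_mem_nhdsWithin (hnhds x hx)).sub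
      (HasDerivWithinAt.fun_sum fun i _ => (hhr' i x _).mul (hγ i x hx))).add
      (HasDerivWithinAt.fun_sum fun i _ => (hhr i x _).mul_const (γ i))).congr_deriv ?_
    simp only [Finset.sum_add_distrib, mul_add]
    ring
  have hSd : ∀ x ∈ Icc l₁ l₂, HasDerivWithinAt (boundaryJump s s')
      (∑ i, h i x * G i x + τ x + (β - conj β')) (Ici x) x := by
    intro x hx
    have h0 : HasDerivWithinAt (fun x : ℝ => (x : ℂ)) 1 (Ici x) x :=
      Complex.ofRealCLM.hasDerivAt.hasDerivWithinAt
    have h1 := (((((HasDerivWithinAt.fun_sum (u := Finset.univ)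
      fun i _ => (hhr i x _).mul (hγ i x hx)).sub
      (((hA₀ x (hIcc x hx)).mono_of_mem_nhdsWithin (hnhds x hx)).const_mul 2)).add
      ((hB₂₀ x (hIcc x hx)).mono_of_mem_nhdsWithin (hnhds x hx))).add_const (α - conj α')).add
      (h0.const_mul (β - conj β')))
    refine (h1.congr_of_eventuallyEq ?_ (hS x (hIcc x hx))).congr_deriv ?_
    · filter_upwards [hnhds x hx] with y hy
      exact hS y hy
    · simp only [hτ, Finset.sum_add_distrib, mul_add]
      ring
  have hRd := hasDerivWithinAt_boundaryJump_of_hasIteratedLimit hY hs hs' hrd.continuousOn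
    hrd'.continuousOn hl le_rfl hb hR
  have hRd' : HasDerivWithinAt
      (fun x => boundaryJump s s' (x + (l₂ - l₁)) - boundaryJump s s' x)
      ((∑ i, h i l₂ * G i l₂ + τ l₂ + (β - conj β')) -
        (∑ i, h i l₁ * G i l₁ + τ l₁ + (β - conj β'))) (Ici l₁) l₁ := by
    refine HasDerivWithinAt.sub ?_ (hSd l₁ ⟨le_rfl, hl.le⟩)
    have h2 : HasDerivWithinAt (fun t => t + (l₂ - l₁)) 1 (Ici l₁) l₁ :=
      ((hasDerivAt_id l₁).add_const _).hasDerivWithinAt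
    have h3 := HasDerivWithinAt.scomp (t' := Ici l₂) (h := fun t => t + (l₂ - l₁)) l₁
      (by rw [add_sub_cancel]; exact hSd l₂ ⟨hl.le, le_rfl⟩) h2 (fun y hy => by
        simp only [mem_Ici] at hy ⊢
        linarith)
    simpa using! h3
  -- The same right derivative at `l₁`, obtained once from the limit defining `R` and once from the
  -- derivatives of the jump at `l₂` and `l₁`; the unknown constants cancel in the difference.
  have heq := (uniqueDiffWithinAt_Ici l₁).eq_deriv _ hRd hRd'
  have hint : ∀ i, IntervalIntegrable (fun x : ℝ => h' i x * G i x) volume l₁ l₂ := fun i => by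
    have h1 : Continuous fun x : ℝ => h' i x * (2 * Real.pi * I) := by
      refine Continuous.mul ?_ continuous_const
      exact (continuous_iff_continuousAt.2 fun z => (hh' i z).continuousAt).comp
        Complex.continuous_ofReal
    simpa only [hG, mul_assoc] using intervalIntegrable_mul_measure_Ioc (Ω i) h1 l₁ l₁ l₂
  have hτint : τ l₂ - τ l₁ = -∑ i, ∫ x in l₁..l₂, h' i x * G i x := by
    rw [← intervalIntegral.integral_finsetSum fun i _ => hint i, ← intervalIntegral.integral_neg]
    refine (intervalIntegral.integral_eq_sub_of_hasDeriv_right_of_le hl.le ?_ ?_ ?_).symm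
    · refine ContinuousOn.add (ContinuousOn.sub ?_ (continuousOn_finsetSum _ fun i _ =>
        ContinuousOn.mul ?_ ((hPc i).mono (Icc_subset_Icc_right hb.le)))) ?_
      · exact ContinuousOn.mono (fun x hx => (hB₁₀ x hx).continuousWithinAt)
          (Icc_subset_Icc_right hb.le)
      · exact fun x _ => (hhr' i x _).continuousWithinAt
      · exact continuousOn_finsetSum _ fun i _ => ContinuousOn.mul
          (fun x _ => (hhr i x _).continuousWithinAt) continuousOn_const
    · exact fun x hx => (hτd x ⟨hx.1.le, hx.2.le⟩).mono Ioi_subset_Ici_self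
    · refine (IntervalIntegrable.sum Finset.univ fun i _ => hint i).neg.congr fun x _ => ?_
      simp
  have hG₁ : ∀ i, G i l₁ = 0 := fun i => by simp [hG]
  have hGi : ∀ i, ∫ x in l₁..l₂, h' i x * G i x =
      2 * Real.pi * I * ∫ x in l₁..l₂, h' i x * Ω i (Ioc l₁ x) := fun i => by
    rw [← intervalIntegral.integral_const_mul]
    refine intervalIntegral.integral_congr fun x _ => ?_
    simp only [hG]
    ring
  have hpi : (2 * Real.pi * I : ℂ) ≠ 0 := by simp [Real.pi_ne_zero]
  apply mul_left_cancel₀ hpi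
  have hfin : ∀ i, ∫ᵛ t in Ioc l₁ l₂, h i t ∂[ContinuousLinearMap.mul ℝ ℂ; Ω i] =
      h i l₂ * Ω i (Ioc l₁ l₂) - ∫ x in l₁..l₂, h' i x * Ω i (Ioc l₁ x) := fun i =>
    integral_Ioc_complexMeasure (Ω i) (fun x => (hh i x).comp_ofReal)
      ((continuous_iff_continuousAt.2 fun z => (hh' i z).continuousAt).comp
        Complex.continuous_ofReal) hl.le
  rw [heq, Finset.mul_sum]
  simp only [hG₁, mul_zero, Finset.sum_const_zero, zero_add]
  rw [show ∑ i, h i l₂ * G i l₂ + τ l₂ + (β - conj β') - (τ l₁ + (β - conj β')) =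
    ∑ i, h i l₂ * G i l₂ + (τ l₂ - τ l₁) by ring, hτint, ← sub_eq_add_neg, ← Finset.sum_sub_distrib]
  refine Finset.sum_congr rfl fun i _ => ?_
  rw [hfin, hGi]
  simp only [hG]
  ring

end

/-! ### Vector-valued absolutely continuous functions. -/

section

section AbsolutelyContinuous

lemma intervalIntegrable_of_locallyIntegrable {E : Type*} [NormedAddCommGroup E] {f : ℝ → E}
    (hf : LocallyIntegrable f volume)
    (x y : ℝ) : IntervalIntegrable f volume x y :=
  (hf.integrableOn_isCompact isCompact_uIcc).intervalIntegrable

lemma locallyIntegrable_norm {E : Type*} [NormedAddCommGroup E] {f : ℝ → E}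
    (hf : LocallyIntegrable f volume) : LocallyIntegrable (fun x => ‖f x‖) volume :=
  fun x => (hf x).norm

lemma abs_integral_le_integral_symm {φ : ℝ → ℝ} (hφ : LocallyIntegrable φ volume) (h0 : 0 ≤ φ)
    {N x : ℝ} (hx : x ∈ Icc (-N) N) : |∫ t in (0 : ℝ)..x, φ t| ≤ ∫ t in (-N)..N, φ t := by
  have hN : 0 ≤ N := by linarith [hx.1, hx.2]
  refine (intervalIntegral.abs_integral_mono_interval (c := -N) (d := N) ?_
    (Eventually.of_forall h0) (intervalIntegrable_of_locallyIntegrable hφ _ _)).trans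
    (le_of_eq (abs_of_nonneg (intervalIntegral.integral_nonneg (by linarith) fun t _ => h0 t)))
  rw [uIoc_of_le (a := -N) (by linarith)]
  intro t ht
  rcases mem_uIoc.1 ht with h | h
  · exact ⟨by linarith [h.1], h.2.trans hx.2⟩
  · exact ⟨hx.1.trans_lt h.1, h.2.trans hN⟩

variable {E : Type*} [NormedAddCommGroup E] [NormedSpace ℝ E]

lemma absolutelyContinuousOnInterval_of_dist_le {X Y : Type*} [PseudoMetricSpace X]
    [PseudoMetricSpace Y] {f : ℝ → X} {g : ℝ → Y} {a b : ℝ}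
    (hg : AbsolutelyContinuousOnInterval g a b) (h : ∀ x y, dist (f x) (f y) ≤ dist (g x) (g y)) :
    AbsolutelyContinuousOnInterval f a b :=
  squeeze_zero (fun _ => Finset.sum_nonneg fun _ _ => dist_nonneg)
    (fun _ => Finset.sum_le_sum fun _ _ => h _ _) hg

/-- Increments are dominated by those of the primitive of `‖f‖`, which reduces the claim to the
scalar case. -/
lemma absolutelyContinuousOnInterval_integral {f : ℝ → E} (hf : LocallyIntegrable f volume)
    (c a b : ℝ) : AbsolutelyContinuousOnInterval (fun x => ∫ t in c..x, f t) a b := by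
  have hi := fun x y => intervalIntegrable_of_locallyIntegrable hf x y
  have hn := fun x y => intervalIntegrable_of_locallyIntegrable (locallyIntegrable_norm hf) x y
  have h1 : AbsolutelyContinuousOnInterval (fun x => ∫ t in c..x, ‖f t‖) a b := by
    have h2 : AbsolutelyContinuousOnInterval (fun x => ∫ t in c..x, ‖f t‖)
        (min (min a b) c) (max (max a b) c) :=
      (hn _ _).absolutelyContinuousOnInterval_intervalIntegral
        (by rw [uIcc_of_le (by simp)]; simp)
    refine h2.mono ?_
    rw [uIcc_of_le (a := min (min a b) c) (by simp)]
    exact Icc_subset_Icc (min_le_left _ _) (le_max_left _ _)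
  refine absolutelyContinuousOnInterval_of_dist_le h1 fun x y => ?_
  rw [dist_comm, dist_comm (∫ t in c..x, ‖f t‖), dist_eq_norm, dist_eq_norm,
    intervalIntegral.integral_interval_sub_left (hi _ _) (hi _ _),
    intervalIntegral.integral_interval_sub_left (hn _ _) (hn _ _), Real.norm_eq_abs]
  exact intervalIntegral.norm_integral_le_abs_integral_norm

lemma absolutelyContinuousOnInterval_const {X : Type*} [PseudoMetricSpace X] (v : X) (a b : ℝ) :
    AbsolutelyContinuousOnInterval (fun _ => v) a b :=
  (LipschitzWith.const v).lipschitzOnWith.absolutelyContinuousOnInterval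

variable [CompleteSpace E]

/-- The fundamental theorem of calculus for vector valued absolutely continuous functions. -/
lemma integral_eq_sub_of_absolutelyContinuous {f f' : ℝ → E}
    (hf : ∀ a b, AbsolutelyContinuousOnInterval f a b) (hf' : LocallyIntegrable f' volume)
    (hd : ∀ᵐ x, HasDerivAt f (f' x) x) (x y : ℝ) : ∫ t in x..y, f' t = f y - f x := by
  obtain ⟨C, hC⟩ := ((hf x y).sub (absolutelyContinuousOnInterval_integral hf' x x y)
    ).const_of_ae_hasDerivAt_zero (by
      filter_upwards [hd, _root_.LocallyIntegrable.ae_hasDerivAt_integral hf'] with t h1 h2 _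
      simpa using! h1.sub (h2 x))
  have h1 := hC x left_mem_uIcc
  have h2 := hC y right_mem_uIcc
  rw [← h1] at h2
  simp only [Pi.sub_apply, intervalIntegral.integral_same, sub_zero] at h2
  rw [← h2]
  abel

end AbsolutelyContinuous

/-- The chain rule for a power of a primitive, valid for a coefficient that is only locally
integrable because the power is absolutely continuous. It produces the factorials in the Volterra
estimate. -/
lemma integral_mul_pow_primitive {a : ℝ → ℝ} (ha : LocallyIntegrable a volume) (n : ℕ) (x : ℝ) :
    ∫ t in (0 : ℝ)..x, a t * (∫ s in (0 : ℝ)..t, a s) ^ n =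
      (∫ s in (0 : ℝ)..x, a s) ^ (n + 1) / (n + 1) := by
  set m : ℝ → ℝ := fun t => ∫ s in (0 : ℝ)..t, a s with hm
  have hmac : ∀ c d, AbsolutelyContinuousOnInterval m c d := fun c d =>
    absolutelyContinuousOnInterval_integral ha 0 c d
  have hpow : ∀ (k : ℕ) c d, AbsolutelyContinuousOnInterval (fun t => m t ^ k) c d := by
    intro k c d
    induction k with
    | zero => simpa using absolutelyContinuousOnInterval_const (1 : ℝ) c d
    | succ k ih => simpa only [pow_succ] using ih.fun_mul (hmac c d)
  have hmc : Continuous m := intervalIntegral.continuous_primitive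
    (intervalIntegrable_of_locallyIntegrable ha) 0
  have hli : LocallyIntegrable (fun t => (n + 1 : ℝ) * (a t * m t ^ n)) volume := by
    have h1 : LocallyIntegrable (fun t => (m t ^ n) • a t) volume := by
      rw [← locallyIntegrableOn_univ] at ha ⊢
      exact ha.continuousOn_smul isOpen_univ.isLocallyClosed (hmc.pow n).continuousOn
    refine (h1.smul (n + 1 : ℝ)).congr (Eventually.of_forall fun t => ?_)
    simp [mul_comm]
  have h := integral_eq_sub_of_absolutelyContinuous (hpow (n + 1)) hli (by
    filter_upwards [_root_.LocallyIntegrable.ae_hasDerivAt_integral ha] with t ht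
    refine ((ht 0).pow (n + 1)).congr_deriv ?_
    push_cast
    simp only [hm]
    ring) 0 x
  rw [intervalIntegral.integral_const_mul] at h
  have h0 : (n + 1 : ℝ) ≠ 0 := by positivity
  rw [eq_div_iff h0, mul_comm]
  refine h.trans ?_
  simp [hm]

/-! ### Volterra integral operators. -/

section Volterra

variable {E : Type*} [NormedAddCommGroup E] [NormedSpace ℂ E]

lemma locallyIntegrable_clm_apply {F : Type*} [NormedAddCommGroup F] [NormedSpace ℂ F]
    {A : ℝ → E →L[ℂ] F} {u : ℝ → E} (hA : LocallyIntegrable A volume)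
    (hu : Continuous u) : LocallyIntegrable (fun t => A t (u t)) volume := by
  rw [locallyIntegrable_iff] at hA ⊢
  intro k hk
  obtain ⟨C, hC⟩ := hk.exists_bound_of_continuousOn hu.continuousOn
  refine Integrable.mono' ((hA k hk).norm.mul_const C) ?_ ?_
  · exact (ContinuousLinearMap.id ℂ (E →L[ℂ] F)).aestronglyMeasurable_comp₂
      (hA k hk).aestronglyMeasurable hu.aestronglyMeasurable
  · filter_upwards [ae_restrict_mem hk.measurableSet] with t ht
    exact (A t).le_opNorm_of_le (hC t ht)

section

variable {E : Type*} [NormedAddCommGroup E]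

/-- The extension of a continuous function on `[-N, N]` to `ℝ`, constant on the complementary
half-lines. -/
def extendIcc {N : ℕ} (u : C(Icc (-(N : ℝ)) N, E)) : ℝ → E :=
  IccExtend (neg_le_self (N.cast_nonneg : (0 : ℝ) ≤ N)) u

lemma continuous_extendIcc {N : ℕ} (u : C(Icc (-(N : ℝ)) N, E)) : Continuous (extendIcc u) :=
  u.continuous.Icc_extend'

lemma extendIcc_of_mem {N : ℕ} (u : C(Icc (-(N : ℝ)) N, E)) {x : ℝ} (hx : x ∈ Icc (-(N : ℝ)) N) :
    extendIcc u x = u ⟨x, hx⟩ := IccExtend_of_mem _ _ hx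

end

open Classical in
/-- The Volterra operator `u ↦ ∫₀ˣ A u` on `C([-N, N], E)`. -/
def volterra (A : ℝ → E →L[ℂ] E) (N : ℕ) :
    C(Icc (-(N : ℝ)) N, E) →L[ℂ] C(Icc (-(N : ℝ)) N, E) :=
  if hA : LocallyIntegrable A volume then
    LinearMap.mkContinuous
      { toFun := fun u =>
          ⟨fun x => ∫ t in (0 : ℝ)..x, A t (extendIcc u t),
            (intervalIntegral.continuous_primitive (intervalIntegrable_of_locallyIntegrable
              (locallyIntegrable_clm_apply hA (continuous_extendIcc u))) 0).comp
                continuous_subtype_val⟩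
        map_add' := fun u v => by
          ext x
          simp only [ContinuousMap.coe_mk, ContinuousMap.add_apply]
          rw [← intervalIntegral.integral_add
            (intervalIntegrable_of_locallyIntegrable
              (locallyIntegrable_clm_apply hA (continuous_extendIcc u)) _ _)
            (intervalIntegrable_of_locallyIntegrable
              (locallyIntegrable_clm_apply hA (continuous_extendIcc v)) _ _)]
          simp [extendIcc, IccExtend]
        map_smul' := fun c u => by
          ext x
          simp only [ContinuousMap.coe_mk, ContinuousMap.smul_apply, RingHom.id_apply]
          rw [← intervalIntegral.integral_smul]
          simp [extendIcc, IccExtend] }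
      (∫ t in (-(N : ℝ))..N, ‖A t‖) fun u => by
        have hN : (0 : ℝ) ≤ N := N.cast_nonneg
        have hi := intervalIntegrable_of_locallyIntegrable (locallyIntegrable_norm hA)
        have h0 : 0 ≤ ∫ t in (-(N : ℝ))..N, ‖A t‖ :=
          intervalIntegral.integral_nonneg (by linarith) fun t _ => norm_nonneg _
        rw [ContinuousMap.norm_le _ (mul_nonneg h0 (norm_nonneg _))]
        intro x
        have hb : ∀ t, ‖A t (extendIcc u t)‖ ≤ ‖A t‖ * ‖u‖ :=
          fun t => (A t).le_opNorm_of_le (u.norm_coe_le_norm _)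
        calc ‖∫ t in (0 : ℝ)..x, A t (extendIcc u t)‖
            ≤ |∫ t in (0 : ℝ)..x, ‖A t‖ * ‖u‖| := by
              refine intervalIntegral.norm_integral_le_abs_of_norm_le (Eventually.of_forall
                fun t => hb t) ((hi _ _).mul_const _)
          _ = |∫ t in (0 : ℝ)..x, ‖A t‖| * ‖u‖ := by
              rw [intervalIntegral.integral_mul_const, abs_mul, abs_norm]
          _ ≤ (∫ t in (-(N : ℝ))..N, ‖A t‖) * ‖u‖ := by
              refine mul_le_mul_of_nonneg_right ?_ (norm_nonneg _)
              exact abs_integral_le_integral_symm (locallyIntegrable_norm hA)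
                (fun t => norm_nonneg _) x.2
  else 0

lemma volterra_apply {A : ℝ → E →L[ℂ] E} (hA : LocallyIntegrable A volume) (N : ℕ)
    (u : C(Icc (-(N : ℝ)) N, E)) (x : Icc (-(N : ℝ)) N) :
    volterra A N u x = ∫ t in (0 : ℝ)..x, A t (extendIcc u t) := by
  simp only [volterra, dif_pos hA]
  rfl

lemma norm_volterra_pow_apply_le {A : ℝ → E →L[ℂ] E} (hA : LocallyIntegrable A volume) (N n : ℕ)
    (u : C(Icc (-(N : ℝ)) N, E)) (x : Icc (-(N : ℝ)) N) :
    ‖(volterra A N ^ n) u x‖ ≤ |∫ t in (0 : ℝ)..x, ‖A t‖| ^ n / n.factorial * ‖u‖ := by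
  induction n generalizing x with
  | zero => simpa using u.norm_coe_le_norm x
  | succ n ih =>
    have hN : (0 : ℝ) ≤ N := N.cast_nonneg
    rw [pow_succ', mul_apply_eq_comp, volterra_apply hA]
    set m : ℝ → ℝ := fun t => ∫ s in (0 : ℝ)..t, ‖A s‖ with hm
    have hi := intervalIntegrable_of_locallyIntegrable (locallyIntegrable_norm hA)
    have hmc : Continuous m := intervalIntegral.continuous_primitive hi 0
    have hint : IntervalIntegrable (fun t => ‖A t‖ * m t ^ n) volume 0 x :=
      (hi _ _).mul_continuousOn (hmc.pow n).continuousOn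
    have hint' : IntervalIntegrable (fun t => ‖A t‖ * |m t| ^ n) volume 0 x :=
      (hi _ _).mul_continuousOn (hmc.abs.pow n).continuousOn
    have hb : ∀ᵐ t ∂volume.restrict (uIoc 0 (x : ℝ)),
        ‖A t (extendIcc ((volterra A N ^ n) u) t)‖ ≤
          (‖A t‖ * |m t| ^ n) * (‖u‖ / n.factorial) := by
      refine (ae_restrict_iff' measurableSet_uIoc).2 (Eventually.of_forall fun t ht => ?_)
      have ht' : t ∈ Icc (-(N : ℝ)) N := by
        have h1 := uIoc_subset_uIcc ht
        have h2 := x.2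
        rcases le_total 0 (x : ℝ) with h | h
        · rw [uIcc_of_le h] at h1
          exact ⟨by linarith [h1.1], h1.2.trans h2.2⟩
        · rw [uIcc_of_ge h] at h1
          exact ⟨h2.1.trans h1.1, h1.2.trans hN⟩
      rw [extendIcc_of_mem _ ht']
      refine ((A t).le_opNorm_of_le (ih ⟨t, ht'⟩)).trans (le_of_eq ?_)
      simp only [hm]
      ring
    refine (intervalIntegral.norm_integral_le_abs_of_norm_le hb (hint'.mul_const _)).trans ?_
    -- The primitive `m` is negative to the left of `0`, but has constant sign on each side, so the
    -- inner absolute value only contributes a factor `(-1)ⁿ`.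
    have habs : |∫ t in (0 : ℝ)..x, ‖A t‖ * |m t| ^ n| = |∫ t in (0 : ℝ)..x, ‖A t‖ * m t ^ n| := by
      rcases le_total 0 (x : ℝ) with h | h
      · congr 1
        refine intervalIntegral.integral_congr fun t ht => ?_
        rw [uIcc_of_le h] at ht
        have : 0 ≤ m t := intervalIntegral.integral_nonneg ht.1 fun s _ => norm_nonneg _
        simp only [abs_of_nonneg this]
      · have h1 : ∫ t in (0 : ℝ)..x, ‖A t‖ * |m t| ^ n =
            (-1) ^ n * ∫ t in (0 : ℝ)..x, ‖A t‖ * m t ^ n := by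
          rw [← intervalIntegral.integral_const_mul]
          refine intervalIntegral.integral_congr fun t ht => ?_
          rw [uIcc_of_ge h] at ht
          have : m t ≤ 0 := by
            simp only [hm]
            rw [intervalIntegral.integral_symm, neg_nonpos]
            exact intervalIntegral.integral_nonneg ht.2 fun s _ => norm_nonneg _
          simp only [abs_of_nonpos this]
          rw [← neg_one_mul (m t), mul_pow]
          ring
        rw [h1, abs_mul, abs_pow, abs_neg, abs_one, one_pow, one_mul]
    rw [intervalIntegral.integral_mul_const, abs_mul, habs, hm,
      integral_mul_pow_primitive (locallyIntegrable_norm hA),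
      abs_div, abs_pow, abs_of_nonneg (a := ‖u‖ / _) (by positivity),
      abs_of_nonneg (a := (n : ℝ) + 1) (by positivity), Nat.factorial_succ]
    push_cast
    apply le_of_eq
    field_simp

variable [CompleteSpace E]

/-- The factorial makes some power `Vⁿ` a strict contraction, and `1 - V` is one of two commuting
factors of the invertible operator `1 - Vⁿ`. No smallness of `A` or of the interval is needed. -/
lemma isUnit_one_sub_volterra {A : ℝ → E →L[ℂ] E} (hA : LocallyIntegrable A volume) (N : ℕ) :
    IsUnit (1 - volterra A N) := by
  have hN : (0 : ℝ) ≤ N := N.cast_nonneg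
  have hi := intervalIntegrable_of_locallyIntegrable (locallyIntegrable_norm hA)
  set c := ∫ t in (-(N : ℝ))..N, ‖A t‖ with hc
  have hc0 : 0 ≤ c := intervalIntegral.integral_nonneg (by linarith) fun t _ => norm_nonneg _
  obtain ⟨n, hn⟩ : ∃ n : ℕ, c ^ n / n.factorial < 1 :=
    ((FloorSemiring.tendsto_pow_div_factorial_atTop c).eventually (gt_mem_nhds one_pos)).exists
  have hle : ‖volterra A N ^ n‖ ≤ c ^ n / n.factorial := by
    refine ContinuousLinearMap.opNorm_le_bound _ (by positivity) fun u => ?_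
    rw [ContinuousMap.norm_le _ (by positivity)]
    intro x
    refine (norm_volterra_pow_apply_le hA N n u x).trans ?_
    have : |∫ t in (0 : ℝ)..x, ‖A t‖| ≤ c :=
      abs_integral_le_integral_symm (locallyIntegrable_norm hA) (fun t => norm_nonneg _) x.2
    gcongr
  have h1 : IsUnit (1 - volterra A N ^ n) :=
    isUnit_one_sub_of_norm_lt_one (x := volterra A N ^ n) (hle.trans_lt hn)
  rw [← mul_neg_geom_sum] at h1
  refine (Commute.isUnit_mul_iff ?_).1 h1 |>.1
  refine Commute.sum_right _ _ _ fun i _ => ?_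
  exact (Commute.one_left _).sub_left (Commute.self_pow _ _)

end Volterra

end

/-! ### Linear systems with locally integrable coefficients. -/

section

section LinearSystem

variable {E : Type*} [NormedAddCommGroup E] [NormedSpace ℂ E]

/-- The solution of `ψ' = A ψ`, `ψ(0) = v` on `[-N, N]`. -/
def volterraSol (A : ℝ → E →L[ℂ] E) (N : ℕ) (v : E) : C(Icc (-(N : ℝ)) N, E) :=
  Ring.inverse (1 - volterra A N) (ContinuousMap.const _ v)

lemma locallyIntegrable_clm_add {A₀ A₁ : ℝ → E →L[ℂ] E} (h₀ : LocallyIntegrable A₀ volume)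
    (h₁ : LocallyIntegrable A₁ volume) (z : ℂ) : LocallyIntegrable (A₀ + z • A₁) volume :=
  h₀.add (h₁.smul z)

lemma locallyIntegrable_clm_const (L : E →L[ℂ] E) :
    LocallyIntegrable (fun _ : ℝ => L) volume := continuous_const.locallyIntegrable

lemma locallyIntegrable_smul_clm_add {a b : ℝ → ℂ} (ha : LocallyIntegrable a volume)
    (hb : LocallyIntegrable b volume) (L₁ L₂ : E →L[ℂ] E) :
    LocallyIntegrable (fun x => a x • L₁ + b x • L₂) volume := by
  have h₁ : LocallyIntegrable (fun x => a x • L₁) volume := fun x =>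
    let ⟨s, hs, hi⟩ := ha x
    ⟨s, hs, Integrable.smul_const hi L₁⟩
  have h₂ : LocallyIntegrable (fun x => b x • L₂) volume := fun x =>
    let ⟨s, hs, hi⟩ := hb x
    ⟨s, hs, Integrable.smul_const hi L₂⟩
  refine (locallyIntegrable_clm_add h₁ h₂ 1).congr (Eventually.of_forall fun x => ?_)
  simp

variable [CompleteSpace E] {A : ℝ → E →L[ℂ] E}

lemma volterraSol_apply (hA : LocallyIntegrable A volume) (N : ℕ) (v : E)
    (x : Icc (-(N : ℝ)) N) :
    volterraSol A N v x = v + ∫ t in (0 : ℝ)..x, A t (extendIcc (volterraSol A N v) t) := by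
  have h1 : (1 - volterra A N) (volterraSol A N v) = ContinuousMap.const _ v := by
    rw [volterraSol, ← mul_apply_eq_comp, Ring.mul_inverse_cancel _ (isUnit_one_sub_volterra hA N),
      one_apply_eq_self]
  have h2 := congrArg (fun u => u x) h1
  simp only [_root_.sub_apply, one_apply_eq_self, ContinuousMap.sub_apply,
    ContinuousMap.const_apply] at h2
  rw [← volterra_apply hA]
  exact sub_eq_iff_eq_add.1 h2

/-- Uniqueness: the integral equation says that `1 - V` maps `ψ` to the constant `v`, and `1 - V` is
injective. -/
lemma eq_volterraSol (hA : LocallyIntegrable A volume) {N : ℕ} {v : E} {ψ : ℝ → E}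
    (hψ : Continuous ψ) (h : ∀ x ∈ Icc (-(N : ℝ)) N, ψ x = v + ∫ t in (0 : ℝ)..x, A t (ψ t))
    {x : ℝ} (hx : x ∈ Icc (-(N : ℝ)) N) : ψ x = volterraSol A N v ⟨x, hx⟩ := by
  set u : C(Icc (-(N : ℝ)) N, E) := ⟨fun x => ψ x, hψ.comp continuous_subtype_val⟩
  have h1 : (1 - volterra A N) u = ContinuousMap.const _ v := by
    ext y
    simp only [_root_.sub_apply, one_apply_eq_self, ContinuousMap.sub_apply,
      ContinuousMap.const_apply]
    rw [volterra_apply hA, sub_eq_iff_eq_add]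
    refine (h y y.2).trans ?_
    congr 1
    refine intervalIntegral.integral_congr fun t ht => ?_
    have ht' : t ∈ Icc (-(N : ℝ)) N := by
      have hN : (0 : ℝ) ≤ N := N.cast_nonneg
      exact ordConnected_Icc.uIcc_subset ⟨by linarith, hN⟩ y.2 ht
    rw [extendIcc_of_mem u ht']
    rfl
  have h2 : u = volterraSol A N v := by
    rw [volterraSol, ← h1, ← mul_apply_eq_comp,
      Ring.inverse_mul_cancel _ (isUnit_one_sub_volterra hA N), one_apply_eq_self]
  exact congrArg (fun w : C(Icc (-(N : ℝ)) N, E) => w ⟨x, hx⟩) h2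

/-- The value at `x` is taken from the smallest interval `[-N, N]` containing it; uniqueness makes
the pieces agree. -/
lemma exists_linearSystem_solution (hA : LocallyIntegrable A volume) (v : E) :
    ∃ ψ : ℝ → E, Continuous ψ ∧ ∀ x, ψ x = v + ∫ t in (0 : ℝ)..x, A t (ψ t) := by
  set ψ : ℝ → E := fun x => extendIcc (volterraSol A ⌈|x|⌉₊ v) x with hψ
  have hmem : ∀ x : ℝ, x ∈ Icc (-(⌈|x|⌉₊ : ℝ)) ⌈|x|⌉₊ := fun x => abs_le.1 (Nat.le_ceil _)
  have key : ∀ (N : ℕ), ∀ x ∈ Icc (-(N : ℝ)) N, ψ x = extendIcc (volterraSol A N v) x := by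
    intro N x hx
    have hle : (⌈|x|⌉₊ : ℝ) ≤ N := by
      exact_mod_cast Nat.ceil_le.2 (abs_le.2 hx)
    rw [eq_volterraSol hA (continuous_extendIcc (volterraSol A N v)) (fun y hy => ?_) (hmem x), hψ]
    · exact extendIcc_of_mem _ (hmem x)
    · have hy' : y ∈ Icc (-(N : ℝ)) N := ⟨by linarith [hy.1], hy.2.trans hle⟩
      rw [extendIcc_of_mem _ hy', volterraSol_apply hA]
  refine ⟨ψ, ?_, fun x => ?_⟩
  · rw [continuous_iff_continuousAt]
    intro x
    obtain ⟨N, hN⟩ := exists_nat_gt |x|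
    refine (continuous_extendIcc (volterraSol A N v)).continuousAt.congr ?_
    filter_upwards [Ioo_mem_nhds (abs_lt.1 hN).1 (abs_lt.1 hN).2] with y hy
    exact (key N y (Ioo_subset_Icc_self hy)).symm
  · have hx := hmem x
    rw [key _ x hx, extendIcc_of_mem _ hx, volterraSol_apply hA]
    congr 1
    refine intervalIntegral.integral_congr fun t ht => ?_
    have ht' : t ∈ Icc (-(⌈|x|⌉₊ : ℝ)) ⌈|x|⌉₊ := by
      have hN : (0 : ℝ) ≤ ⌈|x|⌉₊ := Nat.cast_nonneg _
      exact ordConnected_Icc.uIcc_subset ⟨by linarith, hN⟩ hx ht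
    simp only [key _ t ht']

lemma differentiable_inverse_one_sub {R : Type*} [NormedRing R] [NormedAlgebra ℂ R]
    [CompleteSpace R] (a b : R) (h : ∀ z : ℂ, IsUnit (1 - (a + z • b))) :
    Differentiable ℂ fun z : ℂ => Ring.inverse (1 - (a + z • b)) := fun z =>
  (differentiableAt_inverse (h z)).comp z (f := fun z : ℂ => 1 - (a + z • b)) (by fun_prop)

/-- The Volterra operator is affine in `z`, and inversion is differentiable on the units of a Banach
algebra. -/
lemma differentiable_volterraSol {A₀ A₁ : ℝ → E →L[ℂ] E} (h₀ : LocallyIntegrable A₀ volume)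
    (h₁ : LocallyIntegrable A₁ volume) (N : ℕ) (v : E) :
    Differentiable ℂ fun z : ℂ => volterraSol (A₀ + z • A₁) N v := by
  have hz : ∀ z : ℂ, LocallyIntegrable (A₀ + z • A₁) volume := fun z => h₀.add (h₁.smul z)
  have hvol : ∀ z : ℂ, volterra (A₀ + z • A₁) N = volterra A₀ N + z • volterra A₁ N := by
    intro z
    ext u x
    have hi : ∀ {A : ℝ → E →L[ℂ] E}, LocallyIntegrable A volume →
        IntervalIntegrable (fun t => A t (extendIcc u t)) volume 0 x := fun hA =>
      intervalIntegrable_of_locallyIntegrable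
        (locallyIntegrable_clm_apply hA (continuous_extendIcc u)) _ _
    simp only [volterra_apply (hz z), _root_.add_apply, ContinuousMap.add_apply, _root_.smul_apply,
      ContinuousMap.smul_apply, volterra_apply h₀, volterra_apply h₁, Pi.add_apply, Pi.smul_apply]
    rw [← intervalIntegral.integral_smul]
    exact intervalIntegral.integral_add (hi h₀) ((hi h₁).smul z)
  have h2 := differentiable_inverse_one_sub (volterra A₀ N) (volterra A₁ N) fun z => by
    rw [← hvol]
    exact isUnit_one_sub_volterra (hz z) N
  simp only [volterraSol, hvol]
  exact h2.clm_apply (differentiable_const _)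

end LinearSystem

/-! ### The Dirac equation as a first order system. -/

/-- A matrix as a continuous linear map on `ℂ²`. -/
def actL (A : Matrix (Fin 2) (Fin 2) ℂ) : C2 →L[ℂ] C2 :=
  LinearMap.toContinuousLinearMap
    { toFun := act A, map_add' := act_add A, map_smul' := act_smul A }

@[simp] lemma actL_apply (A : Matrix (Fin 2) (Fin 2) ℂ) (v : C2) : actL A v = act A v := rfl

lemma act_apply_zero (A : Matrix (Fin 2) (Fin 2) ℂ) (v : C2) :
    act A v 0 = A 0 0 * v 0 + A 0 1 * v 1 := by
  simp [act]

lemma act_apply_one (A : Matrix (Fin 2) (Fin 2) ℂ) (v : C2) :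
    act A v 1 = A 1 0 * v 0 + A 1 1 * v 1 := by
  simp [act]

lemma C2_ext {v w : C2} (h0 : v 0 = w 0) (h1 : v 1 = w 1) : v = w := by
  ext i
  fin_cases i
  exacts [h0, h1]

lemma act_sigma4_act_sigma4 (v : C2) : act sigma4 (act sigma4 v) = -v := by
  apply C2_ext <;> simp [act_apply_zero, act_apply_one, sigma4]

lemma act_neg (A : Matrix (Fin 2) (Fin 2) ℂ) (v : C2) : act A (-v) = -act A v := by
  simpa using map_neg (actL A) v

/-- The coefficient `-σ₄ B̃` of the first order system. -/
def coefPotential (q : ℝ → ℂ) (x : ℝ) : C2 →L[ℂ] C2 := -(actL sigma4 * actL (potential q x))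

lemma coefPotential_apply (q : ℝ → ℂ) (x : ℝ) (v : C2) :
    coefPotential q x v = -act sigma4 (act (potential q x) v) := rfl

variable {q : ℝ → ℂ}

lemma locallyIntegrable_coefPotential (hq : LocallyIntegrable q volume) :
    LocallyIntegrable (coefPotential q) volume := by
  set L₁ : C2 →L[ℂ] C2 := actL !![0, -Complex.I; -Complex.I, 0] with hL₁
  set L₂ : C2 →L[ℂ] C2 := actL !![Complex.I, 0; 0, -Complex.I] with hL₂
  have h : coefPotential q = fun x => ((q x).re : ℂ) • L₁ + ((q x).im : ℂ) • L₂ := by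
    ext1 x
    refine ContinuousLinearMap.ext fun v => ?_
    rw [coefPotential_apply]
    apply C2_ext <;>
    simp [hL₁, hL₂, act_apply_zero, act_apply_one, sigma4, potential] <;> ring
  rw [h]
  refine locallyIntegrable_smul_clm_add (fun x => ?_) (fun x => ?_) L₁ L₂
  · obtain ⟨s, hs, hi⟩ := hq x
    exact ⟨s, hs, Integrable.ofReal (Integrable.re hi)⟩
  · obtain ⟨s, hs, hi⟩ := hq x
    exact ⟨s, hs, Integrable.ofReal (Integrable.im hi)⟩

/-- The coefficient `σ₄ (z - B̃)` of the first order system. -/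
def coef (q : ℝ → ℂ) (z : ℂ) : ℝ → C2 →L[ℂ] C2 :=
  coefPotential q + z • fun _ : ℝ => actL sigma4

lemma coef_apply (q : ℝ → ℂ) (z : ℂ) (t : ℝ) (v : C2) :
    coef q z t v = coefPotential q t v + act sigma4 (z • v) := by
  simp [coef, act_smul]

lemma locallyIntegrable_coef (hq : LocallyIntegrable q volume) (z : ℂ) :
    LocallyIntegrable (coef q z) volume :=
  locallyIntegrable_clm_add (locallyIntegrable_coefPotential hq)
    (locallyIntegrable_clm_const (actL sigma4)) z

/-- Multiply by `σ₄` and use `σ₄² = -1`. -/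
lemma hamExpr_eq_iff {ψ : ℝ → C2} {x : ℝ} {w : C2} :
    hamExpr q ψ x = w ↔ deriv ψ x = coefPotential q x (ψ x) + act sigma4 w := by
  rw [hamExpr, coefPotential_apply]
  constructor
  · rintro rfl
    rw [act_add, act_neg, act_sigma4_act_sigma4]
    abel
  · intro h
    rw [h, act_add, act_neg, act_sigma4_act_sigma4, act_sigma4_act_sigma4]
    abel

lemma hasDerivAt_of_hamExpr (hq : LocallyIntegrable q volume) {ψ w : ℝ → C2} (hψ : IsACLoc ψ)
    (hw : LocallyIntegrable w volume) (h : ∀ᵐ x, hamExpr q ψ x = w x) :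
    (LocallyIntegrable (fun x => coefPotential q x (ψ x) + act sigma4 (w x)) volume) ∧
      ∀ᵐ x, HasDerivAt ψ (coefPotential q x (ψ x) + act sigma4 (w x)) x := by
  constructor
  · refine (locallyIntegrable_clm_apply (locallyIntegrable_coefPotential hq) hψ.continuous).add ?_
    intro x
    obtain ⟨s, hs, hi⟩ := hw x
    exact ⟨s, hs, (actL sigma4).integrable_comp hi⟩
  · filter_upwards [h, hψ.ae_differentiableAt] with x h1 h2
    rw [← hamExpr_eq_iff.1 h1]
    exact h2.hasDerivAt

lemma isSolution_iff (hq : LocallyIntegrable q volume) {z : ℂ} {ψ : ℝ → C2} :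
    IsSolution q z ψ ↔ Continuous ψ ∧ ∀ x, ψ x = ψ 0 + ∫ t in (0 : ℝ)..x,
      coef q z t (ψ t) := by
  constructor
  · rintro ⟨hψ, h⟩
    refine ⟨hψ.continuous, fun x => ?_⟩
    obtain ⟨h1, h2⟩ := hasDerivAt_of_hamExpr (w := fun x => z • ψ x) hq hψ
      (hψ.continuous.const_smul z).locallyIntegrable h
    simp only [coef_apply]
    rw [integral_eq_sub_of_absolutelyContinuous hψ h1 h2]
    abel
  · rintro ⟨hψ, h⟩
    have hli := locallyIntegrable_clm_apply (locallyIntegrable_coef hq z) hψ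
    have hψ' : ψ = fun x => ψ 0 + ∫ t in (0 : ℝ)..x,
      coef q z t (ψ t) := funext h
    refine ⟨fun a b => ?_, ?_⟩
    · rw [hψ']
      exact (absolutelyContinuousOnInterval_const (ψ 0) a b).add
        (absolutelyContinuousOnInterval_integral hli 0 a b)
    · filter_upwards [_root_.LocallyIntegrable.ae_hasDerivAt_integral hli] with x hx
      rw [hamExpr_eq_iff, ← coef_apply]
      have := ((hx 0).const_add (ψ 0)).deriv
      rwa [← hψ'] at this

lemma ivpSol_spec (hq : LocallyIntegrable q volume) (z : ℂ) (v : C2) :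
    IsSolution q z (ivpSol q z v) ∧ ivpSol q z v 0 = v := by
  have h : ∃ ψ, IsSolution q z ψ ∧ ψ 0 = v := by
    obtain ⟨ψ, h1, h2⟩ := exists_linearSystem_solution (locallyIntegrable_coef hq z) v
    have h0 : ψ 0 = v := by simpa using h2 0
    exact ⟨ψ, (isSolution_iff hq).2 ⟨h1, by rwa [h0]⟩, h0⟩
  rw [ivpSol, dif_pos h]
  exact h.choose_spec

lemma eq_volterraSol_of_isSolution (hq : LocallyIntegrable q volume) {z : ℂ} {ψ : ℝ → C2}
    (hψ : IsSolution q z ψ) {N : ℕ} {x : ℝ} (hx : x ∈ Icc (-(N : ℝ)) N) :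
    ψ x = volterraSol (coef q z) N (ψ 0) ⟨x, hx⟩ :=
  eq_volterraSol (locallyIntegrable_coef hq z) ((isSolution_iff hq).1 hψ).1
    (fun y _ => ((isSolution_iff hq).1 hψ).2 y) hx

lemma IsSolution.ext (hq : LocallyIntegrable q volume) {z : ℂ} {ψ φ : ℝ → C2}
    (hψ : IsSolution q z ψ) (hφ : IsSolution q z φ) (h : ψ 0 = φ 0) : ψ = φ := by
  ext1 x
  obtain ⟨N, hN⟩ := exists_nat_ge |x|
  rw [eq_volterraSol_of_isSolution hq hψ (abs_le.1 hN),
    eq_volterraSol_of_isSolution hq hφ (abs_le.1 hN), h]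

end

/-! ### Wronskians and analytic dependence on the spectral parameter. -/

section

/-- The bilinear form `uᵀ w` on `ℂ²`. -/
def bilin (u w : C2) : ℂ := u 0 * w 0 + u 1 * w 1

/-- The Wronskian `det (u w)`. -/
def wronsk (u w : C2) : ℂ := u 0 * w 1 - u 1 * w 0

/-- A coordinate as a real continuous linear map. -/
def coordL (i : Fin 2) : C2 →L[ℝ] ℂ := (EuclideanSpace.proj (𝕜 := ℂ) i).restrictScalars ℝ

lemma norm_coord_le (i : Fin 2) (v : C2) : ‖v i‖ ≤ ‖v‖ := PiLp.norm_apply_le v i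

lemma continuous_coord (i : Fin 2) : Continuous fun v : C2 => v i := (coordL i).continuous

lemma absolutelyContinuousOnInterval_coord {ψ : ℝ → C2} {a b : ℝ}
    (h : AbsolutelyContinuousOnInterval ψ a b) (i : Fin 2) :
    AbsolutelyContinuousOnInterval (fun x => ψ x i) a b :=
  absolutelyContinuousOnInterval_of_dist_le h fun x y => by
    rw [dist_eq_norm, dist_eq_norm]
    exact norm_coord_le i (ψ x - ψ y)

lemma locallyIntegrable_coord {g : ℝ → C2} (hg : LocallyIntegrable g volume) (i : Fin 2) :
    LocallyIntegrable (fun x => g x i) volume := fun x => by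
  obtain ⟨s, hs, hi⟩ := hg x
  exact ⟨s, hs, (coordL i).integrable_comp hi⟩

lemma locallyIntegrable_continuous_mul {a b : ℝ → ℂ} (ha : Continuous a)
    (hb : LocallyIntegrable b volume) : LocallyIntegrable (fun x => a x * b x) volume := by
  rw [← locallyIntegrableOn_univ] at hb ⊢
  simpa only [smul_eq_mul] using
    hb.continuousOn_smul isOpen_univ.isLocallyClosed ha.continuousOn

lemma locallyIntegrable_bilin {ψ g : ℝ → C2} (hψ : Continuous ψ)
    (hg : LocallyIntegrable g volume) :
    LocallyIntegrable (fun x => bilin (ψ x) (g x)) volume :=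
  (locallyIntegrable_continuous_mul ((continuous_coord 0).comp hψ)
    (locallyIntegrable_coord hg 0)).add
    (locallyIntegrable_continuous_mul ((continuous_coord 1).comp hψ) (locallyIntegrable_coord hg 1))

variable {q : ℝ → ℂ}

/-- The sum equals the trace of `-σ₄ B̃` times the Wronskian, and this trace vanishes because `B̃`
is symmetric. -/
lemma wronsk_coefPotential_add (x : ℝ) (u w : C2) :
    wronsk (coefPotential q x u) w + wronsk u (coefPotential q x w) = 0 := by
  simp only [wronsk, coefPotential_apply, PiLp.neg_apply, act_apply_zero, act_apply_one, sigma4,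
    potential, Matrix.smul_apply, Matrix.of_apply, Matrix.cons_val', Matrix.cons_val_zero,
    Matrix.cons_val_one, Matrix.cons_val_fin_one, smul_eq_mul]
  ring

lemma hasDerivAt_wronsk {ψ₁ ψ₂ : ℝ → C2} {v₁ v₂ : C2} {x : ℝ} (h₁ : HasDerivAt ψ₁ v₁ x)
    (h₂ : HasDerivAt ψ₂ v₂ x) :
    HasDerivAt (fun x => wronsk (ψ₁ x) (ψ₂ x)) (wronsk v₁ (ψ₂ x) + wronsk (ψ₁ x) v₂) x := by
  have h : ∀ {ψ : ℝ → C2} {v : C2} (_ : HasDerivAt ψ v x) (i : Fin 2),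
      HasDerivAt (fun x => ψ x i) (v i) x := fun h i =>
    ((coordL i).hasFDerivAt.comp_hasDerivAt x h)
  refine (((h h₁ 0).mul (h h₂ 1)).sub ((h h₁ 1).mul (h h₂ 0))).congr_deriv ?_
  simp only [wronsk]
  ring

/-- Lagrange's identity for a solution and a solution of the inhomogeneous equation. -/
lemma wronsk_sub_wronsk (hq : LocallyIntegrable q volume) {z : ℂ} {ψ₁ ψ₂ g : ℝ → C2}
    (h₁ : IsSolution q z ψ₁) (h₂ : IsACLoc ψ₂) (hg : LocallyIntegrable g volume)
    (h : ∀ᵐ x, hamExpr q ψ₂ x = z • ψ₂ x + g x) (x y : ℝ) :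
    wronsk (ψ₁ y) (ψ₂ y) - wronsk (ψ₁ x) (ψ₂ x) = -∫ t in x..y, bilin (ψ₁ t) (g t) := by
  have hac : ∀ a b, AbsolutelyContinuousOnInterval (fun x => wronsk (ψ₁ x) (ψ₂ x)) a b := fun a b =>
    (((absolutelyContinuousOnInterval_coord (h₁.1 a b) 0).fun_smul
      (absolutelyContinuousOnInterval_coord (h₂ a b) 1)).sub
      ((absolutelyContinuousOnInterval_coord (h₁.1 a b) 1).fun_smul
      (absolutelyContinuousOnInterval_coord (h₂ a b) 0)))
  have hd₁ := (hasDerivAt_of_hamExpr (w := fun x => z • ψ₁ x) hq h₁.1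
    (h₁.1.continuous.const_smul z).locallyIntegrable h₁.2).2
  have hd₂ := (hasDerivAt_of_hamExpr (w := fun x => z • ψ₂ x + g x) hq h₂
    ((h₂.continuous.const_smul z).locallyIntegrable.add hg) h).2
  have hli := locallyIntegrable_bilin h₁.1.continuous hg
  rw [← intervalIntegral.integral_neg]
  refine (integral_eq_sub_of_absolutelyContinuous hac hli.neg ?_ x y).symm
  filter_upwards [hd₁, hd₂] with t ht₁ ht₂
  refine (hasDerivAt_wronsk ht₁ ht₂).congr_deriv ?_
  have h0 := wronsk_coefPotential_add (q := q) t (ψ₁ t) (ψ₂ t)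
  simp only [wronsk, bilin, PiLp.add_apply, PiLp.smul_apply, smul_eq_mul, act_apply_zero,
    act_apply_one, Pi.neg_apply] at h0 ⊢
  simp only [sigma4, Matrix.of_apply, Matrix.cons_val', Matrix.cons_val_zero, Matrix.cons_val_one,
    Matrix.cons_val_fin_one]
  linear_combination h0

variable {θ : ℝ}

lemma isSolution_solTheta (hq : LocallyIntegrable q volume) (z : ℂ) :
    IsSolution q z (solTheta q θ z) := (ivpSol_spec hq z _).1

lemma isSolution_solPhi (hq : LocallyIntegrable q volume) (z : ℂ) :
    IsSolution q z (solPhi q θ z) := (ivpSol_spec hq z _).1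

lemma solTheta_zero (hq : LocallyIntegrable q volume) (z : ℂ) :
    solTheta q θ z 0 = !₂[(Real.cos θ : ℂ), (Real.sin θ : ℂ)] := (ivpSol_spec hq z _).2

lemma solPhi_zero (hq : LocallyIntegrable q volume) (z : ℂ) :
    solPhi q θ z 0 = !₂[-(Real.sin θ : ℂ), (Real.cos θ : ℂ)] := (ivpSol_spec hq z _).2

lemma wronsk_solTheta_solPhi (hq : LocallyIntegrable q volume) (z : ℂ) (x : ℝ) :
    wronsk (solTheta q θ z x) (solPhi q θ z x) = 1 := by
  have h := wronsk_sub_wronsk hq (isSolution_solTheta (θ := θ) hq z)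
    (isSolution_solPhi (θ := θ) hq z).1 (g := fun _ => 0) continuous_const.locallyIntegrable
    (by simpa using (isSolution_solPhi (θ := θ) hq z).2) 0 x
  have h0 : wronsk (solTheta q θ z 0) (solPhi q θ z 0) = 1 := by
    rw [solTheta_zero hq, solPhi_zero hq]
    have := Complex.cos_sq_add_sin_sq (θ : ℂ)
    simp only [wronsk]
    simp
    linear_combination this
  rw [h0] at h
  simpa [bilin, sub_eq_zero] using h

/-- On `|x| < N` the solution is the evaluation at `x` of an element of `C([-N, N], ℂ²)` that
depends continuously on `z` in the sup norm. -/
lemma continuous_ivpSol (hq : LocallyIntegrable q volume) (v : C2) :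
    Continuous fun p : ℂ × ℝ => ivpSol q p.1 v p.2 := by
  rw [continuous_iff_continuousAt]
  rintro ⟨z, x⟩
  obtain ⟨N, hN⟩ := exists_nat_gt |x|
  have hd : Continuous fun z : ℂ => volterraSol (coef q z) N v :=
    (differentiable_volterraSol (locallyIntegrable_coefPotential hq)
      (locallyIntegrable_clm_const (actL sigma4)) N v).continuous
  have hN0 : -(N : ℝ) ≤ N := neg_le_self N.cast_nonneg
  have hc : Continuous fun p : ℂ × ℝ => volterraSol (coef q p.1) N v (projIcc _ _ hN0 p.2) :=
    (hd.comp continuous_fst).eval (continuous_projIcc.comp continuous_snd)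
  refine hc.continuousAt.congr ?_
  have hx : ∀ᶠ p : ℂ × ℝ in 𝓝 (z, x), p.2 ∈ Ioo (-(N : ℝ)) N :=
    continuous_snd.continuousAt.eventually (Ioo_mem_nhds (abs_lt.1 hN).1 (abs_lt.1 hN).2)
  filter_upwards [hx] with p hp
  have hp' := Ioo_subset_Icc_self hp
  rw [eq_volterraSol_of_isSolution hq (ivpSol_spec hq p.1 v).1 hp', (ivpSol_spec hq p.1 v).2,
    projIcc_of_mem _ hp']

lemma norm_bilin_le (u w : C2) : ‖bilin u w‖ ≤ 2 * (‖u‖ * ‖w‖) := by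
  refine (norm_add_le _ _).trans ?_
  rw [norm_mul, norm_mul]
  have h0 := mul_le_mul (norm_coord_le 0 u) (norm_coord_le 0 w) (norm_nonneg _) (norm_nonneg _)
  have h1 := mul_le_mul (norm_coord_le 1 u) (norm_coord_le 1 w) (norm_nonneg _) (norm_nonneg _)
  linarith

/-- The functional `u ↦ ∫ uᵀ g` on `C([-N, N], ℂ²)`. -/
lemma exists_integral_functional {N : ℕ} {g : ℝ → C2} (hg : LocallyIntegrable g volume) :
    ∃ L : C(Icc (-(N : ℝ)) N, C2) →L[ℂ] ℂ, ∀ u,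
      L u = ∫ t in (-(N : ℝ))..N, bilin (extendIcc u t) (g t) := by
  have hi : ∀ u : C(Icc (-(N : ℝ)) N, C2), IntervalIntegrable
      (fun t => bilin (extendIcc u t) (g t)) volume (-(N : ℝ)) N := fun u =>
    intervalIntegrable_of_locallyIntegrable
      (locallyIntegrable_bilin (continuous_extendIcc u) hg) _ _
  have hN : -(N : ℝ) ≤ N := neg_le_self N.cast_nonneg
  refine ⟨LinearMap.mkContinuous
    { toFun := fun u => ∫ t in (-(N : ℝ))..N, bilin (extendIcc u t) (g t)
      map_add' := fun u v => by
        rw [← intervalIntegral.integral_add (hi u) (hi v)]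
        refine intervalIntegral.integral_congr fun t _ => ?_
        simp only [bilin, extendIcc, IccExtend, Function.comp_apply, ContinuousMap.add_apply,
          PiLp.add_apply]
        ring
      map_smul' := fun c u => by
        rw [← intervalIntegral.integral_smul]
        refine intervalIntegral.integral_congr fun t _ => ?_
        simp only [bilin, extendIcc, IccExtend, Function.comp_apply, ContinuousMap.smul_apply,
          PiLp.smul_apply, RingHom.id_apply, smul_eq_mul]
        ring }
    (∫ t in (-(N : ℝ))..N, 2 * ‖g t‖) fun u => ?_, fun u => rfl⟩
  refine (intervalIntegral.norm_integral_le_integral_norm hN).trans ?_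
  rw [← intervalIntegral.integral_mul_const]
  refine intervalIntegral.integral_mono_on hN (hi u).norm
    (((intervalIntegrable_of_locallyIntegrable (locallyIntegrable_norm hg) _ _).const_mul
      _).mul_const _) fun t _ => ?_
  have h1 : ‖extendIcc u t‖ ≤ ‖u‖ := u.norm_coe_le_norm _
  calc ‖bilin (extendIcc u t) (g t)‖ ≤ 2 * (‖extendIcc u t‖ * ‖g t‖) := norm_bilin_le _ _
    _ ≤ 2 * (‖u‖ * ‖g t‖) := by gcongr
    _ = 2 * ‖g t‖ * ‖u‖ := by ring

lemma differentiable_integral_bilin_ivpSol (hq : LocallyIntegrable q volume) (v : C2) {g : ℝ → C2}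
    (hg : LocallyIntegrable g volume) (N : ℕ) :
    Differentiable ℂ fun z => ∫ t in (-(N : ℝ))..N, bilin (ivpSol q z v t) (g t) := by
  obtain ⟨L, hL⟩ := exists_integral_functional (N := N) hg
  have hd : Differentiable ℂ fun z : ℂ => L (volterraSol (coef q z) N v) :=
    L.differentiable.comp (differentiable_volterraSol (locallyIntegrable_coefPotential hq)
      (locallyIntegrable_clm_const (actL sigma4)) N v)
  convert hd using 2 with z
  rw [hL]
  refine intervalIntegral.integral_congr fun t ht => ?_
  rw [uIcc_of_le (neg_le_self N.cast_nonneg)] at ht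
  rw [extendIcc_of_mem _ ht, eq_volterraSol_of_isSolution hq (ivpSol_spec hq z v).1 ht,
    (ivpSol_spec hq z v).2]

end

/-! ### Weyl solutions and the jump of coordinates. -/

section

variable {q : ℝ → ℂ} {θ : ℝ} {z : ℂ}

/-- `ψ` is a square integrable solution of `(H̃ - z) ψ = g`. -/
def IsL2Solution (q : ℝ → ℂ) (z : ℂ) (g ψ : ℝ → C2) : Prop :=
  IsACLoc ψ ∧ MemLp ψ 2 volume ∧ ∀ᵐ x, hamExpr q ψ x = z • ψ x + g x

lemma IsResolventAt.exists_isL2Solution {R : L2 →L[ℂ] L2} (hR : IsResolventAt (hamOp q) z R)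
    {g : ℝ → C2} (hg : MemLp g 2 volume) :
    ∃ ψ, IsL2Solution q z g ψ ∧ R (hg.toLp g) =ᵐ[volume] ψ := by
  obtain ⟨hdom, he⟩ := hR.1 (hg.toLp g)
  have hmem := (hamOp q).mem_graph ⟨R (hg.toLp g), hdom⟩
  rw [hamOp_graph] at hmem
  obtain ⟨ψ, hψ, h1, h2⟩ := hmem
  simp only at h1 h2
  refine ⟨ψ, ⟨hψ, (Lp.memLp _).ae_eq h1, ?_⟩, h1⟩
  rw [sub_eq_iff_eq_add'] at he
  rw [he] at h2
  filter_upwards [h1, h2, Lp.coeFn_add (z • R (hg.toLp g)) (hg.toLp g),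
    Lp.coeFn_smul z (R (hg.toLp g)), hg.coeFn_toLp] with x e1 e2 e3 e4 e5
  rw [← e2, e3, Pi.add_apply, e4, Pi.smul_apply, e1, e5]

/-- The coordinates of `ψ(x)` relative to `Θ(z, x)`, `Φ(z, x)`. -/
def coords (q : ℝ → ℂ) (θ : ℝ) (z : ℂ) (ψ : ℝ → C2) (x : ℝ) : Fin 2 → ℂ :=
  ![-wronsk (solPhi q θ z x) (ψ x), wronsk (solTheta q θ z x) (ψ x)]

/-- The transform `∫ (Θ Φ)ᵀ g`. -/
def trans (q : ℝ → ℂ) (θ : ℝ) (z : ℂ) (g : ℝ → C2) : Fin 2 → ℂ :=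
  ![∫ t, bilin (solTheta q θ z t) (g t), ∫ t, bilin (solPhi q θ z t) (g t)]

lemma solComb_coords (hq : LocallyIntegrable q volume) (ψ : ℝ → C2) (x : ℝ) :
    solComb q θ z (coords q θ z ψ x) x = ψ x := by
  have h := wronsk_solTheta_solPhi (θ := θ) hq z x
  simp only [wronsk] at h
  apply C2_ext <;>
  · simp only [solComb, coords, wronsk, Matrix.cons_val_zero, Matrix.cons_val_one,
      PiLp.add_apply, PiLp.smul_apply, smul_eq_mul]
    first
    | linear_combination (ψ x 0) * h
    | linear_combination (ψ x 1) * h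

lemma continuous_solComb (hq : LocallyIntegrable q volume) (c : Fin 2 → ℂ) :
    Continuous (solComb q θ z c) :=
  ((isSolution_solTheta hq z).1.continuous.const_smul (c 0)).add
    ((isSolution_solPhi hq z).1.continuous.const_smul (c 1))

lemma support_bilin_subset {u g : ℝ → C2} {s : Set ℝ} (hs : Function.support g ⊆ s) :
    Function.support (fun t => bilin (u t) (g t)) ⊆ s := by
  intro t ht
  refine hs fun h0 => ht ?_
  simp [bilin, h0]

namespace IsL2Solution

variable {g ψ : ℝ → C2} (h : IsL2Solution q z g ψ)

include h

lemma coords_sub (hq : LocallyIntegrable q volume) (hg : LocallyIntegrable g volume) (x y : ℝ) :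
    coords q θ z ψ y 0 - coords q θ z ψ x 0 = ∫ t in x..y, bilin (solPhi q θ z t) (g t) ∧
      coords q θ z ψ y 1 - coords q θ z ψ x 1 = -∫ t in x..y, bilin (solTheta q θ z t) (g t) := by
  have h1 := wronsk_sub_wronsk hq (isSolution_solTheta (θ := θ) hq z) h.1 hg h.2.2 x y
  have h2 := wronsk_sub_wronsk hq (isSolution_solPhi (θ := θ) hq z) h.1 hg h.2.2 x y
  simp only [coords, Matrix.cons_val_zero, Matrix.cons_val_one]
  exact ⟨by linear_combination -h2, h1⟩

lemma coords_eq (hq : LocallyIntegrable q volume) (hg : LocallyIntegrable g volume) {x y : ℝ}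
    (hxy : ∀ t ∈ uIoc x y, g t = 0) : coords q θ z ψ y = coords q θ z ψ x := by
  obtain ⟨h0, h1⟩ := h.coords_sub (θ := θ) hq hg x y
  rw [intervalIntegral.integral_zero_ae (Eventually.of_forall fun t ht => by
    simp [bilin, hxy t ht])] at h0 h1
  funext i
  fin_cases i
  · exact sub_eq_zero.1 h0
  · exact sub_eq_zero.1 (by simpa using h1)

/-- Variation of parameters: the coordinates move only where `g` is nonzero, and by Lagrange's
identity their total change is the transform of `g`, rotated by a right angle. -/
lemma coords_jump (hq : LocallyIntegrable q volume) (hg : LocallyIntegrable g volume) {a b : ℝ}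
    (hs : Function.support g ⊆ Ioc a b) :
    coords q θ z ψ b - coords q θ z ψ a = ![trans q θ z g 1, -trans q θ z g 0] := by
  obtain ⟨h0, h1⟩ := h.coords_sub (θ := θ) hq hg a b
  rw [intervalIntegral.integral_eq_integral_of_support_subset (support_bilin_subset hs)] at h0 h1
  funext i
  fin_cases i
  · simpa [trans] using h0
  · simpa [trans] using h1

end IsL2Solution

lemma memLp_restrict_of_eq_of_abs_gt {f ψ : ℝ → C2} {s : Set ℝ} {N : ℝ} (hf : Continuous f)
    (hψ : MemLp ψ 2 volume) (hs : MeasurableSet s) (h : ∀ x ∈ s, N < |x| → f x = ψ x) :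
    MemLp f 2 (volume.restrict s) := by
  classical
  rw [← piecewise_same (Icc (-N) N) f]
  refine MemLp.piecewise measurableSet_Icc ?_ ?_
  · obtain ⟨C, hC⟩ := (isCompact_Icc (a := -N) (b := N)).exists_bound_of_continuousOn
      hf.continuousOn
    have : IsFiniteMeasure ((volume.restrict s).restrict (Icc (-N) N)) :=
      ⟨by
        rw [Measure.restrict_restrict measurableSet_Icc, Measure.restrict_apply_univ]
        exact (measure_mono inter_subset_left).trans_lt measure_Icc_lt_top⟩
    exact MemLp.of_bound hf.aestronglyMeasurable C ((ae_restrict_mem measurableSet_Icc).mono hC)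
  · rw [Measure.restrict_restrict measurableSet_Icc.compl]
    refine (hψ.restrict _).ae_eq ?_
    filter_upwards [ae_restrict_mem (measurableSet_Icc.compl.inter hs)] with x hx
    refine (h x hx.2 ?_).symm
    by_contra hx'
    exact hx.1 (abs_le.1 (not_lt.1 hx'))

lemma IsL2Solution.memLp_right {g ψ : ℝ → C2} (h : IsL2Solution q z g ψ)
    (hq : LocallyIntegrable q volume) (hg : LocallyIntegrable g volume) {a b : ℝ}
    (hs : Function.support g ⊆ Ioc a b) :
    MemLp (solComb q θ z (coords q θ z ψ b)) 2 (volume.restrict (Ici 0)) := by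
  refine memLp_restrict_of_eq_of_abs_gt (N := |b|) (continuous_solComb hq _) h.2.1
    measurableSet_Ici fun x hx hbx => ?_
  rw [abs_of_nonneg (mem_Ici.1 hx)] at hbx
  rw [← h.coords_eq (x := b) (y := x) hq hg fun t ht => ?_, solComb_coords hq]
  rw [uIoc_of_le ((le_abs_self b).trans hbx.le)] at ht
  by_contra h0
  exact absurd (hs h0).2 (not_le.2 ht.1)

lemma IsL2Solution.memLp_left {g ψ : ℝ → C2} (h : IsL2Solution q z g ψ)
    (hq : LocallyIntegrable q volume) (hg : LocallyIntegrable g volume) {a b : ℝ}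
    (hs : Function.support g ⊆ Ioc a b) :
    MemLp (solComb q θ z (coords q θ z ψ a)) 2 (volume.restrict (Iic 0)) := by
  refine memLp_restrict_of_eq_of_abs_gt (N := |a|) (continuous_solComb hq _) h.2.1
    measurableSet_Iic fun x hx hbx => ?_
  rw [abs_of_nonpos (mem_Iic.1 hx)] at hbx
  have hxa : x ≤ a := by linarith [neg_abs_le a]
  rw [← h.coords_eq (x := a) (y := x) hq hg fun t ht => ?_, solComb_coords hq]
  rw [uIoc_of_ge hxa] at ht
  by_contra h0
  exact absurd (hs h0).1 (not_lt.2 ht.2)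

/-- The determinant of two vectors. -/
def det2 (c d : Fin 2 → ℂ) : ℂ := c 0 * d 1 - c 1 * d 0

lemma memLp_solComb_add {s : Set ℝ} {c d : Fin 2 → ℂ} (a b : ℂ)
    (hc : MemLp (solComb q θ z c) 2 (volume.restrict s))
    (hd : MemLp (solComb q θ z d) 2 (volume.restrict s)) :
    MemLp (solComb q θ z (a • c + b • d)) 2 (volume.restrict s) := by
  refine ((hc.const_smul a).add (hd.const_smul b)).ae_eq (Eventually.of_forall fun x => ?_)
  simp only [solComb, Pi.add_apply, Pi.smul_apply, smul_add, smul_smul, add_smul, smul_eq_mul]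
  abel

/-- The limit-point property. Two independent square integrable solutions would make both `Θ` and
`Φ` square integrable on `s`, hence their Wronskian integrable; but it equals `1` on a set of
infinite measure. -/
lemma det2_eq_zero_of_memLp (hq : LocallyIntegrable q volume) {s : Set ℝ} (hs : volume s = ⊤)
    {c d : Fin 2 → ℂ} (hc : MemLp (solComb q θ z c) 2 (volume.restrict s))
    (hd : MemLp (solComb q θ z d) 2 (volume.restrict s)) : det2 c d = 0 := by
  by_contra h0
  have hall : ∀ w : Fin 2 → ℂ, MemLp (solComb q θ z w) 2 (volume.restrict s) := fun w => by
    have hw : w = (det2 w d / det2 c d) • c + (det2 c w / det2 c d) • d := by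
      funext i
      simp only [Pi.add_apply, Pi.smul_apply, smul_eq_mul]
      rw [div_mul_eq_mul_div, div_mul_eq_mul_div, ← add_div, eq_div_iff h0]
      fin_cases i <;> simp only [det2, Fin.zero_eta, Fin.mk_one] <;> ring
    rw [hw]
    exact memLp_solComb_add _ _ hc hd
  have hΘ : MemLp (solTheta q θ z) 2 (volume.restrict s) := by
    refine (hall ![1, 0]).ae_eq (Eventually.of_forall fun x => ?_)
    simp [solComb]
  have hΦ : MemLp (solPhi q θ z) 2 (volume.restrict s) := by
    refine (hall ![0, 1]).ae_eq (Eventually.of_forall fun x => ?_)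
    simp [solComb]
  have hcoord : ∀ {f : ℝ → C2}, MemLp f 2 (volume.restrict s) → ∀ i,
      MemLp (fun x => f x i) 2 (volume.restrict s) := fun hf i =>
    (coordL i).comp_memLp' hf
  have hint : Integrable (fun x => wronsk (solTheta q θ z x) (solPhi q θ z x))
      (volume.restrict s) :=
    ((hcoord hΘ 0).integrable_mul (hcoord hΦ 1)).sub ((hcoord hΘ 1).integrable_mul (hcoord hΦ 0))
  simp only [wronsk_solTheta_solPhi hq] at hint
  rw [integrable_const_iff] at hint
  rcases hint with h | h
  · exact one_ne_zero h
  · have := h.measure_univ_lt_top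
    rw [Measure.restrict_apply_univ, hs] at this
    exact lt_irrefl _ this

/-- The hypothesis says that the solutions square integrable at `+∞` and at `-∞` together span. If
no independent pair existed, all four determinants in the expansion of `det (c - d, c' - d') = 1`
would vanish. -/
lemma exists_isWeylPair (hq : LocallyIntegrable q volume)
    (hsum : ∀ w : Fin 2 → ℂ, ∃ c d, MemLp (solComb q θ z c) 2 (volume.restrict (Ici 0)) ∧
      MemLp (solComb q θ z d) 2 (volume.restrict (Iic 0)) ∧ c - d = w) :
    ∃ p, IsWeylPair q θ z p := by
  obtain ⟨c, d, hc, hd, h1⟩ := hsum ![1, 0]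
  obtain ⟨c', d', hc', hd', h2⟩ := hsum ![0, 1]
  have hcc := det2_eq_zero_of_memLp hq Real.volume_Ici hc hc'
  have hdd := det2_eq_zero_of_memLp hq Real.volume_Iic hd hd'
  by_contra hno
  have e1 : det2 c d' = 0 := by
    by_contra hne
    exact hno ⟨(c, d'), hc, hd', hne⟩
  have e2 : det2 c' d = 0 := by
    by_contra hne
    exact hno ⟨(c', d), hc', hd, hne⟩
  have h10 := congrFun h1 0
  have h11 := congrFun h1 1
  have h20 := congrFun h2 0
  have h21 := congrFun h2 1
  simp only [Pi.sub_apply, Matrix.cons_val_zero, Matrix.cons_val_one] at h10 h11 h20 h21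
  have : (c 0 - d 0) * (c' 1 - d' 1) - (c 1 - d 1) * (c' 0 - d' 0) = 1 := by
    rw [h10, h11, h20, h21]; ring
  simp only [det2] at hcc hdd e1 e2
  refine zero_ne_one (α := ℂ) ?_
  linear_combination this - (hcc + hdd - e1 + e2)

/-- By the limit-point property `c` and `d` are proportional to the chosen Weyl vectors, and their
difference then determines both factors by Cramer's rule. -/
lemma weylGamma_mulVec (hq : LocallyIntegrable q volume) (hex : ∃ p, IsWeylPair q θ z p)
    {c d : Fin 2 → ℂ} (hc : MemLp (solComb q θ z c) 2 (volume.restrict (Ici 0)))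
    (hd : MemLp (solComb q θ z d) 2 (volume.restrict (Iic 0))) {b : Fin 2 → ℂ}
    (hb : c - d = ![b 1, -b 0]) :
    c = weylGamma q θ z *ᵥ b ∧ d = (weylGamma q θ z)ᵀ *ᵥ b := by
  rw [weylGamma, dif_pos hex]
  obtain ⟨h1, h2, h3⟩ := hex.choose_spec
  set c' := hex.choose.1
  set d' := hex.choose.2
  have e1 := det2_eq_zero_of_memLp hq Real.volume_Ici h1 hc
  have e2 := det2_eq_zero_of_memLp hq Real.volume_Iic h2 hd
  have hb0 := congrFun hb 0
  have hb1 := congrFun hb 1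
  simp only [Pi.sub_apply, Matrix.cons_val_zero, Matrix.cons_val_one] at hb0 hb1
  simp only [det2] at e1 e2
  have key : ∀ i : Fin 2,
      (c' 0 * d' 1 - c' 1 * d' 0) * c i = c' i * (d' 0 * b 0 + d' 1 * b 1) ∧
      (c' 0 * d' 1 - c' 1 * d' 0) * d i = d' i * (c' 0 * b 0 + c' 1 * b 1) := by
    refine Fin.forall_fin_two.2 ⟨?_, ?_⟩
    · exact ⟨by linear_combination d' 0 * e1 - c' 0 * e2 + c' 0 * d' 1 * hb0 - c' 0 * d' 0 * hb1,
        by linear_combination d' 0 * e1 - c' 0 * e2 + d' 0 * c' 1 * hb0 - d' 0 * c' 0 * hb1⟩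
    · exact ⟨by linear_combination d' 1 * e1 - c' 1 * e2 + c' 1 * d' 1 * hb0 - c' 1 * d' 0 * hb1,
        by linear_combination d' 1 * e1 - c' 1 * e2 + d' 1 * c' 1 * hb0 - d' 1 * c' 0 * hb1⟩
  constructor
  · funext i
    rw [← mul_right_inj' h3, (key i).1]
    simp only [Matrix.mulVec, dotProduct, Fin.sum_univ_two, Matrix.smul_apply,
      Matrix.vecMulVec_apply, smul_eq_mul]
    linear_combination -(c' i * (d' 0 * b 0 + d' 1 * b 1)) * mul_inv_cancel₀ h3
  · funext i
    rw [← mul_right_inj' h3, (key i).2]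
    simp only [Matrix.mulVec, dotProduct, Fin.sum_univ_two, Matrix.transpose_apply,
      Matrix.smul_apply, Matrix.vecMulVec_apply, smul_eq_mul]
    linear_combination -(d' i * (c' 0 * b 0 + c' 1 * b 1)) * mul_inv_cancel₀ h3

end

/-! ### Step functions and the Green kernel. -/

section

variable {q : ℝ → ℂ} {θ : ℝ} {z : ℂ}

/-- The step function with value `v` on `(a, b]`. -/
def stepFn (a b : ℝ) (v : C2) : ℝ → C2 := (Ioc a b).indicator fun _ => v

lemma memLp_stepFn (a b : ℝ) (v : C2) : MemLp (stepFn a b v) 2 volume :=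
  memLp_indicator_const 2 measurableSet_Ioc v (Or.inr measure_Ioc_lt_top.ne)

lemma support_stepFn_subset (a b : ℝ) (v : C2) : Function.support (stepFn a b v) ⊆ Ioc a b :=
  support_indicator_subset

lemma locallyIntegrable_of_memLp_two {g : ℝ → C2} (hg : MemLp g 2 volume) :
    LocallyIntegrable g volume := hg.locallyIntegrable one_le_two

/-- The matrix of the transform on step functions. -/
def stepMat (q : ℝ → ℂ) (θ : ℝ) (z : ℂ) (a b : ℝ) : Matrix (Fin 2) (Fin 2) ℂ :=
  !![∫ t in a..b, solTheta q θ z t 0, ∫ t in a..b, solTheta q θ z t 1;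
    ∫ t in a..b, solPhi q θ z t 0, ∫ t in a..b, solPhi q θ z t 1]

lemma integral_bilin_stepFn {u : ℝ → C2} (hu : Continuous u) {a b : ℝ} (hab : a ≤ b) (v : C2) :
    ∫ t, bilin (u t) (stepFn a b v t) =
      (∫ t in a..b, u t 0) * v 0 + (∫ t in a..b, u t 1) * v 1 := by
  have hi : ∀ i, IntervalIntegrable (fun t => u t i * v i) volume a b := fun i =>
    (((continuous_coord i).comp hu).mul continuous_const).intervalIntegrable _ _
  rw [← intervalIntegral.integral_mul_const, ← intervalIntegral.integral_mul_const,
    ← intervalIntegral.integral_add (hi 0) (hi 1), intervalIntegral.integral_of_le hab,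
    ← integral_indicator measurableSet_Ioc]
  refine integral_congr_ae (Eventually.of_forall fun t => ?_)
  by_cases ht : t ∈ Ioc a b <;> simp [stepFn, bilin, ht]

lemma trans_stepFn (hq : LocallyIntegrable q volume) {a b : ℝ} (hab : a ≤ b) (v : C2) :
    trans q θ z (stepFn a b v) = stepMat q θ z a b *ᵥ v.ofLp := by
  funext i
  fin_cases i
  · simp [trans, stepMat, integral_bilin_stepFn (isSolution_solTheta hq z).1.continuous hab]
    rfl
  · simp [trans, stepMat, integral_bilin_stepFn (isSolution_solPhi hq z).1.continuous hab]
    rfl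

/-- Divided by `x`, the matrix tends to the transposed fundamental matrix at `0`, whose determinant
is the Wronskian `1`. -/
lemma eventually_det_stepMat_ne_zero (hq : LocallyIntegrable q volume) :
    ∀ᶠ x in 𝓝[≠] (0 : ℝ), (stepMat q θ z 0 x).det ≠ 0 := by
  have hslope : ∀ {u : ℝ → C2} (_ : Continuous u) (i : Fin 2),
      Tendsto (fun x : ℝ => (x : ℂ)⁻¹ * ∫ t in (0 : ℝ)..x, u t i) (𝓝[≠] 0) (𝓝 (u 0 i)) := by
    intro u hu i
    have hc : Continuous fun t => u t i := (continuous_coord i).comp hu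
    have h := (intervalIntegral.integral_hasDerivAt_right (hc.intervalIntegrable 0 0)
      hc.stronglyMeasurable.stronglyMeasurableAtFilter hc.continuousAt).tendsto_slope
    refine h.congr fun x => ?_
    simp [slope_def_module, Complex.real_smul]
  have hΘ := (isSolution_solTheta (θ := θ) hq z).1.continuous
  have hΦ := (isSolution_solPhi (θ := θ) hq z).1.continuous
  have h := ((hslope hΘ 0).mul (hslope hΦ 1)).sub ((hslope hΘ 1).mul (hslope hΦ 0))
  have h1 := wronsk_solTheta_solPhi (θ := θ) hq z 0
  simp only [wronsk] at h1
  rw [h1] at h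
  filter_upwards [h.eventually_ne one_ne_zero] with x hx h0
  refine hx ?_
  rw [Matrix.det_fin_two] at h0
  simp only [stepMat, Matrix.of_apply, Matrix.cons_val', Matrix.cons_val_zero, Matrix.cons_val_one,
    Matrix.cons_val_fin_one] at h0
  linear_combination ((x : ℂ)⁻¹) ^ 2 * h0

lemma stepMat_neg (q : ℝ → ℂ) (θ : ℝ) (z : ℂ) (h : ℝ) :
    stepMat q θ z (-h) 0 = -stepMat q θ z 0 (-h) := by
  ext i j
  fin_cases i <;> fin_cases j <;> simp [stepMat, intervalIntegral.integral_symm (-h) 0]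

lemma exists_det_stepMat_ne_zero (hq : LocallyIntegrable q volume) :
    ∃ h : ℝ, 0 < h ∧ h ≤ 1 ∧ (stepMat q θ z 0 h).det ≠ 0 ∧ (stepMat q θ z (-h) 0).det ≠ 0 := by
  have h1 := eventually_det_stepMat_ne_zero (θ := θ) (z := z) hq
  have h2 : Tendsto (fun x : ℝ => -x) (𝓝[>] 0) (𝓝[≠] 0) := by
    refine tendsto_nhdsWithin_iff.2 ⟨?_, ?_⟩
    · have : Tendsto (fun x : ℝ => -x) (𝓝 0) (𝓝 (-0)) := continuous_neg.tendsto 0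
      rw [neg_zero] at this
      exact this.mono_left nhdsWithin_le_nhds
    · filter_upwards [self_mem_nhdsWithin] with x hx
      simpa using (mem_Ioi.1 hx).ne'
  have h3 : ∀ᶠ x in 𝓝[>] (0 : ℝ), (stepMat q θ z 0 x).det ≠ 0 :=
    h1.filter_mono (nhdsWithin_mono _ fun x hx => (mem_Ioi.1 hx).ne')
  obtain ⟨h, ⟨ha, hb⟩, hc, hd⟩ := ((h3.and (h2.eventually h1)).and
    (Ioc_mem_nhdsGT (zero_lt_one (α := ℝ)))).exists
  refine ⟨h, hc, hd, ha, ?_⟩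
  rw [stepMat_neg, Matrix.det_neg]
  simpa using hb

/-- Apply the resolvent to a step function on `(-h, 0]`. The coordinates to its right and left
belong to solutions square integrable at `+∞` and `-∞`, and their difference is the rotated
transform, which takes any prescribed value because the step matrix is invertible. -/
lemma exists_sum_memLp (hq : LocallyIntegrable q volume) {R : L2 →L[ℂ] L2}
    (hR : IsResolventAt (hamOp q) z R) (w : Fin 2 → ℂ) :
    ∃ c d, MemLp (solComb q θ z c) 2 (volume.restrict (Ici 0)) ∧
      MemLp (solComb q θ z d) 2 (volume.restrict (Iic 0)) ∧ c - d = w := by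
  obtain ⟨h, h0, -, -, hdet⟩ := exists_det_stepMat_ne_zero (θ := θ) (z := z) hq
  have hinv : IsUnit (stepMat q θ z (-h) 0).det := isUnit_iff_ne_zero.2 hdet
  set v : C2 := WithLp.toLp 2 ((stepMat q θ z (-h) 0)⁻¹ *ᵥ ![-w 1, w 0]) with hv
  have hg := memLp_stepFn (-h) 0 v
  have hgl := locallyIntegrable_of_memLp_two hg
  have hs := support_stepFn_subset (-h) 0 v
  obtain ⟨ψ, hψ, -⟩ := hR.exists_isL2Solution hg
  refine ⟨coords q θ z ψ 0, coords q θ z ψ (-h), hψ.memLp_right hq hgl hs,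
    hψ.memLp_left hq hgl hs, ?_⟩
  rw [hψ.coords_jump hq hgl hs, trans_stepFn hq (by linarith), hv, Matrix.mulVec_mulVec,
    Matrix.mul_nonsing_inv _ hinv, Matrix.one_mulVec]
  funext i
  fin_cases i <;> simp

/-- The values of the coordinates to the right and to the left of the support of `g`. -/
lemma IsL2Solution.coords_eq_weylGamma_mulVec {g ψ : ℝ → C2} (h : IsL2Solution q z g ψ)
    (hq : LocallyIntegrable q volume) (hz : z ∉ spec (hamOp q))
    (hg : LocallyIntegrable g volume) {a b : ℝ} (hs : Function.support g ⊆ Ioc a b) :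
    coords q θ z ψ b = weylGamma q θ z *ᵥ trans q θ z g ∧
      coords q θ z ψ a = (weylGamma q θ z)ᵀ *ᵥ trans q θ z g := by
  obtain ⟨R, hR⟩ := not_not.1 hz
  exact weylGamma_mulVec hq (exists_isWeylPair hq (exists_sum_memLp hq hR))
    (h.memLp_right hq hg hs) (h.memLp_left hq hg hs) (h.coords_jump hq hg hs)

lemma inner_toLp_eq (hq : LocallyIntegrable q volume) {f ψ : ℝ → C2} (hf : MemLp f 2 volume)
    {u : L2} (hu : u =ᵐ[volume] ψ) :
    inner ℂ (hf.toLp f) u =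
      ∫ x, (coords q θ z ψ x 0 * bilin (solTheta q θ z x) (conjFn f x) +
        coords q θ z ψ x 1 * bilin (solPhi q θ z x) (conjFn f x)) := by
  rw [L2.inner_def]
  refine integral_congr_ae ?_
  filter_upwards [hf.coeFn_toLp, hu] with x h1 h2
  rw [h1, h2]
  nth_rw 1 [← solComb_coords (θ := θ) (z := z) hq ψ x]
  simp only [PiLp.inner_apply, Fin.sum_univ_two, RCLike.inner_apply, bilin, conjFn, solComb,
    PiLp.add_apply, PiLp.smul_apply, smul_eq_mul, RCLike.star_def]
  ring

lemma resolventOp_spec {A : L2 →ₗ.[ℂ] L2} (hz : z ∉ spec A) :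
    IsResolventAt A z (resolventOp A z) := by
  have h : ∃ R : L2 →L[ℂ] L2, IsResolventAt A z R := not_not.1 hz
  rw [resolventOp, dif_pos h]
  exact h.choose_spec

lemma locallyIntegrable_conjFn {f : ℝ → C2} (hf : LocallyIntegrable f volume) :
    LocallyIntegrable (conjFn f) volume := by
  have hc : Continuous fun v : C2 => (WithLp.toLp 2 fun i => star (v i) : C2) :=
    (PiLp.continuous_toLp 2 _).comp (continuous_pi fun i => (continuous_coord i).star)
  intro x
  obtain ⟨s, hs, hi⟩ := hf x
  refine ⟨s, hs, Integrable.mono hi (hc.comp_aestronglyMeasurable hi.aestronglyMeasurable) ?_⟩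
  refine Eventually.of_forall fun y => le_of_eq ?_
  simp [conjFn, EuclideanSpace.norm_eq]

lemma support_conjFn_subset {f : ℝ → C2} {s : Set ℝ} (hs : Function.support f ⊆ s) :
    Function.support (conjFn f) ⊆ s := by
  intro x hx
  refine hs fun h0 => hx ?_
  ext i
  simp [conjFn, h0]

lemma integrable_of_support_subset {h : ℝ → ℂ} (hh : LocallyIntegrable h volume) {a b : ℝ}
    (hs : Function.support h ⊆ Ioc a b) : Integrable h volume :=
  (integrableOn_iff_integrable_of_support_subset hs).1
    ((hh.integrableOn_isCompact isCompact_Icc).mono_set Ioc_subset_Icc_self)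

/-- The resolvent between functions with ordered supports. -/
lemma inner_resolventOp_of_ordered (hq : LocallyIntegrable q volume) (hz : z ∉ spec (hamOp q))
    {f g : ℝ → C2} (hf : MemLp f 2 volume) (hg : MemLp g 2 volume) {a b c : ℝ}
    (hfs : Function.support f ⊆ Ioc b c) (hgs : Function.support g ⊆ Ioc a b) :
    inner ℂ (hf.toLp f) (resolventOp (hamOp q) z (hg.toLp g)) =
      trans q θ z (conjFn f) ⬝ᵥ weylGamma q θ z *ᵥ trans q θ z g := by
  have hgl := locallyIntegrable_of_memLp_two hg
  have hfl := locallyIntegrable_conjFn (locallyIntegrable_of_memLp_two hf)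
  have hfs' := support_conjFn_subset hfs
  obtain ⟨ψ, hψ, hu⟩ := (resolventOp_spec hz).exists_isL2Solution hg
  rw [inner_toLp_eq (θ := θ) (z := z) hq hf hu]
  have hC := (hψ.coords_eq_weylGamma_mulVec (θ := θ) hq hz hgl hgs).1
  have hi : ∀ {u : ℝ → C2}, Continuous u → Integrable (fun x => bilin (u x) (conjFn f x)) volume :=
    fun hu => integrable_of_support_subset (locallyIntegrable_bilin hu hfl)
      (support_bilin_subset hfs')
  have hΘ := hi (isSolution_solTheta (θ := θ) hq z).1.continuous
  have hΦ := hi (isSolution_solPhi (θ := θ) hq z).1.continuous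
  rw [← hC]
  calc _ = ∫ x, (coords q θ z ψ b 0 * bilin (solTheta q θ z x) (conjFn f x) +
        coords q θ z ψ b 1 * bilin (solPhi q θ z x) (conjFn f x)) := by
        refine integral_congr_ae (Eventually.of_forall fun x => ?_)
        by_cases hx : x ∈ Ioc b c
        · simp only
          rw [hψ.coords_eq (x := b) (y := x) hq hgl fun t ht => ?_]
          rw [uIoc_of_le hx.1.le] at ht
          by_contra h0
          exact absurd (hgs h0).2 (not_le.2 ht.1)
        · have h0 : conjFn f x = 0 := by
            by_contra h0
            exact hx (hfs' h0)
          simp [bilin, h0]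
    _ = _ := by
        rw [integral_add (hΘ.const_mul _) (hΦ.const_mul _), integral_const_mul, integral_const_mul]
        simp [trans, dotProduct, Fin.sum_univ_two, mul_comm]

/-- The part of the Green kernel which does not involve the Weyl matrix. -/
def greenRest (q : ℝ → ℂ) (θ : ℝ) (a b : ℝ) (f g : ℝ → C2) (z : ℂ) : ℂ :=
  ∫ x in a..b,
    (((∫ t in a..x, bilin (solPhi q θ z t) (g t)) - ∫ t in x..b, bilin (solPhi q θ z t) (g t)) *
        bilin (solTheta q θ z x) (conjFn f x) -
      ((∫ t in a..x, bilin (solTheta q θ z t) (g t)) -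
        ∫ t in x..b, bilin (solTheta q θ z t) (g t)) * bilin (solPhi q θ z x) (conjFn f x)) / 2

/-- The resolvent in terms of the Weyl matrix. -/
lemma inner_resolventOp (hq : LocallyIntegrable q volume) (hz : z ∉ spec (hamOp q))
    {f g : ℝ → C2} (hf : MemLp f 2 volume) (hg : MemLp g 2 volume) {a b : ℝ}
    (hfs : Function.support f ⊆ Ioc a b) (hgs : Function.support g ⊆ Ioc a b) :
    inner ℂ (hf.toLp f) (resolventOp (hamOp q) z (hg.toLp g)) =
      trans q θ z (conjFn f) ⬝ᵥ weylM q θ z *ᵥ trans q θ z g + greenRest q θ a b f g z := by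
  have hgl := locallyIntegrable_of_memLp_two hg
  have hfl := locallyIntegrable_conjFn (locallyIntegrable_of_memLp_two hf)
  have hfs' := support_conjFn_subset hfs
  obtain ⟨ψ, hψ, hu⟩ := (resolventOp_spec hz).exists_isL2Solution hg
  rw [inner_toLp_eq (θ := θ) (z := z) hq hf hu]
  obtain ⟨hCb, hCa⟩ := hψ.coords_eq_weylGamma_mulVec (θ := θ) hq hz hgl hgs
  set c : Fin 2 → ℂ := weylM q θ z *ᵥ trans q θ z g with hc
  -- The symmetrised matrix appears because the coordinates at `x` are written as the mean of their
  -- values at the two ends, `Γ̃ᵀ` and `Γ̃` applied to the transform, plus half the difference of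
  -- the two partial integrals. The latter part is entered in `greenRest`.
  have hcc : ∀ i, 2 * c i = coords q θ z ψ a i + coords q θ z ψ b i := by
    intro i
    rw [hc, hCa, hCb, weylM, Matrix.smul_mulVec, Matrix.add_mulVec]
    simp only [Pi.smul_apply, Pi.add_apply, smul_eq_mul]
    ring
  have hcΘ := (isSolution_solTheta (θ := θ) hq z).1.continuous
  have hcΦ := (isSolution_solPhi (θ := θ) hq z).1.continuous
  have hlΘ := locallyIntegrable_bilin hcΘ hfl
  have hlΦ := locallyIntegrable_bilin hcΦ hfl
  have hΘ := integrable_of_support_subset hlΘ (support_bilin_subset hfs')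
  have hΦ := integrable_of_support_subset hlΦ (support_bilin_subset hfs')
  have hgΘ := locallyIntegrable_bilin hcΘ hgl
  have hgΦ := locallyIntegrable_bilin hcΦ hgl
  have hk : ∀ {φ : ℝ → ℂ}, LocallyIntegrable φ volume →
      Continuous fun x => (∫ t in a..x, φ t) - ∫ t in x..b, φ t := by
    intro φ hφ
    have hi := intervalIntegrable_of_locallyIntegrable hφ
    refine (intervalIntegral.continuous_primitive hi a).sub ?_
    simp only [fun x => intervalIntegral.integral_symm (μ := volume) (f := φ) b x]
    exact (intervalIntegral.continuous_primitive hi b).neg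
  set k : ℝ → ℂ := fun x =>
    (((∫ t in a..x, bilin (solPhi q θ z t) (g t)) - ∫ t in x..b, bilin (solPhi q θ z t) (g t)) *
        bilin (solTheta q θ z x) (conjFn f x) -
      ((∫ t in a..x, bilin (solTheta q θ z t) (g t)) -
        ∫ t in x..b, bilin (solTheta q θ z t) (g t)) * bilin (solPhi q θ z x) (conjFn f x)) / 2
    with hkdef
  have hks : Function.support k ⊆ Ioc a b := by
    intro x hx
    refine hfs' fun h0 => hx ?_
    simp [hkdef, bilin, h0]
  have hki : Integrable k volume := by
    refine integrable_of_support_subset ?_ hks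
    have := ((locallyIntegrable_continuous_mul (hk hgΦ) hlΘ).sub
      (locallyIntegrable_continuous_mul (hk hgΘ) hlΦ)).smul (1 / 2 : ℂ)
    refine this.congr (Eventually.of_forall fun x => ?_)
    simp only [hkdef, Pi.smul_apply, Pi.sub_apply, smul_eq_mul]
    ring
  have hsum : Integrable (fun x => c 0 * bilin (solTheta q θ z x) (conjFn f x) +
      c 1 * bilin (solPhi q θ z x) (conjFn f x)) volume :=
    (hΘ.const_mul _).add (hΦ.const_mul _)
  calc _ = ∫ x, ((c 0 * bilin (solTheta q θ z x) (conjFn f x) +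
        c 1 * bilin (solPhi q θ z x) (conjFn f x)) + k x) := by
        refine integral_congr_ae (Eventually.of_forall fun x => ?_)
        obtain ⟨e0, e1⟩ := hψ.coords_sub (θ := θ) hq hgl a x
        obtain ⟨e2, e3⟩ := hψ.coords_sub (θ := θ) hq hgl x b
        simp only [hkdef]
        rw [← e0, ← e2]
        linear_combination (bilin (solTheta q θ z x) (conjFn f x) / 2) * -(hcc 0) +
          (bilin (solPhi q θ z x) (conjFn f x) / 2) * (-(hcc 1) + e1 - e3)
    _ = _ := by
        rw [integral_add hsum hki,
          integral_add (hΘ.const_mul _) (hΦ.const_mul _), integral_const_mul, integral_const_mul,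
          greenRest, intervalIntegral.integral_eq_integral_of_support_subset hks]
        simp [trans, dotProduct, Fin.sum_univ_two, mul_comm]

end

/-! ### Analyticity of the resolvent and the Weyl matrix; conjugation symmetry. -/

section

open scoped ComplexConjugate

variable {q : ℝ → ℂ} {θ : ℝ} {z : ℂ}

lemma IsResolventAt.eq {A : L2 →ₗ.[ℂ] L2} {R R' : L2 →L[ℂ] L2} (hR : IsResolventAt A z R)
    (hR' : IsResolventAt A z R') : R = R' := by
  ext1 g
  obtain ⟨h, he⟩ := hR'.1 g
  have := hR.2 ⟨R' g, h⟩
  rwa [he] at this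

/-- The Neumann series for the resolvent. -/
lemma IsResolventAt.neumann {A : L2 →ₗ.[ℂ] L2} {z₀ : ℂ} {R : L2 →L[ℂ] L2}
    (hR : IsResolventAt A z₀ R) (hu : IsUnit (1 - (0 + (z - z₀) • R))) :
    IsResolventAt A z (R * Ring.inverse (1 - (0 + (z - z₀) • R))) := by
  set S := Ring.inverse (1 - (0 + (z - z₀) • R)) with hS
  have h1 : ∀ y, S y - (z - z₀) • R (S y) = y := fun y => by
    have := congrArg (fun T : L2 →L[ℂ] L2 => T y) (Ring.mul_inverse_cancel _ hu)
    rw [← hS] at this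
    simpa [sub_mul] using this
  have h2 : ∀ y, S (y - (z - z₀) • R y) = y := fun y => by
    have := congrArg (fun T : L2 →L[ℂ] L2 => T y) (Ring.inverse_mul_cancel _ hu)
    rw [← hS] at this
    simpa [mul_sub] using this
  constructor
  · intro g
    obtain ⟨h, he⟩ := hR.1 (S g)
    refine ⟨h, ?_⟩
    have h3 := h1 g
    rw [sub_smul] at h3
    have e : A ⟨R (S g), h⟩ = S g + z₀ • R (S g) := sub_eq_iff_eq_add.1 he
    change A ⟨R (S g), h⟩ - z • R (S g) = g
    refine Eq.trans ?_ h3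
    rw [e]
    abel
  · intro u
    have he := hR.2 u
    have h3 := h2 (A u - z₀ • (u : L2))
    rw [he] at h3
    rw [mul_apply_eq_comp, show A u - z • (u : L2) = A u - z₀ • (u : L2) - (z - z₀) • (u : L2) by
      rw [sub_smul]; abel, h3, he]

/-- Near `z₀` the Neumann series gives a resolvent depending differentiably on `z`; uniqueness
identifies it with the chosen one. -/
lemma differentiableAt_resolventOp {A : L2 →ₗ.[ℂ] L2} {z₀ : ℂ} (hz : z₀ ∉ spec A) :
    (∀ᶠ z in 𝓝 z₀, z ∉ spec A) ∧ DifferentiableAt ℂ (resolventOp A) z₀ := by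
  have hR := resolventOp_spec hz
  set R := resolventOp A z₀ with hRdef
  have hlim : Tendsto (fun z : ℂ => ‖0 + (z - z₀) • R‖) (𝓝 z₀) (𝓝 0) := by
    have : Continuous fun z : ℂ => ‖0 + (z - z₀) • R‖ := by fun_prop
    simpa using this.tendsto z₀
  have hunit : ∀ᶠ z in 𝓝 z₀, IsUnit (1 - (0 + (z - z₀) • R)) := by
    filter_upwards [hlim.eventually (gt_mem_nhds one_pos)] with z hz
    exact isUnit_one_sub_of_norm_lt_one (x := 0 + (z - z₀) • R) hz
  refine ⟨hunit.mono fun z hu => not_not.2 ⟨_, hR.neumann hu⟩, ?_⟩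
  have h1 : IsUnit (1 - (0 + (z₀ - z₀) • R)) := by simp
  have h2 : DifferentiableAt ℂ (fun z => R * Ring.inverse (1 - (0 + (z - z₀) • R))) z₀ := by
    refine (differentiableAt_const R).mul ?_
    exact (differentiableAt_inverse h1).comp z₀ (f := fun z : ℂ => 1 - (0 + (z - z₀) • R))
      (by fun_prop)
  refine h2.congr_of_eventuallyEq ?_
  filter_upwards [hunit] with z hu
  have h3 := hR.neumann hu
  exact (resolventOp_spec (not_not.2 ⟨_, h3⟩)).eq h3

lemma differentiableAt_inner_resolventOp {A : L2 →ₗ.[ℂ] L2} {z₀ : ℂ} (hz : z₀ ∉ spec A)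
    (f g : L2) : DifferentiableAt ℂ (fun z => inner ℂ f (resolventOp A z g)) z₀ :=
  (innerSL ℂ f).differentiableAt.comp z₀
    ((differentiableAt_resolventOp hz).2.clm_apply (differentiableAt_const g))

lemma trans_eq_integral {g : ℝ → C2} {N : ℕ} (hs : Function.support g ⊆ Ioc (-(N : ℝ)) N) :
    trans q θ z g = ![∫ t in (-(N : ℝ))..N, bilin (solTheta q θ z t) (g t),
      ∫ t in (-(N : ℝ))..N, bilin (solPhi q θ z t) (g t)] := by
  rw [intervalIntegral.integral_eq_integral_of_support_subset (support_bilin_subset hs),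
    intervalIntegral.integral_eq_integral_of_support_subset (support_bilin_subset hs)]
  rfl

lemma differentiable_trans (hq : LocallyIntegrable q volume) {g : ℝ → C2}
    (hg : LocallyIntegrable g volume) {N : ℕ} (hs : Function.support g ⊆ Ioc (-(N : ℝ)) N)
    (i : Fin 2) : Differentiable ℂ fun z => trans q θ z g i := by
  simp only [trans_eq_integral hs]
  fin_cases i
  · exact differentiable_integral_bilin_ivpSol hq _ hg N
  · exact differentiable_integral_bilin_ivpSol hq _ hg N

lemma stepMat_apply_eq_trans (hq : LocallyIntegrable q volume) {a b : ℝ} (hab : a ≤ b)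
    (i j : Fin 2) :
    stepMat q θ z a b i j = trans q θ z (stepFn a b (EuclideanSpace.single j 1)) i := by
  rw [trans_stepFn hq hab]
  simp

lemma conjFn_stepFn_single (a b : ℝ) (j : Fin 2) :
    conjFn (stepFn a b (EuclideanSpace.single j 1)) = stepFn a b (EuclideanSpace.single j 1) := by
  ext x i
  by_cases hx : x ∈ Ioc a b
  · by_cases hij : i = j <;> simp [conjFn, stepFn, hx, hij]
  · simp [conjFn, stepFn, hx]

/-- Between step functions on `(-h, 0]` and `(0, h]` the supports are ordered, so the matrix of
resolvent elements is exactly `Aᵀ Γ̃ B`, where `A` and `B` have entire entries and are invertible at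
`z₀`. Solving for `Γ̃` by adjugates expresses it through differentiable functions; the arbitrary
choice of Weyl pair at each `z` plays no role. -/
lemma differentiableAt_weylGamma (hq : LocallyIntegrable q volume) {z₀ : ℂ}
    (hz : z₀ ∉ spec (hamOp q)) (k l : Fin 2) :
    DifferentiableAt ℂ (fun z => weylGamma q θ z k l) z₀ := by
  obtain ⟨h, h0, h1, hA, hB⟩ := exists_det_stepMat_ne_zero (θ := θ) (z := z₀) hq
  set f : Fin 2 → ℝ → C2 := fun j => stepFn 0 h (EuclideanSpace.single j 1) with hf
  set g : Fin 2 → ℝ → C2 := fun j => stepFn (-h) 0 (EuclideanSpace.single j 1) with hg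
  have hfL : ∀ j, MemLp (f j) 2 volume := fun j => memLp_stepFn _ _ _
  have hgL : ∀ j, MemLp (g j) 2 volume := fun j => memLp_stepFn _ _ _
  set A : ℂ → Matrix (Fin 2) (Fin 2) ℂ := fun z => stepMat q θ z 0 h with hAdef
  set B : ℂ → Matrix (Fin 2) (Fin 2) ℂ := fun z => stepMat q θ z (-h) 0 with hBdef
  set r : ℂ → Matrix (Fin 2) (Fin 2) ℂ := fun z => Matrix.of fun i j =>
    inner ℂ ((hfL i).toLp (f i)) (resolventOp (hamOp q) z ((hgL j).toLp (g j))) with hr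
  have hsub : ∀ {a b : ℝ} (v : C2), -1 ≤ a → b ≤ 1 →
      Function.support (stepFn a b v) ⊆ Ioc (-((1 : ℕ) : ℝ)) (1 : ℕ) := fun v ha hb =>
    (support_stepFn_subset _ _ _).trans (Ioc_subset_Ioc (by simpa using ha) (by simpa using hb))
  have hAd : ∀ i j, DifferentiableAt ℂ (fun z => A z i j) z₀ := fun i j => by
    simp only [hAdef, stepMat_apply_eq_trans hq h0.le]
    exact differentiable_trans hq (locallyIntegrable_of_memLp_two (hfL j))
      (hsub _ (by linarith) h1) i z₀
  have hBd : ∀ i j, DifferentiableAt ℂ (fun z => B z i j) z₀ := fun i j => by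
    simp only [hBdef, stepMat_apply_eq_trans hq (neg_nonpos.2 h0.le)]
    exact differentiable_trans hq (locallyIntegrable_of_memLp_two (hgL j))
      (hsub _ (by linarith) (by linarith)) i z₀
  have hrd : ∀ i j, DifferentiableAt ℂ (fun z => r z i j) z₀ := fun i j =>
    differentiableAt_inner_resolventOp hz _ _
  have hrel : ∀ z, z ∉ spec (hamOp q) → r z = (A z)ᵀ * weylGamma q θ z * B z := by
    intro z hz
    ext i j
    simp only [hr, Matrix.of_apply]
    rw [inner_resolventOp_of_ordered (θ := θ) hq hz (hfL i) (hgL j) (support_stepFn_subset _ _ _)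
      (support_stepFn_subset _ _ _), conjFn_stepFn_single, trans_stepFn hq h0.le,
      trans_stepFn hq (by linarith)]
    simp only [hAdef, hBdef, Matrix.mul_apply, Matrix.mulVec, dotProduct, Fin.sum_univ_two,
      Matrix.transpose_apply]
    fin_cases i <;> fin_cases j <;> simp <;> ring
  have hdet : ∀ {T : ℂ → Matrix (Fin 2) (Fin 2) ℂ},
      (∀ i j, DifferentiableAt ℂ (fun z => T z i j) z₀) →
      DifferentiableAt ℂ (fun z => (T z).det) z₀ := fun hT => by
    simp only [Matrix.det_fin_two]
    exact ((hT 0 0).mul (hT 1 1)).sub ((hT 0 1).mul (hT 1 0))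
  have hform : ∀ᶠ z in 𝓝 z₀, weylGamma q θ z k l = ((A z).det)⁻¹ * ((B z).det)⁻¹ *
      (((A z).adjugate)ᵀ * r z * (B z).adjugate) k l := by
    filter_upwards [(differentiableAt_resolventOp hz).1,
      (hdet hAd).continuousAt.eventually_ne hA, (hdet hBd).continuousAt.eventually_ne hB]
      with z h1 h2 h3
    have : ((A z).adjugate)ᵀ * r z * (B z).adjugate =
        ((A z).det * (B z).det) • weylGamma q θ z := by
      rw [hrel z h1]
      have e1 : ((A z).adjugate)ᵀ * (A z)ᵀ = (A z).det • (1 : Matrix (Fin 2) (Fin 2) ℂ) := by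
        rw [← Matrix.transpose_mul, Matrix.mul_adjugate]
        simp
      calc _ = (((A z).adjugate)ᵀ * (A z)ᵀ) * weylGamma q θ z * (B z * (B z).adjugate) := by
            simp only [Matrix.mul_assoc]
        _ = _ := by
            rw [e1, Matrix.mul_adjugate]
            simp [smul_smul, mul_comm]
    rw [this, Matrix.smul_apply, smul_eq_mul]
    field_simp
  have hadj : ∀ {T : ℂ → Matrix (Fin 2) (Fin 2) ℂ},
      (∀ i j, DifferentiableAt ℂ (fun z => T z i j) z₀) →
      ∀ i j, DifferentiableAt ℂ (fun z => (T z).adjugate i j) z₀ := fun hT i j => by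
    simp only [Matrix.adjugate_fin_two]
    fin_cases i <;> fin_cases j
    exacts [hT 1 1, (hT 0 1).neg, (hT 1 0).neg, hT 0 0]
  have hmul : ∀ {S T : ℂ → Matrix (Fin 2) (Fin 2) ℂ},
      (∀ i j, DifferentiableAt ℂ (fun z => S z i j) z₀) →
      (∀ i j, DifferentiableAt ℂ (fun z => T z i j) z₀) →
      ∀ i j, DifferentiableAt ℂ (fun z => (S z * T z) i j) z₀ := fun hS hT i j => by
    simp only [Matrix.mul_apply]
    exact DifferentiableAt.fun_sum fun m _ => (hS i m).mul (hT m j)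
  refine DifferentiableAt.congr_of_eventuallyEq ?_ hform
  exact (((hdet hAd).inv hA).mul ((hdet hBd).inv hB)).mul
    (hmul (hmul (fun i j => hadj hAd j i) hrd) (hadj hBd) k l)

lemma differentiableAt_weylM (hq : LocallyIntegrable q volume) {z₀ : ℂ}
    (hz : z₀ ∉ spec (hamOp q)) (k l : Fin 2) :
    DifferentiableAt ℂ (fun z => weylM q θ z k l) z₀ := by
  simp only [weylM, Matrix.smul_apply, Matrix.add_apply, Matrix.transpose_apply, smul_eq_mul]
  exact ((differentiableAt_weylGamma hq hz k l).add
    (differentiableAt_weylGamma hq hz l k)).const_mul _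

lemma weylGamma_eq_of_isWeylPair (hq : LocallyIntegrable q volume)
    {p : (Fin 2 → ℂ) × (Fin 2 → ℂ)} (hp : IsWeylPair q θ z p) :
    weylGamma q θ z = (det2 p.1 p.2)⁻¹ • Matrix.vecMulVec p.1 p.2 := by
  have hex : ∃ p, IsWeylPair q θ z p := ⟨p, hp⟩
  rw [weylGamma, dif_pos hex]
  obtain ⟨h1, h2, h3⟩ := hex.choose_spec
  set c' := hex.choose.1
  set d' := hex.choose.2
  obtain ⟨c, d⟩ := p
  have e1 := det2_eq_zero_of_memLp hq Real.volume_Ici h1 hp.1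
  have e2 := det2_eq_zero_of_memLp hq Real.volume_Iic h2 hp.2.1
  have h4 : det2 c d ≠ 0 := hp.2.2
  simp only [det2] at e1 e2 h4 ⊢
  have key : ∀ i j : Fin 2, c' i * d' j * (c 0 * d 1 - c 1 * d 0) =
      c i * d j * (c' 0 * d' 1 - c' 1 * d' 0) := by
    have f1 : ∀ i j : Fin 2, c' i * c j = c' j * c i := by
      refine Fin.forall_fin_two.2 ⟨Fin.forall_fin_two.2 ⟨rfl, ?_⟩, Fin.forall_fin_two.2 ⟨?_, rfl⟩⟩
      exacts [by linear_combination e1, by linear_combination -e1]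
    have f2 : ∀ i j : Fin 2, d' i * d j = d' j * d i := by
      refine Fin.forall_fin_two.2 ⟨Fin.forall_fin_two.2 ⟨rfl, ?_⟩, Fin.forall_fin_two.2 ⟨?_, rfl⟩⟩
      exacts [by linear_combination e2, by linear_combination -e2]
    intro i j
    linear_combination (d' j * d 1) * f1 i 0 + (c' 0 * c i) * f2 j 1 - (d' j * d 0) * f1 i 1 -
      (c' 1 * c i) * f2 j 0
  ext i j
  simp only [Matrix.smul_apply, Matrix.vecMulVec_apply, smul_eq_mul]
  rw [inv_mul_eq_div, inv_mul_eq_div, div_eq_div_iff h3 h4]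
  exact key i j

/-- The antiunitary symmetry `v ↦ σ₄ v̄`. -/
def rotConj (v : C2) : C2 := WithLp.toLp 2 ![conj (v 1), -conj (v 0)]

lemma norm_rotConj (v : C2) : ‖rotConj v‖ = ‖v‖ := by
  simp [rotConj, EuclideanSpace.norm_eq, Fin.sum_univ_two, add_comm]

/-- `rotConj` as a real continuous linear map. -/
def rotConjL : C2 →L[ℝ] C2 :=
  LinearMap.mkContinuous
    { toFun := rotConj
      map_add' := fun v w => by apply C2_ext <;> simp [rotConj]; ring
      map_smul' := fun c v => by apply C2_ext <;> simp [rotConj] } 1 fun v => by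
        rw [one_mul]; exact (norm_rotConj v).le

/-- `B̃` is `i` times a real symmetric matrix of trace zero, so conjugation changes its sign, and so
does moving it past `σ₄`; the two signs cancel. -/
lemma rotConj_coef (q : ℝ → ℂ) (z : ℂ) (t : ℝ) (v : C2) :
    rotConj (coef q z t v) = coef q (conj z) t (rotConj v) := by
  apply C2_ext <;>
    simp [coef_apply, coefPotential_apply, rotConj, act_apply_zero, act_apply_one, sigma4,
      potential]
  ring

lemma IsSolution.rotConj (hq : LocallyIntegrable q volume) {ψ : ℝ → C2} (hψ : IsSolution q z ψ) :
    IsSolution q (conj z) fun x => rotConj (ψ x) := by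
  obtain ⟨hc, h⟩ := (isSolution_iff hq).1 hψ
  refine (isSolution_iff hq).2 ⟨rotConjL.continuous.comp hc, fun x => ?_⟩
  simp only [← rotConj_coef]
  have h1 := congrArg rotConjL (h x)
  rw [map_add, ← ContinuousLinearMap.intervalIntegral_comp_comm _
    (intervalIntegrable_of_locallyIntegrable
      (locallyIntegrable_clm_apply (locallyIntegrable_coef hq z) hc) _ _)] at h1
  exact h1

lemma rotConj_solTheta (hq : LocallyIntegrable q volume) (x : ℝ) :
    rotConj (solTheta q θ z x) = -solPhi q θ (conj z) x := by
  have h : (fun x => -rotConj (solTheta q θ z x)) = solPhi q θ (conj z) := by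
    refine IsSolution.ext (z := conj z) hq ?_ (isSolution_solPhi hq _) ?_
    · obtain ⟨hc, h⟩ := (isSolution_iff hq).1 ((isSolution_solTheta (θ := θ) hq z).rotConj hq)
      refine (isSolution_iff hq).2 ⟨hc.neg, fun x => ?_⟩
      simp only [map_neg, intervalIntegral.integral_neg]
      rw [h x]
      abel
    · rw [solTheta_zero hq, solPhi_zero hq]
      apply C2_ext <;> simp [rotConj, -Complex.ofReal_cos, -Complex.ofReal_sin]
  rw [← h, neg_neg]

lemma rotConj_solPhi (hq : LocallyIntegrable q volume) (x : ℝ) :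
    rotConj (solPhi q θ z x) = solTheta q θ (conj z) x := by
  have h : (fun x => rotConj (solPhi q θ z x)) = solTheta q θ (conj z) := by
    refine IsSolution.ext (z := conj z) hq ((isSolution_solPhi hq z).rotConj hq)
      (isSolution_solTheta hq _) ?_
    rw [solTheta_zero hq, solPhi_zero hq]
    apply C2_ext <;> simp [rotConj, -Complex.ofReal_cos, -Complex.ofReal_sin]
  rw [← h]

lemma rotConj_solComb (hq : LocallyIntegrable q volume) (c : Fin 2 → ℂ) (x : ℝ) :
    rotConj (solComb q θ z c x) = solComb q θ (conj z) ![conj (c 1), -conj (c 0)] x := by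
  have h1 := rotConj_solTheta (θ := θ) (z := z) hq x
  have h2 := rotConj_solPhi (θ := θ) (z := z) hq x
  simp only [solComb, Matrix.cons_val_zero, Matrix.cons_val_one]
  rw [← h2, neg_smul, ← smul_neg, ← h1]
  apply C2_ext <;> simp [rotConj]; ring

/-- The growth bound is given only above the axis. The map `ψ ↦ σ₄ ψ̄` preserves norms and sends
Weyl solutions at `z` to Weyl solutions at `z̄`, with coordinates `(c̄₁, -c̄₀)`. Hence `M̃(z̄)` is,
up to signs, the conjugate of `M̃(z)` with both indices flipped, and the bound holds below the axis
too. -/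
lemma weylM_conj (hq : LocallyIntegrable q volume) (hex : ∃ p, IsWeylPair q θ z p) (j k : Fin 2) :
    ∃ j' k', ‖weylM q θ (conj z) j k‖ = ‖weylM q θ z j' k'‖ := by
  obtain ⟨⟨c, d⟩, hp⟩ := hex
  have hmem : ∀ {c : Fin 2 → ℂ} {s : Set ℝ},
      MemLp (solComb q θ z c) 2 (volume.restrict s) →
      MemLp (solComb q θ (conj z) ![conj (c 1), -conj (c 0)]) 2 (volume.restrict s) := by
    intro c s hc
    refine hc.of_le (continuous_solComb hq _).aestronglyMeasurable
      (Eventually.of_forall fun x => ?_)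
    rw [← rotConj_solComb hq, norm_rotConj]
  have hp' : IsWeylPair q θ (conj z)
      (![conj (c 1), -conj (c 0)], ![conj (d 1), -conj (d 0)]) := by
    refine ⟨hmem hp.1, hmem hp.2.1, ?_⟩
    have h3 := hp.2.2
    simp only [Matrix.cons_val_zero, Matrix.cons_val_one] at h3 ⊢
    intro h0
    refine h3 ((map_eq_zero (starRingEnd ℂ)).1 ?_)
    simp only [map_sub, map_mul]
    linear_combination h0
  have e1 := weylGamma_eq_of_isWeylPair hq hp
  have e2 := weylGamma_eq_of_isWeylPair hq hp'
  have hdet : det2 ![conj (c 1), -conj (c 0)] ![conj (d 1), -conj (d 0)] = conj (det2 c d) := by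
    simp [det2]; ring
  have hconj : conj (2 : ℂ) = 2 := map_ofNat _ 2
  have hnorm : ∀ {u w : ℂ}, u = conj w → ‖u‖ = ‖w‖ := fun h => by rw [h, RCLike.norm_conj]
  have hnorm' : ∀ {u w : ℂ}, u = -conj w → ‖u‖ = ‖w‖ := fun h => by
    rw [h, norm_neg, RCLike.norm_conj]
  simp only [weylM, e1, e2, hdet]
  fin_cases j <;> fin_cases k
  · exact ⟨1, 1, hnorm (by simp [Matrix.vecMulVec_apply, hconj]; exact Or.inl (mul_comm _ _))⟩
  · exact ⟨1, 0, hnorm' (by simp [Matrix.vecMulVec_apply, hconj]; ring)⟩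
  · exact ⟨0, 1, hnorm' (by simp [Matrix.vecMulVec_apply, hconj]; ring)⟩
  · exact ⟨0, 0, hnorm (by simp [Matrix.vecMulVec_apply, hconj]; exact Or.inl (mul_comm _ _))⟩

end

/-! ### Continuity of the remainder and the form of the transform. -/

section

open scoped ComplexConjugate

variable {q : ℝ → ℂ} {θ : ℝ} {z : ℂ}

lemma continuous_conjFn {f : ℝ → C2} (hf : Continuous f) : Continuous (conjFn f) :=
  (PiLp.continuous_toLp 2 _).comp
    (continuous_pi fun i => ((continuous_coord i).comp hf).star)

lemma continuous_bilin {X : Type*} [TopologicalSpace X] {u w : X → C2} (hu : Continuous u)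
    (hw : Continuous w) : Continuous fun x => bilin (u x) (w x) :=
  (((continuous_coord 0).comp hu).mul ((continuous_coord 0).comp hw)).add
    (((continuous_coord 1).comp hu).mul ((continuous_coord 1).comp hw))

lemma continuous_integral_sub_integral {X : Type*} [TopologicalSpace X] {k : X × ℝ → ℂ}
    (hk : Continuous k) (a b : ℝ) :
    Continuous fun p : X × ℝ => (∫ t in a..p.2, k (p.1, t)) - ∫ t in p.2..b, k (p.1, t) := by
  have h : ∀ c : ℝ, Continuous fun p : X × ℝ => ∫ t in c..p.2, k (p.1, t) := fun c =>
    intervalIntegral.continuous_parametric_intervalIntegral_of_continuous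
      (f := fun (p : X × ℝ) t => k (p.1, t)) (by unfold Function.uncurry; fun_prop) continuous_snd
  refine ((h a).add (h b)).congr fun p => ?_
  rw [intervalIntegral.integral_symm b p.2, sub_neg_eq_add]
  rfl

/-- Continuity across the real axis is all that is needed for this term to contribute nothing to the
jump. -/
lemma continuous_greenRest (hq : LocallyIntegrable q volume) {f g : ℝ → C2} (hf : Continuous f)
    (hg : Continuous g) (a b : ℝ) : Continuous (greenRest q θ a b f g) := by
  have hΘ : Continuous fun p : ℂ × ℝ => solTheta q θ p.1 p.2 := continuous_ivpSol hq _
  have hΦ : Continuous fun p : ℂ × ℝ => solPhi q θ p.1 p.2 := continuous_ivpSol hq _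
  have h1 := continuous_bilin hΘ (hg.comp continuous_snd)
  have h2 := continuous_bilin hΦ (hg.comp continuous_snd)
  have h3 := continuous_bilin hΘ ((continuous_conjFn hf).comp continuous_snd)
  have h4 := continuous_bilin hΦ ((continuous_conjFn hf).comp continuous_snd)
  refine intervalIntegral.continuous_parametric_intervalIntegral_of_continuous' ?_ a b
  exact (((continuous_integral_sub_integral h2 a b).mul h3).sub
    ((continuous_integral_sub_integral h1 a b).mul h4)).div_const 2

lemma transformT0_eq_trans (hq : LocallyIntegrable q volume) {f : ℝ → C2} (hf : Continuous f)
    (hs : HasCompactSupport f) (t : ℝ) (j : Fin 2) :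
    transformT0 q θ f t j = trans q θ t f j := by
  have hΘ := (isSolution_solTheta (θ := θ) hq (t : ℂ)).1.continuous
  have hΦ := (isSolution_solPhi (θ := θ) hq (t : ℂ)).1.continuous
  have h0 : ∀ x, act (fundMat q θ t x)ᵀ (f x) =
      WithLp.toLp 2 ![bilin (solTheta q θ t x) (f x), bilin (solPhi q θ t x) (f x)] := fun x => by
    apply C2_ext <;> simp [act_apply_zero, act_apply_one, fundMat, bilin]
  have hc : Continuous fun x => act (fundMat q θ t x)ᵀ (f x) := by
    simp only [h0]
    refine (PiLp.continuous_toLp 2 _).comp (continuous_pi ?_)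
    exact Fin.forall_fin_two.2 ⟨continuous_bilin hΘ hf, continuous_bilin hΦ hf⟩
  have hi : Integrable (fun x => act (fundMat q θ t x)ᵀ (f x)) volume :=
    hc.integrable_of_hasCompactSupport
      (hs.mono fun x hx h => hx (by simp only [h, act_zero]))
  have h1 : transformT0 q θ f t j = ∫ x, (act (fundMat q θ t x)ᵀ (f x)) j :=
    ((coordL j).integral_comp_comm hi).symm
  rw [h1]
  simp only [h0]
  fin_cases j <;> simp [trans]

lemma exists_support_subset_Ioc {f : ℝ → C2} (hs : HasCompactSupport f) :
    ∃ N₀ : ℕ, ∀ N ≥ N₀, Function.support f ⊆ Ioc (-(N : ℝ)) N := by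
  obtain ⟨R, hR⟩ := hs.isBounded.subset_ball 0
  obtain ⟨N₀, hN₀⟩ := exists_nat_gt R
  refine ⟨N₀, fun N hN x hx => ?_⟩
  have h1 := hR (subset_tsupport f hx)
  rw [Real.ball_eq_Ioo, zero_sub, zero_add] at h1
  have h2 : (N₀ : ℝ) ≤ N := by exact_mod_cast hN
  exact ⟨by linarith [h1.1], by linarith [h1.2]⟩

lemma hasCompactSupport_conjFn {f : ℝ → C2} (hs : HasCompactSupport f) :
    HasCompactSupport (conjFn f) :=
  hs.mono (support_conjFn_subset subset_rfl)

lemma differentiableAt_reflect {M : ℂ → ℂ} (h : DifferentiableAt ℂ M (conj z)) :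
    DifferentiableAt ℂ (reflect M) z :=
  differentiableAt_conj_conj_iff.2 h

end

end DiracSpectral

end

/-! ### The spectral representation. -/

open DiracSpectral

theorem theorem4p11 (q : ℝ → ℂ) (hq : LocallyIntegrable q volume) (θ l₁ l₂ : ℝ) (hl : l₁ < l₂)
    (hiso : DiracSpectral.IsolatedInterval q θ l₁ l₂)
    (Ω : Matrix (Fin 2) (Fin 2) (ComplexMeasure ℝ))
    (hΩ : DiracSpectral.IsSpectralMatrixMeasure q θ l₁ l₂ Ω)
    (E : DiracSpectral.L2 →L[ℂ] DiracSpectral.L2)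
    (hE : DiracSpectral.IsStoneProjection q l₁ l₂ E)
    (f g : ℝ → DiracSpectral.C2) (hf : DiracSpectral.IsTest f) (hg : DiracSpectral.IsTest g) :
    (∀ j k : Fin 2, (Ω j k).IntegrableOn
      (fun t => DiracSpectral.transformT0 q θ (DiracSpectral.conjFn f) t j *
        DiracSpectral.transformT0 q θ g t k) (Ioc l₁ l₂)) ∧
    inner ℂ hf.toL2 (E hg.toL2) =
      ∑ j : Fin 2, ∑ k : Fin 2,
        ∫ᵛ t in Ioc l₁ l₂, (DiracSpectral.transformT0 q θ (DiracSpectral.conjFn f) t j *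
          DiracSpectral.transformT0 q θ g t k) ∂[ContinuousLinearMap.mul ℝ ℂ; Ω j k] := by
  obtain ⟨Y, hY, δ₀, hδ₀, hspec, ⟨C, hC⟩, -⟩ := hiso
  have hfc := continuous_conjFn hf.1.continuous
  have hfs := hasCompactSupport_conjFn hf.2
  obtain ⟨N₁, hN₁⟩ := exists_support_subset_Ioc hf.2
  obtain ⟨N₂, hN₂⟩ := exists_support_subset_Ioc hg.2
  set N := max N₁ N₂
  have hfN := hN₁ N (le_max_left _ _)
  have hgN := hN₂ N (le_max_right _ _)
  have hdf := differentiable_trans (θ := θ) hq hfc.locallyIntegrable (support_conjFn_subset hfN)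
  have hdg := differentiable_trans (θ := θ) hq hg.1.continuous.locallyIntegrable hgN
  -- Conjugating `f` before transforming makes these weights holomorphic in `z`; on the real axis
  -- they are the integrands of the claim.
  set h : Fin 2 × Fin 2 → ℂ → ℂ :=
    fun i z => trans q θ z (conjFn f) i.1 * trans q θ z g i.2 with hdef
  have hd : ∀ i, Differentiable ℂ (h i) := fun i => (hdf i.1).mul (hdg i.2)
  simp only [transformT0_eq_trans hq hfc hfs, transformT0_eq_trans hq hg.1.continuous hg.2]
  refine ⟨fun j k => integrable_of_continuous_Ioc _
    ((hd (j, k)).continuous.comp Complex.continuous_ofReal) _ _, ?_⟩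
  have hres : ∀ z : ℂ, z.re ∈ Ioo l₁ (l₂ + δ₀) → z.im ≠ 0 → |z.im| < Y →
      z ∉ spec (hamOp q) := fun z h1 h2 h3 hz => h2 (hspec z hz h1.1.le h1.2.le h3.le)
  have hup : ∀ z ∈ Ioo l₁ (l₂ + δ₀) ×ℂ Ioo 0 Y, z ∉ spec (hamOp q) := fun z hz =>
    hres z hz.1 hz.2.1.ne' (by rw [abs_of_pos hz.2.1]; exact hz.2.2)
  have hlow : ∀ z ∈ Ioo l₁ (l₂ + δ₀) ×ℂ Ioo 0 Y, starRingEnd ℂ z ∉ spec (hamOp q) := fun z hz =>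
    hres _ (by simpa using! hz.1) (by simpa using! hz.2.1.ne')
      (by rw [Complex.conj_im, abs_neg, abs_of_pos hz.2.1]; exact hz.2.2)
  have hbd : ∀ z ∈ Ioo l₁ (l₂ + δ₀) ×ℂ Ioo 0 Y, ∀ j k, ‖weylM q θ z j k‖ ≤ C / z.im := by
    intro z hz j k
    have h1 := hC z.re ⟨hz.1.1.le, hz.1.2.le⟩ z.im hz.2.1 hz.2.2.le j k
    rw [Complex.re_add_im] at h1
    rwa [le_div_iff₀ hz.2.1, mul_comm]
  have hgreen : ∀ z, z ∉ spec (hamOp q) → inner ℂ hf.toL2 (resolventOp (hamOp q) z hg.toL2) =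
      ∑ i, h i z * weylM q θ z i.1 i.2 + greenRest q θ (-(N : ℝ)) N f g z := by
    intro z hz
    refine (inner_resolventOp (θ := θ) hq hz _ _ hfN hgN).trans ?_
    simp only [hdef, Fintype.sum_prod_type, Fin.sum_univ_two, dotProduct, Matrix.mulVec]
    ring
  -- The margin `δ₀` beyond `l₂` leaves room for the intervals shifted by `δ`.
  have key := eq_sum_integral_of_hasIteratedLimit (l₁ := l₁) (l₂ := l₂) (b := l₂ + δ₀) (Y := Y)
    (C := C) (ι := Fin 2 × Fin 2) (M := fun i z => weylM q θ z i.1 i.2) (h := h)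
    (h' := fun i => deriv (h i)) (h'' := fun i => deriv (deriv (h i)))
    (r := fun z => inner ℂ hf.toL2 (resolventOp (hamOp q) z hg.toL2))
    (e := greenRest q θ (-(N : ℝ)) N f g) (Ω := fun i => Ω i.1 i.2)
    (R := inner ℂ hf.toL2 (E hg.toL2)) hl (by linarith) hY
    (fun i z hz => (differentiableAt_weylM hq (hup z hz) _ _).differentiableWithinAt)
    (fun i z hz => (differentiableAt_reflect
      (differentiableAt_weylM hq (hlow z hz) _ _)).differentiableWithinAt)
    (fun i z hz => hbd z hz _ _)
    (fun i z hz => by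
      obtain ⟨R, hR⟩ := not_not.1 (hup z hz)
      obtain ⟨j, k, h1⟩ := weylM_conj (θ := θ) hq
        (exists_isWeylPair hq (exists_sum_memLp hq hR)) i.1 i.2
      rw [reflect, RCLike.norm_conj, h1]
      exact hbd z hz j k)
    (fun i z => (hd i z).hasDerivAt) (fun i z => ((hd i).deriv z).hasDerivAt)
    (fun i z => (hd i).deriv.deriv z)
    (continuous_greenRest hq hf.1.continuous hg.1.continuous _ _)
    (fun z hz => (differentiableAt_inner_resolventOp (hup z hz) _ _).differentiableWithinAt)
    (fun z hz => (differentiableAt_reflect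
      (differentiableAt_inner_resolventOp (hlow z hz) _ _)).differentiableWithinAt)
    (fun z hz => hgreen z (hup z hz)) (fun z hz => hgreen _ (hlow z hz))
    (fun i x y hx hxy hy => hΩ x y hx hxy hy i.1 i.2)
    (by
      have := hE.2 f g hf hg
      simpa only [_root_.sub_apply, inner_sub_right] using this)
  rw [key, Fintype.sum_prod_type]
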